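/- A *(stable) tropical curve* of genus $g$ with $n$ marked points is a quadruple $\Gamma=(G,l,m,w)$, where $G$ is a finite connected multigraph (loops and multiple edges allowed), $l\colon E(G)\to\mathbb{R}_{>0}$, $m\colon\{1,\dots,n\}\to V(G)$ and $w\colon V(G)\to\mathbb{Z}_{\ge 0}$ are functions with $2w(v)-2+\operatorname{val}(v)+|m^{-1}(v)|>0$ for every vertex $v$ (a loop at $v$ contributes $2$ to $\operatorname{val}(v)$), and $|E(G)|-|V(G)|+1+\sum_v w(v)=g$. The triple $\mathbf{G}=(G,m,w)$ is its *combinatorial type*. For $S\subseteq E(G)$, the type $\mathbf{G}/S$ is obtained by contracting the edges in $S$ one after the other, where contracting a loop at $v$ deletes it and increases $w(v)$ by $1$, and contracting a nonloop edge identifies its endpoints and adds their weights. Let $M^{\mathrm{trop}}_{g,n}$ be the colimit, in topological spaces, of the cones $\overline{C}(\mathbf{G})=\mathbb{R}_{\ge 0}^{E(G)}$ over all combinatorial types $\mathbf{G}$ of genus $g$ with $n$ marked points, along the face identifications $\overline{C}(\mathbf{G}')\to\overline{C}(\mathbf{G})$ given by all isomorphisms $\mathbf{G}'\cong\mathbf{G}/S$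 (transport a length function along the isomorphism and extend it by zero on $S$). Its points correspond to the isomorphism classes of such tropical curves. The *bridge locus* $B_{g,n}[1]\subseteq M^{\mathrm{trop}}_{g,n}$ is the subspace of points of total edge length $1$ in the closure of the set of tropical curves having a bridge (an edge whose deletion disconnects $G$). **Theorem.** For every $n\ge 0$, the bridge locus $B_{2,n}[1]$ is contractible. -/

import Mathlib

open scoped NNReal

noncomputable section

namespace TropicalCurve

/-- A finite multigraph (loops and multiple edges allowed) with `n` marked points and vertex
weights. No connectedness, stability or genus condition is imposed here. -/
structure MarkedGraph (n : ℕ) where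
  /-- vertices -/
  V : Type
  /-- edges -/
  E : Type
  [fintypeV : Fintype V]
  [fintypeE : Fintype E]
  /-- the unordered pair of endpoints of an edge -/
  ends : E → Sym2 V
  /-- the marking function -/
  m : Fin n → V
  /-- the vertex weights -/
  w : V → ℕ

attribute [instance] MarkedGraph.fintypeV MarkedGraph.fintypeE

namespace MarkedGraph

variable {n : ℕ}

/-- The simple graph on the vertices of `G` in which two distinct vertices are adjacent if they are
joined by an edge in `S`; it has the same connected components as the subgraph of `G` with all
vertices of `G` and edge set `S`. -/
def edgeGraph (G : MarkedGraph n) (S : Set G.E) : SimpleGraph G.V where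
  Adj u v := u ≠ v ∧ ∃ e ∈ S, G.ends e = s(u, v)
  symm := ⟨fun _ _ h => ⟨h.1.symm, by
    obtain ⟨e, he, h'⟩ := h.2
    exact ⟨e, he, h'.trans Sym2.eq_swap⟩⟩⟩
  loopless := ⟨fun _ h => h.1 rfl⟩

/-- `G` is nonempty and connected. -/
def Connected (G : MarkedGraph n) : Prop := (G.edgeGraph Set.univ).Connected

/-- An edge is a bridge if its deletion disconnects the graph. -/
def IsBridge (G : MarkedGraph n) (e : G.E) : Prop := ¬ (G.edgeGraph {e}ᶜ).Connected

open Classical in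
/-- The number of half-edges at `v`: loops count twice. -/
def valence (G : MarkedGraph n) (v : G.V) : ℕ :=
  Fintype.card {e : G.E // v ∈ G.ends e} + Fintype.card {e : G.E // G.ends e = s(v, v)}

open Classical in
/-- The stability condition `2 w(v) - 2 + val(v) + |m⁻¹(v)| > 0` at every vertex. -/
def Stable (G : MarkedGraph n) : Prop :=
  ∀ v : G.V,
    0 < 2 * (G.w v : ℤ) - 2 + (G.valence v : ℤ) + (Fintype.card {i : Fin n // G.m i = v} : ℤ)

/-- The genus `|E| - |V| + 1 + ∑ w(v)`. -/
def genus (G : MarkedGraph n) : ℤ :=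
  (Fintype.card G.E : ℤ) - (Fintype.card G.V : ℤ) + 1 + ∑ v, (G.w v : ℤ)

/-- An isomorphism: a multigraph isomorphism preserving markings and weights. -/
structure Iso (G H : MarkedGraph n) where
  /-- the bijection on vertices -/
  vert : G.V ≃ H.V
  /-- the bijection on edges -/
  edge : G.E ≃ H.E
  ends_edge : ∀ e, H.ends (edge e) = (G.ends e).map vert
  m_vert : ∀ i, H.m i = vert (G.m i)
  w_vert : ∀ v, H.w (vert v) = G.w v

open Classical in
/-- The contraction `G / S` of all edges in `S`. Its vertices are the connected components of the
subgraph with edge set `S`. The weight of a component `c` is the total weight of its vertices plus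
its first Betti number `|S_c| + 1 - |V_c|`, where `V_c` and `S_c` are the vertices and edges of `c`
(the subtraction does not truncate, as `c` is connected): contracting a loop adds one to the weight
of its base vertex, and contracting a nonloop edge adds the weights of its ends. -/
def contract (G : MarkedGraph n) (S : Set G.E) : MarkedGraph n where
  V := (G.edgeGraph S).ConnectedComponent
  E := {e : G.E // e ∉ S}
  fintypeV := Fintype.ofFinite _
  fintypeE := Fintype.ofFinite _
  ends e := (G.ends e.1).map (G.edgeGraph S).connectedComponentMk
  m i := (G.edgeGraph S).connectedComponentMk (G.m i)
  w c :=
    (∑ v : {v : G.V // (G.edgeGraph S).connectedComponentMk v = c}, G.w v.1) +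
      (Fintype.card {e : G.E //
          e ∈ S ∧ ∃ v ∈ G.ends e, (G.edgeGraph S).connectedComponentMk v = c} + 1 -
        Fintype.card {v : G.V // (G.edgeGraph S).connectedComponentMk v = c})

end MarkedGraph

/-- The combinatorial types of stable tropical curves of genus `g` with `n` marked points. -/
structure CombType (g n : ℕ) extends MarkedGraph n where
  connected : toMarkedGraph.Connected
  stable : toMarkedGraph.Stable
  genus_eq : toMarkedGraph.genus = (g : ℤ)

variable {g n : ℕ}

/-- The closed cone of nonnegative length functions on the edges. -/
abbrev Cone (G : CombType g n) : Type := G.E → ℝ≥0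

open Classical in
/-- The face identification attached to an isomorphism `α : G' ≅ G / S`: it extends a length
function on `G'`, transported along `α`, by zero on `S`. -/
def faceMap {G' G : CombType g n} (S : Set G.E)
    (α : G'.toMarkedGraph.Iso (G.toMarkedGraph.contract S)) (l' : Cone G') : Cone G :=
  fun e => if h : e ∈ S then 0 else l' (α.edge.symm ⟨e, h⟩)

/-- A point of one cone is related to its images under all face identifications. -/
inductive FaceRel (g n : ℕ) :
    (Σ G : CombType g n, Cone G) → (Σ G : CombType g n, Cone G) → Prop
  | face {G' G : CombType g n} (S : Set G.E)
      (α : G'.toMarkedGraph.Iso (G.toMarkedGraph.contract S)) (l' : Cone G') :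
      FaceRel g n ⟨G', l'⟩ ⟨G, faceMap S α l'⟩

/-- The moduli space of tropical curves: the topological colimit of the cones along all face
identifications, that is, the quotient of their disjoint union by the equivalence relation
generated by `FaceRel`, with the quotient topology. -/
def Mtrop (g n : ℕ) : Type 1 := Quot (FaceRel g n)

instance (g n : ℕ) : TopologicalSpace (Mtrop g n) :=
  inferInstanceAs (TopologicalSpace (Quot (FaceRel g n)))

/-- The canonical map from a cone to the moduli space. -/
def Mtrop.mk (G : CombType g n) (l : Cone G) : Mtrop g n := Quot.mk _ ⟨G, l⟩

theorem sum_faceMap {G' G : CombType g n} (S : Set G.E)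
    (α : G'.toMarkedGraph.Iso (G.toMarkedGraph.contract S)) (l' : Cone G') :
    ∑ e, faceMap S α l' e = ∑ e, l' e := by
  classical
  have h0 : ∀ e, e ∉ Finset.univ.filter (· ∉ S) → faceMap S α l' e = 0 := by
    intro e he
    have he' : e ∈ S := by simpa using he
    simp [faceMap, he']
  rw [← Finset.sum_subset (Finset.subset_univ (Finset.univ.filter (· ∉ S)))
    (fun e _ he => h0 e he)]
  refine (Finset.sum_bij (fun e _ => (α.edge e).1) ?_ ?_ ?_ ?_).symm
  · intro e _
    simpa using (α.edge e).2
  · intro a _ b _ h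
    exact α.edge.injective (Subtype.ext h)
  · intro e he
    have he' : e ∉ S := by simpa using he
    refine ⟨α.edge.symm ⟨e, he'⟩, Finset.mem_univ _, ?_⟩
    exact congrArg Subtype.val (α.edge.apply_symm_apply ⟨e, he'⟩)
  · intro e _
    have he : (α.edge e).1 ∉ S := (α.edge e).2
    have h2 : (⟨(α.edge e).1, he⟩ : (G.toMarkedGraph.contract S).E) = α.edge e := rfl
    simp only [faceMap, he, dite_false]
    rw [h2, Equiv.symm_apply_apply]

/-- The total length of a tropical curve. -/
def Mtrop.totalLength : Mtrop g n → ℝ≥0 :=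
  Quot.lift (fun x => ∑ e, x.2 e) (by
    rintro _ _ ⟨S, α, l'⟩
    exact (sum_faceMap S α l').symm)

/-- The tropical curves containing a bridge. A tropical curve is a combinatorial type with a
strictly positive length function. -/
def curvesWithBridge (g n : ℕ) : Set (Mtrop g n) :=
  {x | ∃ (G : CombType g n) (l : Cone G),
    (∀ e, 0 < l e) ∧ (∃ e, G.toMarkedGraph.IsBridge e) ∧ x = Mtrop.mk G l}

/-- The closure in the moduli space of the set of tropical curves containing a bridge. -/
def bridgeClosure (g n : ℕ) : Set (Mtrop g n) := closure (curvesWithBridge g n)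

/-- The bridge locus: the points of total length one in the closure of the set of tropical curves
containing a bridge. -/
def bridgeLocus (g n : ℕ) : Set (Mtrop g n) :=
  {x | x ∈ bridgeClosure g n ∧ x.totalLength = 1}

end TropicalCurve

end

/-! The length of edges that are not bridges can be traded for length of a bridge. By
`bridgeClosure_eq` the points of the closure are those represented by contractions of graphs with a
bridge. These types are filtered by the number of non-bridges; types all of whose edges are loops or
bridges belong to every stage. On any other type with exactly k + 1 non-bridges, all non-bridges are
shortened at the same speed until the shortest one vanishes, and the lost length is spent on a
bridge along which a part of the graph is pulled away from a vertex. The total length is kept and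
the curve ends in stage k. Where a non-bridge already has length zero the flow is stationary, so it
is compatible with passing to faces. This is `contractible_stage`; by `ncard_nonBridges_le` finitely
many stages suffice.

The part to be pulled away must be respected by isomorphisms and by collapsing bridges. Once all
bridges are collapsed, genus two means that the numbers `exc` are nonnegative with sum two. If one
vertex has `exc` two, some part of the graph hangs on it by exactly two edges
(`exists_cand_of_exc`). Otherwise two vertices have `exc` one and the graph is a subdivided theta;
since it degenerates from a graph with a bridge, some vertex carries two marked points
(`exists_two_marks`), and the complement of such a vertex is pulled away. In both cases the side is
determined by the marked points on it (`Cand.eq_of_marks`). Isomorphisms fix marked points, so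
choosing a set of marked points (`label`) is canonical. The edges of the cut also meet in one vertex
before the bridges are collapsed (`exists_apex`), and pulling commutes with contractions
(`pullPoint_contr`).

In the bottom stage, replacing weights by loops of length zero gives a tree of bridges carrying
exactly two loops. Shrinking the bridges and moving both loop lengths to one half contracts this
stage to a figure eight (`contractible_stage_zero`).

All homotopies are glued from maps on simplices: `isQuotientMap_sliceMap` identifies the subspace
topology with a quotient topology, and `exists_slice_lift` carries this over to products with the
interval. -/

noncomputable section

namespace TropicalCurve

open scoped Classical

variable {g n : ℕ}

/-! ### Half-edges, stability degree and genus -/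

namespace MarkedGraph

/-- One endpoint of an edge, chosen arbitrarily. -/
def src (G : MarkedGraph n) (e : G.E) : G.V := (Quot.out (G.ends e)).1

/-- The other endpoint of an edge. -/
def tgt (G : MarkedGraph n) (e : G.E) : G.V := (Quot.out (G.ends e)).2

theorem ends_eq (G : MarkedGraph n) (e : G.E) : G.ends e = s(G.src e, G.tgt e) :=
  (Quot.out_eq (G.ends e)).symm

theorem mem_ends (G : MarkedGraph n) {e : G.E} {v : G.V} :
    v ∈ G.ends e ↔ G.src e = v ∨ G.tgt e = v := by
  rw [ends_eq, Sym2.mem_iff]; tauto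

theorem src_mem (G : MarkedGraph n) (e : G.E) : G.src e ∈ G.ends e := by simp [mem_ends]

theorem tgt_mem (G : MarkedGraph n) (e : G.E) : G.tgt e ∈ G.ends e := by simp [mem_ends]

/-- The number of half-edges of `e` at `v`. -/
def half (G : MarkedGraph n) (e : G.E) (v : G.V) : ℤ :=
  (if G.src e = v then 1 else 0) + (if G.tgt e = v then 1 else 0)

theorem half_eq_of_ends (G : MarkedGraph n) {e : G.E} {a b : G.V} (h : G.ends e = s(a, b))
    (v : G.V) : G.half e v = (if a = v then 1 else 0) + (if b = v then 1 else 0) := by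
  rw [ends_eq, Sym2.eq_iff] at h
  rcases h with ⟨h1, h2⟩ | ⟨h1, h2⟩ <;> simp [half, h1, h2, add_comm]

theorem half_nonneg (G : MarkedGraph n) (e : G.E) (v : G.V) : 0 ≤ G.half e v := by
  unfold half; split_ifs <;> simp

theorem half_eq_zero (G : MarkedGraph n) {e : G.E} {v : G.V} :
    G.half e v = 0 ↔ v ∉ G.ends e := by
  rw [mem_ends]; unfold half; split_ifs <;> simp_all

theorem half_pos (G : MarkedGraph n) {e : G.E} {v : G.V} (h : v ∈ G.ends e) :
    1 ≤ G.half e v := by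
  rw [mem_ends] at h; unfold half; split_ifs <;> simp_all

theorem valence_eq (G : MarkedGraph n) (v : G.V) :
    (G.valence v : ℤ) = ∑ e, G.half e v := by
  have h : ∀ e, G.half e v = (if v ∈ G.ends e then 1 else 0) +
      (if G.ends e = s(v, v) then 1 else 0) := by
    intro e
    simp only [ends_eq, Sym2.eq_iff, Sym2.mem_iff, eq_comm (a := v)]
    unfold half
    split_ifs <;> simp_all
  simp only [h, Finset.sum_add_distrib, valence, Fintype.card_subtype, Finset.sum_boole]
  push_cast
  rfl

/-- The number of marked points at a vertex. -/
def marks (G : MarkedGraph n) (v : G.V) : ℤ := (Fintype.card {i : Fin n // G.m i = v} : ℤ)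

theorem marks_eq (G : MarkedGraph n) (v : G.V) :
    G.marks v = ∑ i, if G.m i = v then 1 else 0 := by
  simp [marks, Fintype.card_subtype]

theorem marks_nonneg (G : MarkedGraph n) (v : G.V) : 0 ≤ G.marks v := by simp [marks]

/-- The quantity `2 w(v) - 2 + val(v) + |m⁻¹(v)|` that stability requires to be positive. -/
def deg (G : MarkedGraph n) (v : G.V) : ℤ :=
  2 * (G.w v : ℤ) - 2 + (G.valence v : ℤ) + G.marks v

theorem stable_iff (G : MarkedGraph n) : G.Stable ↔ ∀ v, 0 < G.deg v := Iff.rfl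

theorem sum_fiber_ite {α β : Type*} [Fintype α] (f : α → β) (x : β) (a : α) :
    (∑ v with f v = x, if a = v then (1 : ℤ) else 0) = if f a = x then 1 else 0 := by
  rw [Finset.sum_ite_eq]; simp

theorem sum_half_fiber (G : MarkedGraph n) {W : Type*} (f : G.V → W) (x : W) (e : G.E) :
    ∑ v with f v = x, G.half e v =
      (if f (G.src e) = x then 1 else 0) + (if f (G.tgt e) = x then 1 else 0) := by
  simp only [half, Finset.sum_add_distrib]
  rw [sum_fiber_ite, sum_fiber_ite]

theorem sum_marks_fiber (G : MarkedGraph n) {W : Type*} (f : G.V → W) (x : W) :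
    ∑ v with f v = x, G.marks v = ∑ i, if f (G.m i) = x then 1 else 0 := by
  simp only [marks_eq]
  rw [Finset.sum_comm]
  exact Finset.sum_congr rfl fun i _ => sum_fiber_ite f x _

theorem sum_half (G : MarkedGraph n) (e : G.E) : ∑ v, G.half e v = 2 := by
  have := G.sum_half_fiber (fun _ => ()) () e
  simpa using this

theorem sum_marks (G : MarkedGraph n) : ∑ v, G.marks v = n := by
  have := G.sum_marks_fiber (fun _ => ()) ()
  simpa using this

theorem sum_valence (G : MarkedGraph n) :
    ∑ v, (G.valence v : ℤ) = 2 * Fintype.card G.E := by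
  simp only [valence_eq]
  rw [Finset.sum_comm]
  simp [sum_half, mul_comm]

/-- Every edge has two half-edges, so the sum sees only the genus and `n`. Hence a contraction along
which `deg` adds up over fibres preserves the genus, and it visibly preserves stability. -/
theorem sum_deg (G : MarkedGraph n) : ∑ v, G.deg v = 2 * (G.genus - 1) + n := by
  simp only [deg, Finset.sum_add_distrib, Finset.sum_sub_distrib, sum_marks, sum_valence,
    ← Finset.mul_sum, genus]
  simp
  ring

/-! ### Reachability, cuts and bridges -/

/-- Vertices joined by edges in `T`. -/
abbrev Reach (G : MarkedGraph n) (T : Set G.E) (u v : G.V) : Prop :=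
  (G.edgeGraph T).Reachable u v

theorem reach_ends (G : MarkedGraph n) {T : Set G.E} {e : G.E} (he : e ∈ T) {u v : G.V}
    (hu : u ∈ G.ends e) (hv : v ∈ G.ends e) : G.Reach T u v := by
  by_cases h : u = v
  · exact h ▸ SimpleGraph.Reachable.refl _
  · refine SimpleGraph.Adj.reachable (G := G.edgeGraph T) ⟨h, e, he, ?_⟩
    exact (Sym2.mem_and_mem_iff h).1 ⟨hu, hv⟩

theorem reach_induction (G : MarkedGraph n) {T : Set G.E} {R : G.V → G.V → Prop}
    (hR : Equivalence R) (h : ∀ e ∈ T, R (G.src e) (G.tgt e)) {u v : G.V}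
    (huv : G.Reach T u v) : R u v := by
  obtain ⟨p⟩ := huv
  induction p with
  | nil => exact hR.refl _
  | cons hadj _ ih =>
    refine hR.trans ?_ ih
    obtain ⟨_, e, he, h'⟩ := hadj
    have := h e he
    rw [ends_eq, Sym2.eq_iff] at h'
    rcases h' with ⟨h1, h2⟩ | ⟨h1, h2⟩
    · rwa [h1, h2] at this
    · rw [h1, h2] at this; exact hR.symm this

theorem reach_equivalence (G : MarkedGraph n) (T : Set G.E) : Equivalence (G.Reach T) :=
  (G.edgeGraph T).reachable_is_equivalence

theorem reach_mono (G : MarkedGraph n) {T T' : Set G.E} (h : T ⊆ T') {u v : G.V}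
    (huv : G.Reach T u v) : G.Reach T' u v :=
  G.reach_induction (G.reach_equivalence T')
    (fun e he => G.reach_ends (h he) (G.src_mem e) (G.tgt_mem e)) huv

theorem reach_map (G : MarkedGraph n) (H : MarkedGraph n) {T : Set G.E} {T' : Set H.E}
    (f : G.V → H.V) (h : ∀ e ∈ T, H.Reach T' (f (G.src e)) (f (G.tgt e))) {u v : G.V}
    (huv : G.Reach T u v) : H.Reach T' (f u) (f v) :=
  G.reach_induction (R := fun a b => H.Reach T' (f a) (f b))
    ⟨fun _ => SimpleGraph.Reachable.refl _, fun h => h.symm, fun h h' => h.trans h'⟩ h huv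

theorem connected_iff (G : MarkedGraph n) (T : Set G.E) :
    (G.edgeGraph T).Connected ↔ Nonempty G.V ∧ ∀ u v, G.Reach T u v := by
  rw [SimpleGraph.connected_iff]
  exact and_comm

/-- The edges with exactly one endpoint in `A`. -/
def bdry (G : MarkedGraph n) (A : Set G.V) : Set G.E := {e | ¬ (G.src e ∈ A ↔ G.tgt e ∈ A)}

theorem mem_bdry_of_ends (G : MarkedGraph n) {A : Set G.V} {e : G.E} {a b : G.V}
    (h : G.ends e = s(a, b)) : e ∈ G.bdry A ↔ ¬ (a ∈ A ↔ b ∈ A) := by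
  rw [ends_eq, Sym2.eq_iff] at h
  rcases h with ⟨h1, h2⟩ | ⟨h1, h2⟩
  · simp [bdry, h1, h2]
  · simp only [bdry, Set.mem_ofPred_eq, h1, h2]; tauto

theorem mem_bdry_iff (G : MarkedGraph n) {A : Set G.V} {e : G.E} :
    e ∈ G.bdry A ↔ ∃ a ∈ A, ∃ b ∉ A, G.ends e = s(a, b) := by
  constructor
  · intro h
    by_cases ha : G.src e ∈ A
    · exact ⟨_, ha, G.tgt e, fun hb => h ⟨fun _ => hb, fun _ => ha⟩, G.ends_eq e⟩
    · refine ⟨G.tgt e, ?_, _, ha, (G.ends_eq e).trans Sym2.eq_swap⟩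
      by_contra hb
      exact h ⟨fun h => absurd h ha, fun h => absurd h hb⟩
  · rintro ⟨a, ha, b, hb, h⟩
    rw [G.mem_bdry_of_ends h]; tauto

theorem not_mem_bdry (G : MarkedGraph n) {A : Set G.V} {e : G.E} (h : e ∉ G.bdry A)
    {u v : G.V} (hu : u ∈ G.ends e) (hv : v ∈ G.ends e) : u ∈ A ↔ v ∈ A := by
  simp only [bdry, Set.mem_ofPred_eq, not_not] at h
  rw [mem_ends] at hu hv
  rcases hu with rfl | rfl <;> rcases hv with rfl | rfl <;> tauto

theorem mem_iff_of_reach (G : MarkedGraph n) {A : Set G.V} {T : Set G.E}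
    (h : ∀ e ∈ T, e ∉ G.bdry A) {u v : G.V} (huv : G.Reach T u v) : u ∈ A ↔ v ∈ A :=
  G.reach_induction (R := fun a b => (a ∈ A ↔ b ∈ A))
    ⟨fun _ => Iff.rfl, fun h => h.symm, fun h h' => h.trans h'⟩
    (fun e he => G.not_mem_bdry (h e he) (G.src_mem e) (G.tgt_mem e)) huv

theorem not_mem_bdry_reach (G : MarkedGraph n) {T : Set G.E} {e : G.E} (he : e ∈ T) (u : G.V) :
    e ∉ G.bdry {v | G.Reach T u v} := by
  have := G.reach_ends he (G.src_mem e) (G.tgt_mem e)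
  simp only [bdry, Set.mem_ofPred_eq, not_not]
  exact ⟨fun h => h.trans this, fun h => h.trans this.symm⟩

theorem bdry_nonempty {G : MarkedGraph n} (hG : G.Connected) {A : Set G.V} {u v : G.V}
    (hu : u ∈ A) (hv : v ∉ A) : (G.bdry A).Nonempty := by
  by_contra h
  rw [Set.not_nonempty_iff_eq_empty] at h
  have := (G.connected_iff _).1 hG
  exact hv ((G.mem_iff_of_reach (A := A) (by simp [h]) (this.2 u v)).1 hu)

/-- The component of a vertex after deleting a bridge has only that edge in its boundary. The
description by cuts is the useful one because cuts pull back along contractions. -/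
theorem isBridge_iff {G : MarkedGraph n} (hG : G.Connected) (e : G.E) :
    G.IsBridge e ↔ ∃ A, G.bdry A = {e} := by
  have hc := (G.connected_iff _).1 hG
  rw [IsBridge, connected_iff]
  constructor
  · intro h
    have h : ¬ ∀ u v, G.Reach {e}ᶜ u v := fun h' => h ⟨hc.1, h'⟩
    push Not at h
    obtain ⟨u, v, huv⟩ := h
    refine ⟨{v | G.Reach {e}ᶜ u v}, ?_⟩
    have hne : (G.bdry {v | G.Reach {e}ᶜ u v}).Nonempty :=
      bdry_nonempty hG (u := u) (v := v) (SimpleGraph.Reachable.refl _) huv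
    refine (Set.Nonempty.subset_singleton_iff hne).1 ?_
    intro f hf
    by_contra hfe
    exact G.not_mem_bdry_reach (T := {e}ᶜ) hfe u hf
  · rintro ⟨A, hA⟩ ⟨_, h⟩
    have he : e ∈ G.bdry A := by simp [hA]
    obtain ⟨a, ha, b, hb, _⟩ := G.mem_bdry_iff.1 he
    exact hb ((G.mem_iff_of_reach (A := A) (T := {e}ᶜ) (by simp [hA]) (h a b)).1 ha)

/-! ### Contractions as morphisms -/

/-- A contraction `G → H`: it collapses the edges outside the range of `edge`. The weights enter
through the additivity of `deg`. -/
structure Contr (G H : MarkedGraph n) where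
  /-- the map on vertices -/
  vert : G.V → H.V
  /-- the embedding of the remaining edges -/
  edge : H.E → G.E
  edge_inj : Function.Injective edge
  vert_surj : Function.Surjective vert
  ends_edge : ∀ e, H.ends e = (G.ends (edge e)).map vert
  vert_const : ∀ e, e ∉ Set.range edge → vert (G.src e) = vert (G.tgt e)
  m_vert : ∀ i, H.m i = vert (G.m i)
  fiber : ∀ u v, vert u = vert v → G.Reach (Set.range edge)ᶜ u v
  deg_eq : ∀ x, H.deg x = ∑ v with vert v = x, G.deg v

namespace Contr

variable {G H K : MarkedGraph n}

theorem ends_edge' (c : Contr G H) (e : H.E) :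
    H.ends e = s(c.vert (G.src (c.edge e)), c.vert (G.tgt (c.edge e))) := by
  rw [c.ends_edge, ends_eq]; rfl

theorem vert_eq_of_mem (c : Contr G H) {e : G.E} (he : e ∉ Set.range c.edge) {u v : G.V}
    (hu : u ∈ G.ends e) (hv : v ∈ G.ends e) : c.vert u = c.vert v := by
  have := c.vert_const e he
  rw [mem_ends] at hu hv
  rcases hu with rfl | rfl <;> rcases hv with rfl | rfl <;> simp_all

theorem vert_eq_of_reach (c : Contr G H) {T : Set G.E} (hT : ∀ e ∈ T, e ∉ Set.range c.edge)
    {u v : G.V} (h : G.Reach T u v) : c.vert u = c.vert v :=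
  G.reach_induction (R := fun a b => c.vert a = c.vert b)
    ⟨fun _ => rfl, fun h => h.symm, fun h h' => h.trans h'⟩
    (fun e he => c.vert_const e (hT e he)) h

theorem half_eq (c : Contr G H) (e : H.E) (x : H.V) :
    H.half e x = ∑ v with c.vert v = x, G.half (c.edge e) v := by
  rw [sum_half_fiber, half_eq_of_ends _ (c.ends_edge' e)]

theorem marks_eq (c : Contr G H) (x : H.V) :
    H.marks x = ∑ v with c.vert v = x, G.marks v := by
  rw [sum_marks_fiber, MarkedGraph.marks_eq]
  simp [c.m_vert]

theorem sum_deg_eq (c : Contr G H) : ∑ x, H.deg x = ∑ v, G.deg v := by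
  simp only [c.deg_eq]
  exact Finset.sum_fiberwise _ _ _

theorem genus_eq (c : Contr G H) : H.genus = G.genus := by
  have h := c.sum_deg_eq
  rw [sum_deg, sum_deg] at h
  linarith

theorem reach_vert (c : Contr G H) {T : Set H.E} {T' : Set G.E}
    (hT : ∀ e ∈ T', e ∈ Set.range c.edge → e ∈ c.edge '' T) {u v : G.V}
    (h : G.Reach T' u v) : H.Reach T (c.vert u) (c.vert v) := by
  refine reach_map _ _ c.vert ?_ h
  intro e he
  by_cases her : e ∈ Set.range c.edge
  · obtain ⟨f, hf, rfl⟩ := hT e he her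
    refine H.reach_ends hf ?_ ?_ <;> simp [c.ends_edge' f]
  · rw [c.vert_const e her]

theorem connected (c : Contr G H) (hG : G.Connected) : H.Connected := by
  have h := (G.connected_iff _).1 hG
  refine (H.connected_iff _).2 ⟨h.1.map c.vert, fun x y => ?_⟩
  obtain ⟨u, rfl⟩ := c.vert_surj x
  obtain ⟨v, rfl⟩ := c.vert_surj y
  exact c.reach_vert (by simp) (h.2 u v)

theorem stable (c : Contr G H) (hG : G.Stable) : H.Stable := by
  rw [stable_iff] at hG ⊢
  intro x
  rw [c.deg_eq]
  obtain ⟨u, rfl⟩ := c.vert_surj x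
  exact Finset.sum_pos (fun v _ => hG v) ⟨u, by simp⟩

/-- The identity contraction. -/
def refl (G : MarkedGraph n) : Contr G G where
  vert := id
  edge := id
  edge_inj := Function.injective_id
  vert_surj := Function.surjective_id
  ends_edge := by simp
  vert_const := by simp
  m_vert := by simp
  fiber := by rintro u _ rfl; exact SimpleGraph.Reachable.refl _
  deg_eq x := by
    have : (Finset.univ.filter fun v : G.V => id v = x) = {x} := by ext; simp
    rw [this, Finset.sum_singleton]

/-- A walk in `H` is lifted edge by edge through a section of the vertex map; the gaps between
consecutive lifts lie in fibres, which are connected by collapsed edges. -/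
theorem reach_lift (c : Contr G H) {T : Set H.E} {T' : Set G.E} (hS : (Set.range c.edge)ᶜ ⊆ T')
    (hT : c.edge '' T ⊆ T') {u v : G.V} (h : H.Reach T (c.vert u) (c.vert v)) :
    G.Reach T' u v := by
  have key : ∀ x y, H.Reach T x y → ∀ u v, c.vert u = x → c.vert v = y → G.Reach T' u v := by
    intro x y hxy
    choose s hs using c.vert_surj
    have hfib : ∀ u v, c.vert u = c.vert v → G.Reach T' u v := fun u v h =>
      G.reach_mono hS (c.fiber u v h)
    have hss : G.Reach T' (s x) (s y) := by
      refine reach_map H G s ?_ hxy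
      intro e he
      have he' := c.ends_edge' e
      rw [ends_eq, Sym2.eq_iff] at he'
      have hst := G.reach_ends (hT ⟨e, he, rfl⟩) (G.src_mem (c.edge e)) (G.tgt_mem (c.edge e))
      rcases he' with ⟨h1, h2⟩ | ⟨h1, h2⟩
      · exact ((hfib _ _ (by rw [hs, h1])).trans hst).trans (hfib _ _ (by rw [hs, h2]))
      · exact ((hfib _ _ (by rw [hs, h1])).trans hst.symm).trans (hfib _ _ (by rw [hs, h2]))
    rintro u v rfl rfl
    exact ((hfib _ _ (by rw [hs])).trans hss).trans (hfib _ _ (by rw [hs]))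
  exact key _ _ h u v rfl rfl

theorem sum_fiber_comp {α β γ : Type*} [Fintype α] [Fintype β] (f : α → β) (h : β → γ) (x : γ)
    (d : α → ℤ) : ∑ v with h (f v) = x, d v = ∑ y with h y = x, ∑ v with f v = y, d v := by
  rw [← Finset.sum_fiberwise_of_maps_to (s := {v | h (f v) = x}) (t := {y | h y = x}) (g := f)]
  · refine Finset.sum_congr rfl fun y hy => Finset.sum_congr ?_ fun _ _ => rfl
    ext v
    simp only [Finset.mem_filter, Finset.mem_univ, true_and] at hy ⊢
    exact ⟨fun h => h.2, fun h' => ⟨by rw [h', hy], h'⟩⟩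
  · intro v hv
    simpa using hv

/-- The composite of two contractions. -/
def comp (c : Contr G H) (d : Contr H K) : Contr G K where
  vert := d.vert ∘ c.vert
  edge := c.edge ∘ d.edge
  edge_inj := c.edge_inj.comp d.edge_inj
  vert_surj := d.vert_surj.comp c.vert_surj
  ends_edge e := by
    rw [d.ends_edge, c.ends_edge, Sym2.map_map]; rfl
  vert_const e he := by
    by_cases h : e ∈ Set.range c.edge
    · obtain ⟨f, rfl⟩ := h
      have hf : f ∉ Set.range d.edge := by
        rintro ⟨x, rfl⟩; exact he ⟨x, rfl⟩
      refine d.vert_eq_of_mem hf ?_ ?_ <;> simp [c.ends_edge' f]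
    · simp [c.vert_const e h]
  m_vert i := by rw [d.m_vert, c.m_vert]; rfl
  fiber u v h := by
    refine c.reach_lift ?_ ?_ (d.fiber _ _ h)
    · intro e he he'
      obtain ⟨x, rfl⟩ := he'
      exact he ⟨_, rfl⟩
    · rintro _ ⟨e, he, rfl⟩ ⟨x, hx⟩
      exact he ⟨x, c.edge_inj hx⟩
  deg_eq x := by
    rw [d.deg_eq]
    simp only [c.deg_eq]
    exact (sum_fiber_comp c.vert d.vert x _).symm

/-- A contraction that collapses more edges factors through one that collapses fewer. -/
theorem exists_factor (c : Contr G H) (c' : Contr G K)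
    (h : Set.range c'.edge ⊆ Set.range c.edge) :
    ∃ d : Contr H K, (∀ v, d.vert (c.vert v) = c'.vert v) ∧ ∀ e, c.edge (d.edge e) = c'.edge e := by
  -- The factor is defined through a section of `c.vert`. The choice is immaterial: a fibre of `c`
  -- is joined by edges that `c'` collapses as well.
  choose s hs using c.vert_surj
  have hv : ∀ v, c'.vert (s (c.vert v)) = c'.vert v := fun v =>
    c'.vert_eq_of_reach (T := (Set.range c.edge)ᶜ) (fun e he he' => he (h he'))
      (c.fiber _ _ (hs _))
  choose t ht using fun e => h ⟨e, rfl⟩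
  refine ⟨⟨fun x => c'.vert (s x), t, ?_, ?_, ?_, ?_, ?_, ?_, ?_⟩, hv, ht⟩
  · intro a b hab
    exact c'.edge_inj (by rw [← ht, ← ht, hab])
  · intro x
    obtain ⟨v, rfl⟩ := c'.vert_surj x
    exact ⟨c.vert v, hv v⟩
  · intro e
    rw [c'.ends_edge, c.ends_edge, Sym2.map_map, ht]
    congr 1
    ext v
    exact (hv v).symm
  · intro e he
    have h1 : c.edge e ∉ Set.range c'.edge := by
      rintro ⟨f, hf⟩
      rw [← ht] at hf
      exact he ⟨f, c.edge_inj hf⟩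
    have h2 := c.ends_edge' e
    rw [ends_eq, Sym2.eq_iff] at h2
    have h3 := c'.vert_const _ h1
    rcases h2 with ⟨h4, h5⟩ | ⟨h4, h5⟩
    · rw [h4, h5, hv, hv, h3]
    · rw [h4, h5, hv, hv, h3]
  · intro i
    rw [c'.m_vert, c.m_vert, hv]
  · intro x y hxy
    have := c'.fiber _ _ hxy
    have := c.reach_vert (T := (Set.range t)ᶜ) ?_ this
    · rwa [hs, hs] at this
    · rintro e he ⟨f, rfl⟩
      refine ⟨f, ?_, rfl⟩
      rintro ⟨x, rfl⟩
      exact he ⟨x, (ht x).symm⟩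
  · intro x
    rw [c'.deg_eq]
    simp only [c.deg_eq]
    rw [← sum_fiber_comp c.vert (fun y => c'.vert (s y)) x]
    simp only [hv]

theorem bdry_preimage (c : Contr G H) (A : Set H.V) :
    G.bdry (c.vert ⁻¹' A) = c.edge '' H.bdry A := by
  ext e
  by_cases he : e ∈ Set.range c.edge
  · obtain ⟨f, rfl⟩ := he
    rw [c.edge_inj.mem_set_image, H.mem_bdry_of_ends (c.ends_edge' f)]
    rfl
  · constructor
    · intro h
      simp [bdry, c.vert_const e he] at h
    · rintro ⟨f, _, rfl⟩
      exact absurd ⟨f, rfl⟩ he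

theorem eq_preimage (c : Contr G H) {A : Set G.V} (hA : G.bdry A ⊆ Set.range c.edge) :
    A = c.vert ⁻¹' (c.vert '' A) := by
  ext v
  constructor
  · exact fun h => ⟨v, h, rfl⟩
  · rintro ⟨u, hu, huv⟩
    exact (G.mem_iff_of_reach (T := (Set.range c.edge)ᶜ) (fun e he he' => he (hA he'))
      (c.fiber _ _ huv)).1 hu

/-- A vertex set whose boundary consists of surviving edges is a union of fibres, so the cuts of `H`
are exactly such cuts of `G`. -/
theorem isBridge_edge (c : Contr G H) (hG : G.Connected) (e : H.E) :
    G.IsBridge (c.edge e) ↔ H.IsBridge e := by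
  rw [isBridge_iff hG, isBridge_iff (c.connected hG)]
  constructor
  · rintro ⟨A, hA⟩
    refine ⟨c.vert '' A, ?_⟩
    have h1 := c.eq_preimage (A := A) (by rw [hA]; rintro _ rfl; exact ⟨e, rfl⟩)
    rw [h1, c.bdry_preimage, ← Set.image_singleton] at hA
    exact c.edge_inj.image_injective hA
  · rintro ⟨A, hA⟩
    exact ⟨c.vert ⁻¹' A, by rw [c.bdry_preimage, hA, Set.image_singleton]⟩

theorem valence_add (c : Contr G H) (x : H.V) :
    ∑ v with c.vert v = x, (G.valence v : ℤ) = H.valence x +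
      2 * ∑ e with e ∉ Set.range c.edge, if c.vert (G.src e) = x then 1 else 0 := by
  simp only [valence_eq]
  rw [Finset.sum_comm, ← Finset.sum_filter_not_add_sum_filter _ (fun e => e ∉ Set.range c.edge)]
  congr 1
  · simp only [not_not, c.half_eq]
    refine (Finset.sum_bij (fun e _ => c.edge e) ?_ ?_ ?_ ?_).symm
    · intro e _; simp
    · intro a _ b _ h; exact c.edge_inj h
    · intro e he
      simp only [Finset.mem_filter, Finset.mem_univ, true_and] at he
      obtain ⟨f, rfl⟩ := he
      exact ⟨f, by simp, rfl⟩
    · intro e _; rfl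
  · rw [Finset.mul_sum]
    refine Finset.sum_congr rfl fun e he => ?_
    simp only [Finset.mem_filter, Finset.mem_univ, true_and] at he
    rw [sum_half_fiber, c.vert_const e he]
    ring

/-- Each collapsed edge has both half-edges in one fibre (`valence_add`), so additivity of `deg`
amounts to the usual rule: total weight plus first Betti number of the fibre. -/
theorem weight_eq (c : Contr G H) (x : H.V) :
    (H.w x : ℤ) = ∑ v with c.vert v = x, (G.w v : ℤ) +
      (∑ e with e ∉ Set.range c.edge, if c.vert (G.src e) = x then 1 else 0) + 1 -
        (∑ v with c.vert v = x, 1) := by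
  have h1 := c.deg_eq x
  have h2 := c.valence_add x
  have h3 := c.marks_eq x
  simp only [deg, Finset.sum_add_distrib, Finset.sum_sub_distrib, ← Finset.mul_sum] at h1
  rw [h2] at h1
  have h4 : ∑ v with c.vert v = x, (2 : ℤ) = 2 * ∑ v with c.vert v = x, 1 := by
    rw [Finset.mul_sum]; rfl
  rw [h4] at h1
  linarith

end Contr

/-! ### The quotient by a set of edges is a contraction -/

/-- A connected graph has at least as many edges as a spanning tree. This is what keeps the natural
subtraction in `contract` from truncating. -/
theorem card_fiber_le (G : MarkedGraph n) (S : Set G.E) (c : (G.edgeGraph S).ConnectedComponent) :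
    Fintype.card {v : G.V // (G.edgeGraph S).connectedComponentMk v = c} ≤
      Fintype.card {e : G.E //
          e ∈ S ∧ ∃ v ∈ G.ends e, (G.edgeGraph S).connectedComponentMk v = c} + 1 := by
  have h := c.connected_toSimpleGraph.card_vert_le_card_edgeSet_add_one
  have h1 : Nat.card c = Fintype.card {v : G.V // (G.edgeGraph S).connectedComponentMk v = c} := by
    rw [← Nat.card_eq_fintype_card]; rfl
  rw [h1] at h
  refine h.trans (Nat.add_le_add_right ?_ 1)
  rw [← Nat.card_eq_fintype_card]
  have hex : ∀ a : c.toSimpleGraph.edgeSet, ∃ e : {e : G.E //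
          e ∈ S ∧ ∃ v ∈ G.ends e, (G.edgeGraph S).connectedComponentMk v = c},
          G.ends e = a.1.map Subtype.val := by
    rintro ⟨a, ha⟩
    induction a with
    | h u v =>
      obtain ⟨_, e, he, hends⟩ := ha
      exact ⟨⟨e, he, u, by rw [hends]; simp, u.2⟩, hends⟩
  choose f hf using hex
  refine Nat.card_le_card_of_injective f ?_
  intro a b hab
  have := (hf a).symm.trans ((congrArg (fun e => G.ends e.1) hab).trans (hf b))
  exact Subtype.ext (Sym2.map.injective Subtype.val_injective this)

/-- The quotient map on vertices of a contraction. -/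
def contractVert (G : MarkedGraph n) (S : Set G.E) : G.V → (G.contract S).V :=
  (G.edgeGraph S).connectedComponentMk

/-- The inclusion of the edges of a contraction. -/
def contractEdge (G : MarkedGraph n) (S : Set G.E) (e : (G.contract S).E) : G.E := e.1

theorem contractVert_eq_iff (G : MarkedGraph n) (S : Set G.E) {u v : G.V} :
    G.contractVert S u = G.contractVert S v ↔ G.Reach S u v :=
  SimpleGraph.ConnectedComponent.eq

theorem contractEdge_injective (G : MarkedGraph n) (S : Set G.E) :
    Function.Injective (G.contractEdge S) := Subtype.val_injective

theorem range_contractEdge (G : MarkedGraph n) (S : Set G.E) :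
    Set.range (G.contractEdge S) = Sᶜ := by
  ext e
  exact ⟨by rintro ⟨f, rfl⟩; exact f.2, fun h => ⟨⟨e, h⟩, rfl⟩⟩

theorem contractVert_src_tgt (G : MarkedGraph n) {S : Set G.E} {e : G.E} (he : e ∈ S) :
    G.contractVert S (G.src e) = G.contractVert S (G.tgt e) :=
  (G.contractVert_eq_iff S).2 (G.reach_ends he (G.src_mem e) (G.tgt_mem e))

theorem contract_w (G : MarkedGraph n) (S : Set G.E) (c : (G.contract S).V) :
    ((G.contract S).w c : ℤ) = ∑ v with G.contractVert S v = c, (G.w v : ℤ) +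
      (∑ e with e ∈ S, if G.contractVert S (G.src e) = c then 1 else 0) + 1 -
        ∑ v with G.contractVert S v = c, 1 := by
  have hcard := G.card_fiber_le S c
  change (((∑ v : {v : G.V // G.contractVert S v = c}, G.w v.1) + _ : ℕ) : ℤ) = _
  rw [Nat.cast_add, Nat.cast_sub hcard]
  have e1 : ((∑ v : {v : G.V // G.contractVert S v = c}, G.w v.1 : ℕ) : ℤ)
      = ∑ v with G.contractVert S v = c, (G.w v : ℤ) := by
    push_cast
    exact (Finset.sum_subtype _ (by simp) (fun v => (G.w v : ℤ))).symm
  have e2 : (Fintype.card {v : G.V // (G.edgeGraph S).connectedComponentMk v = c} : ℤ)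
      = ∑ v with G.contractVert S v = c, 1 := by
    rw [Fintype.card_subtype, Finset.sum_const, nsmul_one]; rfl
  have e3 : (Fintype.card {e : G.E // e ∈ S ∧ ∃ v ∈ G.ends e,
      (G.edgeGraph S).connectedComponentMk v = c} : ℤ)
      = ∑ e with e ∈ S, if G.contractVert S (G.src e) = c then 1 else 0 := by
    rw [Fintype.card_subtype, Finset.sum_boole, Finset.filter_filter]
    congr 2
    ext e
    simp only [Finset.mem_filter, Finset.mem_univ, true_and]
    refine and_congr_right fun he => ⟨?_, fun h => ⟨_, G.src_mem e, h⟩⟩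
    rintro ⟨v, hv, hvc⟩
    rcases G.mem_ends.1 hv with rfl | rfl
    · exact hvc
    · rw [G.contractVert_src_tgt he]; exact hvc
  rw [e1, e2]
  push_cast
  rw [e3]
  ring

theorem contract_valence (G : MarkedGraph n) (S : Set G.E) (c : (G.contract S).V) :
    ((G.contract S).valence c : ℤ) + 2 * (∑ e with e ∈ S,
      if G.contractVert S (G.src e) = c then 1 else 0) =
        ∑ v with G.contractVert S v = c, (G.valence v : ℤ) := by
  simp only [valence_eq]
  rw [Finset.sum_comm, ← Finset.sum_filter_not_add_sum_filter Finset.univ (fun e => e ∈ S)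
    (fun y => ∑ x with G.contractVert S x = c, G.half y x)]
  congr 1
  · refine Finset.sum_bij (fun e _ => G.contractEdge S e) ?_ ?_ ?_ ?_
    · intro e _; exact Finset.mem_filter.2 ⟨Finset.mem_univ _, e.2⟩
    · intro a _ b _ h; exact G.contractEdge_injective S h
    · intro e he
      exact ⟨⟨e, (Finset.mem_filter.1 he).2⟩, Finset.mem_univ _, rfl⟩
    · intro e _
      rw [sum_half_fiber]
      refine half_eq_of_ends _ ?_ c
      change (G.ends e.1).map (G.contractVert S) = _
      rw [G.ends_eq]; rfl
  · rw [Finset.mul_sum]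
    refine Finset.sum_congr rfl fun e he => ?_
    simp only [Finset.mem_filter, Finset.mem_univ, true_and] at he
    rw [sum_half_fiber, G.contractVert_src_tgt he]
    ring

/-- The contraction of the edges in `S`. -/
def toContract (G : MarkedGraph n) (S : Set G.E) : Contr G (G.contract S) where
  vert := G.contractVert S
  edge := G.contractEdge S
  edge_inj := G.contractEdge_injective S
  vert_surj := Quot.mk_surjective
  ends_edge _ := rfl
  vert_const e he := by
    rw [range_contractEdge, Set.notMem_compl_iff] at he
    exact G.contractVert_src_tgt he
  m_vert _ := rfl
  fiber u v h := by
    rw [range_contractEdge, compl_compl]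
    exact (G.contractVert_eq_iff S).1 h
  deg_eq c := by
    have hm : (G.contract S).marks c = ∑ v with G.contractVert S v = c, G.marks v := by
      rw [sum_marks_fiber, marks_eq]; rfl
    simp only [deg, Finset.sum_add_distrib, Finset.sum_sub_distrib, ← Finset.mul_sum]
    rw [hm, ← contract_valence, contract_w]
    have h4 : ∑ v with G.contractVert S v = c, (2 : ℤ) =
        2 * ∑ v with G.contractVert S v = c, 1 := by
      rw [Finset.mul_sum]; rfl
    rw [h4]
    ring

/-- The contraction without collapsed edges given by an isomorphism. -/
def Contr.ofIso {G H : MarkedGraph n} (α : G.Iso H) : Contr H G where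
  vert := α.vert.symm
  edge := α.edge
  edge_inj := α.edge.injective
  vert_surj := α.vert.symm.surjective
  ends_edge e := by
    rw [α.ends_edge, Sym2.map_map]; simp
  vert_const e he := absurd (α.edge.surjective e) he
  m_vert i := by rw [α.m_vert]; simp
  fiber u v h := by
    rw [α.vert.symm.injective h]
  deg_eq x := by
    have h1 : (Finset.univ.filter fun v => α.vert.symm v = x) = {α.vert x} := by
      ext v; simp [Equiv.symm_apply_eq]
    rw [h1, Finset.sum_singleton]
    have h2 : (G.valence x : ℤ) = H.valence (α.vert x) := by
      rw [valence_eq, valence_eq, ← α.edge.sum_comp]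
      refine Finset.sum_congr rfl fun e _ => ?_
      have := α.ends_edge e
      rw [G.ends_eq, Sym2.map_mk] at this
      rw [half_eq_of_ends H this]
      simp [half]
    have h3 : G.marks x = H.marks (α.vert x) := by
      rw [MarkedGraph.marks_eq, MarkedGraph.marks_eq]; simp [α.m_vert]
    rw [deg, deg, h2, h3, α.w_vert]

namespace Contr
variable {G H K : MarkedGraph n}

/-- A contraction that collapses no edge has an inverse. -/
theorem exists_inverse (d : Contr G H) (hd : Function.Surjective d.edge) :
    ∃ d' : Contr H G, (∀ v, d'.vert (d.vert v) = v) ∧ ∀ e, d.edge (d'.edge e) = e :=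
  d.exists_factor (Contr.refl G) (by rw [hd.range_eq]; exact Set.subset_univ _)

theorem vert_injective (d : Contr G H) (hd : Function.Surjective d.edge) :
    Function.Injective d.vert := by
  obtain ⟨d', h, _⟩ := d.exists_inverse hd
  exact Function.LeftInverse.injective h

theorem vert_bijective (d : Contr G H) (hd : Function.Surjective d.edge) :
    Function.Bijective d.vert := ⟨d.vert_injective hd, d.vert_surj⟩

theorem edge_bijective (d : Contr G H) (hd : Function.Surjective d.edge) :
    Function.Bijective d.edge := ⟨d.edge_inj, hd⟩

/-- The isomorphism given by a contraction that collapses no edge. -/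
def toIso (d : Contr G H) (hd : Function.Surjective d.edge) : H.Iso G where
  vert := (Equiv.ofBijective d.vert (d.vert_bijective hd)).symm
  edge := Equiv.ofBijective d.edge (d.edge_bijective hd)
  ends_edge e := by
    rw [d.ends_edge, Sym2.map_map, Equiv.ofBijective_apply]
    have : ⇑(Equiv.ofBijective d.vert (d.vert_bijective hd)).symm ∘ d.vert = id := by
      ext v
      exact (Equiv.ofBijective d.vert (d.vert_bijective hd)).symm_apply_apply v
    rw [this, Sym2.map_id, id]
  m_vert i := by
    rw [Equiv.eq_symm_apply, Equiv.ofBijective_apply, d.m_vert]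
  w_vert x := by
    obtain ⟨v, rfl⟩ := d.vert_surj x
    have h := d.weight_eq (d.vert v)
    have h1 : (Finset.univ.filter fun u => d.vert u = d.vert v) = {v} := by
      ext u; simp [(d.vert_injective hd).eq_iff]
    have h2 : (Finset.univ.filter fun e => e ∉ Set.range d.edge) = ∅ := by
      ext e; simp [hd e]
    rw [h1, h2] at h
    simp at h
    have h3 : (Equiv.ofBijective d.vert (d.vert_bijective hd)).symm (d.vert v) = v :=
      by rw [Equiv.symm_apply_eq]; rfl
    rw [h3, h]

end Contr
end MarkedGraph

/-! ### Points of the moduli space and their positive-length models -/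

open MarkedGraph

/-- The combinatorial type obtained from a contraction. -/
def CombType.ofContr (G : CombType g n) {H : MarkedGraph n} (c : Contr G.toMarkedGraph H) :
    CombType g n where
  toMarkedGraph := H
  connected := c.connected G.connected
  stable := c.stable G.stable
  genus_eq := c.genus_eq.trans G.genus_eq

/-- The contraction of a combinatorial type. -/
def CombType.contract (G : CombType g n) (S : Set G.E) : CombType g n :=
  G.ofContr (G.toMarkedGraph.toContract S)

/-- Contractions between combinatorial types. -/
abbrev CContr (G H : CombType g n) : Type := Contr G.toMarkedGraph H.toMarkedGraph

/-- The canonical map to the contraction of a combinatorial type. -/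
def CombType.toContract (G : CombType g n) (S : Set G.E) : CContr G (G.contract S) :=
  G.toMarkedGraph.toContract S

theorem CombType.range_toContract (G : CombType g n) (S : Set G.E) :
    Set.range (G.toContract S).edge = Sᶜ := range_contractEdge _ _

/-- With `S` the set of collapsed edges, the contraction factors as `G → G / S` followed by an
isomorphism, and this is an instance of `FaceRel`. -/
theorem mk_eq_of_contr {G H : CombType g n} (c : CContr G H) (l : Cone G)
    (hl : ∀ e ∉ Set.range c.edge, l e = 0) :
    Mtrop.mk G l = Mtrop.mk H (l ∘ c.edge) := by
  set S : Set G.E := (Set.range c.edge)ᶜ with hS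
  have hr : Set.range (G.toContract S).edge = Set.range c.edge := by
    rw [G.range_toContract, hS, compl_compl]
  obtain ⟨d, hd1, hd2⟩ := (G.toContract S).exists_factor c hr.symm.subset
  have hs : Function.Surjective d.edge := by
    intro e
    have : (G.toContract S).edge e ∈ Set.range c.edge := hr ▸ ⟨e, rfl⟩
    obtain ⟨f, hf⟩ := this
    exact ⟨f, (G.toContract S).edge_inj ((hd2 f).trans hf)⟩
  let α : H.toMarkedGraph.Iso (G.toMarkedGraph.contract S) := d.toIso hs
  have key : faceMap S α (l ∘ c.edge) = l := by
    funext e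
    by_cases he : e ∈ S
    · simp [faceMap, he, hl e he]
    · simp only [faceMap, he, dite_false, Function.comp_apply]
      congr 1
      have h1 := hd2 (α.edge.symm ⟨e, he⟩)
      rw [← h1]
      have h2 : d.edge (α.edge.symm ⟨e, he⟩) = ⟨e, he⟩ := α.edge.apply_symm_apply ⟨e, he⟩
      exact congrArg (G.toContract S).edge h2
  have := Quot.sound (FaceRel.face S α (l ∘ c.edge))
  rw [key] at this
  exact this.symm

/-- The edges of length zero. -/
def zeroSet {G : CombType g n} (l : Cone G) : Set G.E := {e | l e = 0}

/-- Two tropical curves with the same underlying metric graph after collapsing edges of length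
zero. -/
def SameCurve (x y : Σ G : CombType g n, Cone G) : Prop :=
  ∃ d : CContr (x.1.contract (zeroSet x.2)) (y.1.contract (zeroSet y.2)),
    Function.Surjective d.edge ∧ ∀ e, x.2 ((x.1.toContract _).edge (d.edge e)) =
      y.2 ((y.1.toContract _).edge e)

theorem sameCurve_equivalence : Equivalence (SameCurve (g := g) (n := n)) where
  refl x := ⟨Contr.refl _, Function.surjective_id, fun _ => rfl⟩
  symm := by
    rintro x y ⟨d, hd, h⟩
    obtain ⟨d', _, h'⟩ := d.exists_inverse hd
    refine ⟨d', fun e => ⟨d.edge e, d.edge_inj (h' _)⟩, fun e => ?_⟩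
    rw [← h, h']
  trans := by
    rintro x y z ⟨d, hd, h⟩ ⟨d', hd', h'⟩
    refine ⟨d.comp d', hd.comp hd', fun e => ?_⟩
    rw [← h', ← h]; rfl

theorem sameCurve_of_contr {G H : CombType g n} (c : CContr G H) (l : Cone G)
    (hl : ∀ e ∉ Set.range c.edge, l e = 0) : SameCurve ⟨G, l⟩ ⟨H, l ∘ c.edge⟩ := by
  have hr : Set.range (c.comp (H.toContract (zeroSet (l ∘ c.edge)))).edge =
      Set.range (G.toContract (zeroSet l)).edge := by
    change Set.range (c.edge ∘ _) = _
    rw [Set.range_comp, CombType.range_toContract, CombType.range_toContract]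
    ext e
    constructor
    · rintro ⟨f, hf, rfl⟩; exact hf
    · intro he
      by_cases h : e ∈ Set.range c.edge
      · obtain ⟨f, rfl⟩ := h
        exact ⟨f, he, rfl⟩
      · exact absurd (hl e h) he
  obtain ⟨d, _, h2⟩ := (G.toContract (zeroSet l)).exists_factor _ hr.subset
  refine ⟨d, fun e => ?_, fun e => congrArg l (h2 e)⟩
  have : (G.toContract (zeroSet l)).edge e ∈ Set.range (c.comp
      (H.toContract (zeroSet (l ∘ c.edge)))).edge := hr ▸ ⟨e, rfl⟩
  obtain ⟨f, hf⟩ := this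
  exact ⟨f, (G.toContract (zeroSet l)).edge_inj ((h2 f).trans hf)⟩

/-- A face identification only inserts edges of length zero, so the model in which these are
contracted is an invariant. `SameCurve` is an equivalence relation containing `FaceRel`, hence
contains the generated one. -/
theorem sameCurve_of_mk_eq {G H : CombType g n} {l : Cone G} {l' : Cone H}
    (h : Mtrop.mk G l = Mtrop.mk H l') : SameCurve ⟨G, l⟩ ⟨H, l'⟩ := by
  have h := Quot.eqvGen_exact h
  revert h
  generalize (⟨G, l⟩ : Σ G : CombType g n, Cone G) = x
  generalize (⟨H, l'⟩ : Σ G : CombType g n, Cone G) = y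
  intro h
  induction h with
  | rel x y h =>
    obtain ⟨S, α, l'⟩ := h
    rename_i G' G
    let c : CContr G G' := (G.toContract S).comp (Contr.ofIso α)
    have hr : Set.range c.edge = Sᶜ :=
      (Function.Surjective.range_comp α.edge.surjective
        (G.toMarkedGraph.contractEdge S)).trans (range_contractEdge _ S)
    have := sameCurve_of_contr c (faceMap S α l') (by
      intro e he
      rw [hr, Set.notMem_compl_iff] at he
      simp [faceMap, he])
    have h2 : faceMap S α l' ∘ c.edge = l' := by
      funext e
      have he : c.edge e ∉ S := by
        have : c.edge e ∈ Set.range c.edge := ⟨e, rfl⟩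
        rwa [hr] at this
      simp only [Function.comp_apply, faceMap, he, dite_false]
      congr 1
      exact α.edge.symm_apply_apply e
    rw [h2] at this
    exact sameCurve_equivalence.symm this
  | refl x => exact sameCurve_equivalence.refl x
  | symm x y _ ih => exact sameCurve_equivalence.symm ih
  | trans x y z _ _ ih ih' => exact sameCurve_equivalence.trans ih ih'

theorem mk_contract_zeroSet (G : CombType g n) (l : Cone G) :
    Mtrop.mk G l = Mtrop.mk (G.contract (zeroSet l)) (l ∘ (G.toContract (zeroSet l)).edge) := by
  refine mk_eq_of_contr _ l fun e he => ?_
  rw [CombType.range_toContract, Set.notMem_compl_iff] at he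
  exact he

theorem sum_contr {G H : CombType g n} (c : CContr G H) (l : Cone G)
    (hl : ∀ e ∉ Set.range c.edge, l e = 0) : ∑ e, (l ∘ c.edge) e = ∑ e, l e := by
  refine Finset.sum_of_injOn c.edge c.edge_inj.injOn (by simp) ?_ (fun _ _ => rfl)
  intro e _ he
  exact hl e (by simpa using he)

/-! ### Slices of total length one as quotients of simplices -/

/-- A class of combinatorial types closed under contractions. -/
def ContrClosed (T : Set (CombType g n)) : Prop :=
  ∀ G ∈ T, ∀ H, CContr G H → H ∈ T

/-- The curves of total length one with combinatorial type in `T` or degenerate from such. -/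
def slice (T : Set (CombType g n)) : Set (Mtrop g n) :=
  {x | ∃ G ∈ T, ∃ l : Cone G, ∑ e, l e = 1 ∧ Mtrop.mk G l = x}

theorem contract_mem_of_mk_eq {T : Set (CombType g n)} (hT : ContrClosed T) {G H : CombType g n}
    (hG : G ∈ T) {l : Cone G} {l' : Cone H} (h : Mtrop.mk G l = Mtrop.mk H l') :
    H.contract (zeroSet l') ∈ T := by
  obtain ⟨d, _, _⟩ := sameCurve_of_mk_eq h
  exact hT _ (hT G hG _ (G.toContract _)) _ d

/-- The data of a point of `slice T`. -/
abbrev SliceCover (T : Set (CombType g n)) : Type 1 :=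
  Σ G : T, {l : Cone G.1 // ∑ e, l e = 1}

/-- The parametrization of `slice T` by simplices. -/
def sliceMap (T : Set (CombType g n)) (x : SliceCover T) : slice T :=
  ⟨Mtrop.mk x.1.1 x.2.1, x.1.1, x.1.2, x.2.1, x.2.2, rfl⟩

theorem isQuotientMap_mk :
    Topology.IsQuotientMap (fun x : Σ G : CombType g n, Cone G => Mtrop.mk x.1 x.2) :=
  isQuotientMap_quot_mk

theorem continuous_mk (G : CombType g n) : Continuous (Mtrop.mk G) :=
  isQuotientMap_mk.continuous.comp continuous_sigmaMk

/-- The slice carries the subspace topology, while maps out of it are built on simplices. In the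
cone of an arbitrary type, a set that is closed on simplices becomes a finite union over edge sets
`S` of closed sets: functions vanishing on `S` whose restriction to `G / S` lies in a closed set. -/
theorem isQuotientMap_sliceMap {T : Set (CombType g n)} (hT : ContrClosed T) :
    Topology.IsQuotientMap (sliceMap T) := by
  have hcont : Continuous (sliceMap T) := by
    refine Continuous.subtype_mk ?_ _
    refine continuous_sigma fun G => ?_
    exact (continuous_mk G.1).comp continuous_subtype_val
  rw [Topology.isQuotientMap_iff_isClosed]
  refine ⟨?_, fun s => ⟨fun h => h.preimage hcont, fun h => ?_⟩⟩
  · rintro ⟨_, G, hG, l, hl, rfl⟩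
    exact ⟨⟨⟨G, hG⟩, l, hl⟩, rfl⟩
  have key : IsClosed (Subtype.val '' s) := by
    rw [← isQuotientMap_mk.isClosed_preimage, isClosed_sigma_iff]
    intro G
    rw [isClosed_sigma_iff] at h
    let D : (S : Set G.E) → (G.contract S ∈ T) → Set (Cone (G.contract S)) := fun S hS =>
      Subtype.val '' (Sigma.mk (β := fun G : T => {l : Cone G.1 // ∑ e, l e = 1})
        ⟨G.contract S, hS⟩ ⁻¹' (sliceMap T ⁻¹' s))
    have hD : ∀ S hS, IsClosed (D S hS) := by
      intro S hS
      refine IsClosed.trans (h _) ?_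
      exact isClosed_eq (by fun_prop) continuous_const
    have heq : Sigma.mk G ⁻¹' ((fun x : Σ G : CombType g n, Cone G => Mtrop.mk x.1 x.2) ⁻¹'
        (Subtype.val '' s)) = ⋃ S : Set G.E, ⋃ hS : G.contract S ∈ T,
          ({l : Cone G | ∀ e ∈ S, l e = 0} ∩ {l | l ∘ (G.toContract S).edge ∈ D S hS}) := by
      ext l
      simp only [Set.mem_iUnion, Set.mem_preimage]
      constructor
      · rintro ⟨⟨x, hx⟩, hxs, hxl⟩
        change x = Mtrop.mk G l at hxl
        obtain ⟨G', hG', l', hl', h'⟩ := id hx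
        -- `G` itself may lie outside `T`, but the positive-length model of a point of the slice
        -- lies in `T`.
        have hmem := contract_mem_of_mk_eq hT hG' (h'.trans hxl)
        refine ⟨zeroSet l, hmem, fun e he => he, ?_⟩
        have hsum : ∑ e, (l ∘ (G.toContract (zeroSet l)).edge) e = 1 := by
          rw [sum_contr, ← hl']
          · exact (congrArg Mtrop.totalLength (h'.trans hxl)).symm
          · intro e he
            rw [CombType.range_toContract, Set.notMem_compl_iff] at he
            exact he
        refine ⟨⟨_, hsum⟩, ?_, rfl⟩
        change sliceMap T ⟨⟨_, hmem⟩, ⟨_, hsum⟩⟩ ∈ s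
        convert hxs
        rw [hxl]
        exact (mk_contract_zeroSet G l).symm
      · rintro ⟨S, hS, h0, ⟨l', hl'⟩, hmem, heq⟩
        refine ⟨_, hmem, ?_⟩
        subst heq
        refine (mk_eq_of_contr (G.toContract S) l ?_).symm
        intro e he
        rw [CombType.range_toContract, Set.notMem_compl_iff] at he
        exact h0 e he
    rw [heq]
    refine isClosed_iUnion_of_finite fun S => isClosed_iUnion_of_finite fun hS => ?_
    refine IsClosed.inter ?_ ((hD S hS).preimage (by fun_prop))
    have : {l : Cone G | ∀ e ∈ S, l e = 0} = ⋂ e ∈ S, {l | l e = 0} := by ext; simp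
    rw [this]
    exact isClosed_biInter fun e _ => isClosed_eq (by fun_prop) continuous_const
  have : s = Subtype.val ⁻¹' (Subtype.val '' s) :=
    (Set.preimage_image_eq s Subtype.val_injective).symm
  rw [this]
  exact key.preimage continuous_subtype_val

/-- Two representatives of a point have isomorphic positive-length models, so invariance under
contractions of zero-length edges gives a well-defined map. -/
theorem exists_slice_lift {T : Set (CombType g n)} (hT : ContrClosed T) {Y : Type*}
    [TopologicalSpace Y] (f : ∀ G : CombType g n, Cone G → unitInterval → Y)
    (hinv : ∀ G ∈ T, ∀ H ∈ T, ∀ (c : CContr G H) (l : Cone G),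
      (∀ e ∉ Set.range c.edge, l e = 0) → ∀ t, f G l t = f H (l ∘ c.edge) t)
    (hcont : ∀ G ∈ T, Continuous fun p : Cone G × unitInterval => f G p.1 p.2) :
    ∃ F : C(slice T × unitInterval, Y), ∀ G (hG : G ∈ T) (l : Cone G) (hl : ∑ e, l e = 1) t,
      F (⟨Mtrop.mk G l, G, hG, l, hl, rfl⟩, t) = f G l t := by
  have hwd : ∀ G ∈ T, ∀ H ∈ T, ∀ (l : Cone G) (l' : Cone H), Mtrop.mk G l = Mtrop.mk H l' →
      ∀ t, f G l t = f H l' t := by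
    intro G hG H hH l l' h t
    obtain ⟨d, hd, hdl⟩ := sameCurve_of_mk_eq h
    have hG' := hT G hG _ (G.toContract (zeroSet l))
    have hH' := hT H hH _ (H.toContract (zeroSet l'))
    rw [hinv G hG _ hG' (G.toContract (zeroSet l)) l (by
        intro e he
        rw [CombType.range_toContract, Set.notMem_compl_iff] at he
        exact he),
      hinv H hH _ hH' (H.toContract (zeroSet l')) l' (by
        intro e he
        rw [CombType.range_toContract, Set.notMem_compl_iff] at he
        exact he),
      hinv _ hG' _ hH' d _ (fun e he => absurd (hd e) he)]
    congr 1
    funext e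
    exact hdl e
  choose G hG l hl hx using fun x : slice T => x.2
  let F : slice T × unitInterval → Y := fun p => f (G p.1) (l p.1) p.2
  have hF : ∀ G' (hG' : G' ∈ T) (l' : Cone G') (hl' : ∑ e, l' e = 1) t,
      F (⟨Mtrop.mk G' l', G', hG', l', hl', rfl⟩, t) = f G' l' t := by
    intro G' hG' l' hl' t
    exact hwd _ (hG _) _ hG' _ _ (hx ⟨Mtrop.mk G' l', G', hG', l', hl', rfl⟩) t
  have hFc : Continuous F := by
    -- The interval is locally compact, so the product of the quotient map with it is again a
    -- quotient map.
    refine (isQuotientMap_sliceMap hT).continuous_lift_prod_left ?_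
    rw [← Homeomorph.sigmaProdDistrib.symm.comp_continuous_iff']
    refine continuous_sigma fun G' => ?_
    have : Continuous fun p : {l : Cone G'.1 // ∑ e, l e = 1} × unitInterval =>
        f G'.1 p.1.1 p.2 := (hcont G'.1 G'.2).comp
          ((continuous_subtype_val.comp continuous_fst).prodMk continuous_snd)
    convert this using 2 with p
    exact hF G'.1 G'.2 p.1.1 p.1.2 p.2
  exact ⟨⟨F, hFc⟩, hF⟩

/-- A deformation of the curves in `slice T` into `slice T'` reduces contractibility of the former
to contractibility of the latter. -/
theorem contractible_of_deformation {T T' : Set (CombType g n)} (hT : ContrClosed T)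
    (hsub : T' ⊆ T) (f : ∀ G : CombType g n, Cone G → unitInterval → Mtrop g n)
    (hinv : ∀ G ∈ T, ∀ H ∈ T, ∀ (c : CContr G H) (l : Cone G),
      (∀ e ∉ Set.range c.edge, l e = 0) → ∀ t, f G l t = f H (l ∘ c.edge) t)
    (hcont : ∀ G ∈ T, Continuous fun p : Cone G × unitInterval => f G p.1 p.2)
    (h0 : ∀ G ∈ T, ∀ l, f G l 0 = Mtrop.mk G l)
    (hmem : ∀ G ∈ T, ∀ l : Cone G, ∑ e, l e = 1 → ∀ t, f G l t ∈ slice T)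
    (h1 : ∀ G ∈ T, ∀ l : Cone G, ∑ e, l e = 1 → f G l 1 ∈ slice T')
    (hc : ContractibleSpace (slice T')) : ContractibleSpace (slice T) := by
  obtain ⟨F, hF⟩ := exists_slice_lift hT f hinv hcont
  have hFmem : ∀ p, F p ∈ slice T := by
    rintro ⟨⟨_, G, hG, l, hl, rfl⟩, t⟩
    rw [hF G hG l hl t]
    exact hmem G hG l hl t
  have hF1 : ∀ x, F (x, 1) ∈ slice T' := by
    rintro ⟨_, G, hG, l, hl, rfl⟩
    rw [hF G hG l hl 1]
    exact h1 G hG l hl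
  let r : C(slice T, slice T') := ⟨fun x => ⟨F (x, 1), hF1 x⟩, by fun_prop⟩
  have hss : slice T' ⊆ slice T := by
    rintro _ ⟨G, hG, l, hl, rfl⟩
    exact ⟨G, hsub hG, l, hl, rfl⟩
  let i : C(slice T', slice T) := ⟨Set.inclusion hss, continuous_inclusion hss⟩
  have hom : (ContinuousMap.id (slice T)).Homotopic (i.comp r) := by
    refine ⟨⟨⟨fun p => ⟨F (p.2, p.1), hFmem _⟩, by fun_prop⟩, ?_, ?_⟩⟩
    · rintro ⟨_, G, hG, l, hl, rfl⟩
      refine Subtype.ext ?_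
      change F (_, 0) = _
      rw [hF G hG l hl 0, h0 G hG l]; rfl
    · intro x
      rfl
  rw [contractible_iff_id_nullhomotopic] at hc ⊢
  obtain ⟨y, hy⟩ := hc
  refine ⟨i y, hom.trans ?_⟩
  -- The end map `r` need not fix `slice T'`: it suffices that the identity is homotopic to `i ∘ r`,
  -- which factors through a contractible space.
  have h2 := ((ContinuousMap.Homotopic.refl i).comp hy).comp (ContinuousMap.Homotopic.refl r)
  exact h2

/-! ### Splitting a vertex along a new edge -/

namespace MarkedGraph

theorem src_tgt_of_ends (G : MarkedGraph n) {W : Type*} {f : G.V → W} {e : G.E} {a b : G.V}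
    (h : G.ends e = s(a, b)) (hab : f a = f b) : f (G.src e) = f (G.tgt e) := by
  rw [ends_eq, Sym2.eq_iff] at h
  rcases h with ⟨h1, h2⟩ | ⟨h1, h2⟩ <;> simp [h1, h2, hab]

theorem reach_of_ends (G H : MarkedGraph n) {T : Set H.E} {f : G.V → H.V} {e : G.E} {a b : G.V}
    (h : G.ends e = s(a, b)) (hab : H.Reach T (f a) (f b)) :
    H.Reach T (f (G.src e)) (f (G.tgt e)) := by
  rw [ends_eq, Sym2.eq_iff] at h
  rcases h with ⟨h1, h2⟩ | ⟨h1, h2⟩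
  · rwa [h1, h2]
  · rw [h1, h2]; exact hab.symm

theorem Contr.connected_of {G H : MarkedGraph n} (c : Contr G H) (h : H.Connected) :
    G.Connected := by
  rw [Connected, connected_iff] at h ⊢
  obtain ⟨x⟩ := h.1
  obtain ⟨v, -⟩ := c.vert_surj x
  exact ⟨⟨v⟩, fun u v => c.reach_lift (T := Set.univ) (by simp) (by simp) (h.2 _ _)⟩

/-- The number of half-edges at `u` of edges in `X`. -/
def valOn (G : MarkedGraph n) (X : Set G.E) (u : G.V) : ℤ := ∑ e with e ∈ X, G.half e u

/-- The new endpoint of a half-edge of `e` at `v` when the half-edges at `u` of edges in `X` are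
moved to a new vertex. -/
def splitEnd (G : MarkedGraph n) (u : G.V) (X : Set G.E) (e : G.E) (v : G.V) : Option G.V :=
  if e ∈ X ∧ v = u then none else some v

/-- Splitting the vertex `u`: the half-edges at `u` of edges in `X` are moved to a new vertex, which
is joined to `u` by a new edge. -/
def split (G : MarkedGraph n) (u : G.V) (X : Set G.E) : MarkedGraph n where
  V := Option G.V
  E := Option G.E
  ends o := match o with
    | none => s(none, some u)
    | some e => (G.ends e).map (G.splitEnd u X e)
  m i := some (G.m i)
  w o := match o with
    | none => 0
    | some v => G.w v

section split

variable (G : MarkedGraph n) (u : G.V) (X : Set G.E)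

/-- The new vertex. -/
def newV : (G.split u X).V := (none : Option G.V)

/-- The old vertices. -/
def oldV (v : G.V) : (G.split u X).V := (some v : Option G.V)

/-- The new edge. -/
def newE : (G.split u X).E := (none : Option G.E)

/-- The old edges. -/
def oldE (e : G.E) : (G.split u X).E := (some e : Option G.E)

theorem oldV_injective : Function.Injective (G.oldV u X) := Option.some_injective _

theorem oldE_injective : Function.Injective (G.oldE u X) := Option.some_injective _

theorem oldV_ne_newV (v : G.V) : G.oldV u X v ≠ G.newV u X := Option.some_ne_none _

theorem oldE_ne_newE (v : G.E) : G.oldE u X v ≠ G.newE u X := Option.some_ne_none _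

theorem split_V_cases (x : (G.split u X).V) : x = G.newV u X ∨ ∃ v, x = G.oldV u X v := by
  rcases x with _ | v
  · exact Or.inl rfl
  · exact Or.inr ⟨v, rfl⟩

theorem split_E_cases (x : (G.split u X).E) : x = G.newE u X ∨ ∃ v, x = G.oldE u X v := by
  rcases x with _ | v
  · exact Or.inl rfl
  · exact Or.inr ⟨v, rfl⟩

/-- Maps on the vertices of a split graph. -/
def splitVElim {W : Type*} (a : W) (f : G.V → W) (x : (G.split u X).V) : W :=
  Option.elim (α := G.V) x a f

@[simp] theorem splitVElim_newV {W : Type*} (a : W) (f : G.V → W) :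
    G.splitVElim u X a f (G.newV u X) = a := rfl

@[simp] theorem splitVElim_oldV {W : Type*} (a : W) (f : G.V → W) (v : G.V) :
    G.splitVElim u X a f (G.oldV u X v) = f v := rfl

/-- Maps on the edges of a split graph. -/
def splitEElim {W : Type*} (a : W) (f : G.E → W) (x : (G.split u X).E) : W :=
  Option.elim (α := G.E) x a f

@[simp] theorem splitEElim_newE {W : Type*} (a : W) (f : G.E → W) :
    G.splitEElim u X a f (G.newE u X) = a := rfl

@[simp] theorem splitEElim_oldE {W : Type*} (a : W) (f : G.E → W) (v : G.E) :
    G.splitEElim u X a f (G.oldE u X v) = f v := rfl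

theorem sum_split_V (f : (G.split u X).V → ℤ) :
    ∑ x, f x = f (G.newV u X) + ∑ v, f (G.oldV u X v) :=
  Fintype.sum_option (α := G.V) f

theorem sum_split_E {M : Type*} [AddCommMonoid M] (f : (G.split u X).E → M) :
    ∑ x, f x = f (G.newE u X) + ∑ v, f (G.oldE u X v) :=
  Fintype.sum_option (α := G.E) f

theorem split_ends_new : (G.split u X).ends (G.newE u X) = s(G.newV u X, G.oldV u X u) := rfl

theorem split_ends_old (e : G.E) : (G.split u X).ends (G.oldE u X e) =
    (G.ends e).map (fun v => if e ∈ X ∧ v = u then G.newV u X else G.oldV u X v) := rfl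

theorem split_ends_of_not_mem {e : G.E} (he : e ∉ X) : (G.split u X).ends (G.oldE u X e) =
    s(G.oldV u X (G.src e), G.oldV u X (G.tgt e)) := by
  rw [split_ends_old, ends_eq]; simp [he]

theorem split_half_old_new (e : G.E) :
    (G.split u X).half (G.oldE u X e) (G.newV u X) = if e ∈ X then G.half e u else 0 := by
  have h := G.split_ends_old u X e
  rw [G.ends_eq, Sym2.map_mk] at h
  rw [half_eq_of_ends _ h]
  by_cases he : e ∈ X
  · simp only [he, true_and, if_true, half]
    congr 1 <;> split_ifs <;> simp_all [oldV_ne_newV]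
  · simp [he, oldV_ne_newV]

theorem split_half_old_old (e : G.E) (v : G.V) :
    (G.split u X).half (G.oldE u X e) (G.oldV u X v) =
      if e ∈ X ∧ v = u then 0 else G.half e v := by
  have h := G.split_ends_old u X e
  rw [G.ends_eq, Sym2.map_mk] at h
  rw [half_eq_of_ends _ h]
  have hne : ∀ v, G.newV u X ≠ G.oldV u X v := fun v => (G.oldV_ne_newV u X v).symm
  by_cases he : e ∈ X
  · simp only [he, true_and, half]
    by_cases hv : v = u
    · subst hv
      rw [if_pos rfl]
      have : ∀ y : G.V, (if (if y = v then G.newV v X else G.oldV v X y) = G.oldV v X v then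
          (1 : ℤ) else 0) = 0 := by
        intro y
        by_cases hy : y = v
        · simp [hy, hne]
        · simp [hy, (G.oldV_injective v X).eq_iff]
      rw [this, this]; rfl
    · rw [if_neg hv]
      congr 1 <;> split_ifs <;> simp_all [(G.oldV_injective u X).eq_iff]
  · simp [he, half, (G.oldV_injective u X).eq_iff]

theorem split_half_new_new : (G.split u X).half (G.newE u X) (G.newV u X) = 1 := by
  rw [half_eq_of_ends _ (G.split_ends_new u X)]
  simp [oldV_ne_newV]

theorem split_half_new_old (v : G.V) : (G.split u X).half (G.newE u X) (G.oldV u X v) =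
    if u = v then 1 else 0 := by
  rw [half_eq_of_ends _ (G.split_ends_new u X)]
  simp [(G.oldV_ne_newV u X v).symm, (G.oldV_injective u X).eq_iff]

/-- The new vertex has no weight and no marks, and the new edge adds one half-edge to those of `X`.
By `split_deg_old` the vertex `u` loses the same amount, so stability of the split is a pair of
inequalities on `valOn`. -/
theorem split_deg_new : (G.split u X).deg (G.newV u X) = G.valOn X u - 1 := by
  have hm : (G.split u X).marks (G.newV u X) = 0 := by
    rw [marks_eq]
    exact Finset.sum_eq_zero fun i _ => if_neg (G.oldV_ne_newV u X (G.m i))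
  have hw : (G.split u X).w (G.newV u X) = 0 := rfl
  rw [deg, hm, hw, valence_eq, sum_split_E, split_half_new_new]
  simp only [split_half_old_new, valOn, Finset.sum_filter]
  push_cast
  ring

theorem split_deg_old (v : G.V) : (G.split u X).deg (G.oldV u X v) =
    G.deg v - if v = u then G.valOn X u - 1 else 0 := by
  have hm : (G.split u X).marks (G.oldV u X v) = G.marks v := by
    rw [marks_eq, marks_eq]
    refine Finset.sum_congr rfl fun i _ => ?_
    change (if G.oldV u X (G.m i) = _ then (1 : ℤ) else 0) = _
    simp [(G.oldV_injective u X).eq_iff]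
  have hw : (G.split u X).w (G.oldV u X v) = G.w v := rfl
  rw [deg, deg, hm, hw, valence_eq, valence_eq, sum_split_E, split_half_new_old]
  simp only [split_half_old_old]
  by_cases hv : v = u
  · subst hv
    have : ∑ e, G.half e v = (∑ e, if e ∈ X ∧ v = v then 0 else G.half e v) + G.valOn X v := by
      rw [valOn, Finset.sum_filter, ← Finset.sum_add_distrib]
      refine Finset.sum_congr rfl fun e _ => ?_
      by_cases he : e ∈ X <;> simp [he]
    rw [this]
    simp
    ring
  · simp [hv, Ne.symm hv]

/-- Collapsing the new edge of a split graph gives back the graph. -/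
def splitContr : Contr (G.split u X) G where
  vert := G.splitVElim u X u id
  edge := G.oldE u X
  edge_inj := G.oldE_injective u X
  vert_surj v := ⟨G.oldV u X v, rfl⟩
  ends_edge e := by
    rw [split_ends_old, Sym2.map_map]
    have : (G.splitVElim u X u id ∘ fun v => if e ∈ X ∧ v = u then G.newV u X else G.oldV u X v)
        = id := by
      ext v
      by_cases h : e ∈ X ∧ v = u
      · simp [h]
      · simp [h]
    rw [this, Sym2.map_id, id]
  vert_const e he := by
    rcases G.split_E_cases u X e with rfl | ⟨v, rfl⟩
    · exact src_tgt_of_ends _ (G.split_ends_new u X) rfl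
    · exact absurd ⟨v, rfl⟩ he
  m_vert i := rfl
  fiber := by
    have key : ∀ x, (G.split u X).Reach (Set.range (G.oldE u X))ᶜ x
        (G.oldV u X (G.splitVElim u X u id x)) := by
      intro x
      rcases G.split_V_cases u X x with rfl | ⟨v, rfl⟩
      · refine (G.split u X).reach_ends (e := G.newE u X) ?_ ?_ ?_
        · rintro ⟨e, he⟩; exact G.oldE_ne_newE u X e he
        · simp [split_ends_new]
        · simp [split_ends_new]
      · exact SimpleGraph.Reachable.refl _
    intro x y h
    exact ((key x).trans (by rw [h])).trans (key y).symm
  deg_eq v := by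
    rw [Finset.sum_filter, sum_split_V]
    simp only [splitVElim_newV, splitVElim_oldV, split_deg_new, split_deg_old, id]
    rw [Finset.sum_ite_eq' Finset.univ v]
    by_cases hv : v = u
    · simp [hv]
    · simp [hv, Ne.symm hv]

/-- The set `A` together with the new vertex is one side of the cut: every edge of the old boundary
now runs inside it. -/
theorem split_isBridge {A : Set G.V} (hG : G.Connected) (hu : u ∉ A)
    (hA : ∀ e ∈ G.bdry A, u ∈ G.ends e) :
    (G.split u (G.bdry A)).IsBridge (G.newE u (G.bdry A)) := by
  rw [isBridge_iff ((G.splitContr u _).connected_of hG)]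
  refine ⟨{x | G.splitVElim u (G.bdry A) True (· ∈ A) x}, ?_⟩
  ext x
  rcases G.split_E_cases u (G.bdry A) x with rfl | ⟨e, rfl⟩
  · rw [mem_bdry_of_ends _ (G.split_ends_new u _)]
    simp [hu]
  · simp only [Set.mem_singleton_iff, G.oldE_ne_newE, iff_false]
    by_cases he : e ∈ G.bdry A
    · obtain ⟨a, ha, b, hb, hab⟩ := G.mem_bdry_iff.1 he
      have hub : b = u := by
        have := hA e he
        rw [hab, Sym2.mem_iff] at this
        rcases this with rfl | rfl
        · exact absurd ha hu
        · rfl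
      subst hub
      have h := G.split_ends_old b (G.bdry A) e
      rw [hab, Sym2.map_mk] at h
      have hane : a ≠ b := by rintro rfl; exact hu ha
      rw [mem_bdry_of_ends _ h]
      simp [he, hane, ha]
    · rw [mem_bdry_of_ends _ (G.split_ends_of_not_mem u _ he)]
      have := G.not_mem_bdry he (G.src_mem e) (G.tgt_mem e)
      simpa using this

end split

theorem valence_eq_valOn (G : MarkedGraph n) (X : Set G.E) (u : G.V) :
    (G.valence u : ℤ) = G.valOn X u + ∑ e with e ∉ X, G.half e u := by
  rw [valence_eq, valOn, Finset.sum_filter_add_sum_filter_not]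

/-- The half-edges at `u` of edges in `X` can be pulled away from `u`: either splitting `u` gives
a stable graph, or exactly one further half-edge is at `u`. -/
structure Pullable (G : MarkedGraph n) (X : Set G.E) (u : G.V) : Prop where
  two_le : 2 ≤ G.valOn X u
  le_deg : G.valOn X u ≤ G.deg u + 1
  exists_edge : G.valOn X u = G.deg u + 1 → ∃ b ∉ X, u ∈ G.ends b

/-- Failure of the inequality forces twice the weight, the marks and the remaining half-edges at `u`
to add up to one, and `exists_edge` says that the one is a half-edge. So `u` already looks like the
new vertex of a split, with `b` in the role of the new edge. -/
theorem Pullable.exists_unique {G : MarkedGraph n} {X : Set G.E} {u : G.V} (h : G.Pullable X u)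
    (hu : ¬ G.valOn X u ≤ G.deg u) :
    ∃ b ∉ X, (∃ y, y ≠ u ∧ G.ends b = s(u, y)) ∧ ∀ e ∉ X, u ∈ G.ends e → e = b := by
  have hd : G.valOn X u = G.deg u + 1 := by have := h.le_deg; omega
  obtain ⟨b, hb, hub⟩ := h.exists_edge hd
  have h1 := G.valence_eq_valOn X u
  have h2 := G.marks_nonneg u
  rw [deg] at hd
  have h3 : ∑ e with e ∉ X, G.half e u ≤ 1 := by
    have : (0 : ℤ) ≤ G.w u := by positivity
    omega
  have hsub : ∀ s : Finset G.E, (∀ e ∈ s, e ∉ X) → ∑ e ∈ s, G.half e u ≤ 1 := fun s hs =>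
    (Finset.sum_le_sum_of_subset_of_nonneg (fun e he => by simp [hs e he])
      fun e _ _ => G.half_nonneg e u).trans h3
  refine ⟨b, hb, ?_, ?_⟩
  · have := hsub {b} (by simpa using hb)
    rw [Finset.sum_singleton, half] at this
    rcases G.mem_ends.1 hub with h' | h'
    · refine ⟨G.tgt b, ?_, by rw [ends_eq, h']⟩
      intro h''
      simp [h', h''] at this
    · refine ⟨G.src b, ?_, by rw [ends_eq, h', Sym2.eq_swap]⟩
      intro h''
      simp [h', h''] at this
  · intro e he hue
    by_contra hne
    have := hsub {e, b} (by simp [he, hb])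
    rw [Finset.sum_pair hne] at this
    have := G.half_pos hue
    have := G.half_pos hub
    omega

end MarkedGraph

/-! ### Pulling half-edges away from a vertex -/

/-- Splitting a vertex of a combinatorial type. -/
def CombType.split (G : CombType g n) (u : G.V) (X : Set G.E)
    (h : 2 ≤ G.valOn X u ∧ G.valOn X u ≤ G.deg u) : CombType g n where
  toMarkedGraph := G.toMarkedGraph.split u X
  connected := (G.splitContr u X).connected_of G.connected
  stable := by
    rw [stable_iff]
    have hs := G.stable
    rw [stable_iff] at hs
    intro x
    rcases G.split_V_cases u X x with rfl | ⟨v, rfl⟩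
    · rw [split_deg_new]; omega
    · rw [split_deg_old]
      have := hs v
      split_ifs with hv
      · subst hv; omega
      · omega
  genus_eq := (G.splitContr u X).genus_eq.symm.trans G.genus_eq

/-- The curve obtained from `(G, l)` by pulling the half-edges at `u` of edges in `X` away from
`u` by the distance `s`. -/
def pullPoint (G : CombType g n) (u : G.V) (X : Set G.E) (l : Cone G) (s : ℝ≥0) : Mtrop g n :=
  if h : 2 ≤ G.valOn X u ∧ G.valOn X u ≤ G.deg u then
    Mtrop.mk (G.split u X h) (G.splitEElim u X s l)
  -- For pullable data this case means that a single further edge leaves `u`; that edge is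
  -- lengthened instead of creating an unstable split.
  else Mtrop.mk G (fun e => l e + if e ∉ X ∧ u ∈ G.ends e then s else 0)

theorem pullPoint_zero (G : CombType g n) (u : G.V) (X : Set G.E) (l : Cone G) :
    pullPoint G u X l 0 = Mtrop.mk G l := by
  rw [pullPoint]
  split_ifs with h
  · refine (mk_eq_of_contr (G := G.split u X h) (H := G) (G.splitContr u X) _ ?_)
    intro e he
    rcases G.split_E_cases u X e with rfl | ⟨v, rfl⟩
    · rfl
    · exact absurd ⟨v, rfl⟩ he
  · simp

theorem continuous_pullPoint (G : CombType g n) (u : G.V) (X : Set G.E) :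
    Continuous fun p : Cone G × ℝ≥0 => pullPoint G u X p.1 p.2 := by
  by_cases h : 2 ≤ G.valOn X u ∧ G.valOn X u ≤ G.deg u
  · simp only [pullPoint, h]
    refine (continuous_mk _).comp ?_
    refine continuous_pi fun e => ?_
    rcases G.split_E_cases u X e with rfl | ⟨v, rfl⟩
    · exact continuous_snd
    · exact (continuous_apply v).comp continuous_fst
  · simp only [pullPoint, h]
    refine (continuous_mk _).comp ?_
    refine continuous_pi fun e => ?_
    refine ((continuous_apply e).comp continuous_fst).add ?_
    split_ifs
    · exact continuous_snd
    · exact continuous_const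

/-! ### Compatibility of pulling with contractions -/

namespace MarkedGraph

section pull

variable {G H : MarkedGraph n} (c : Contr G H) {u : G.V} {X : Set H.E}

theorem Contr.valOn_image
    (hX : ∀ e ∈ c.edge '' X, ∀ v ∈ G.ends e, c.vert v = c.vert u → v = u) :
    G.valOn (c.edge '' X) u = H.valOn X (c.vert u) := by
  rw [valOn, valOn]
  refine (Finset.sum_bij (fun e _ => c.edge e) ?_ ?_ ?_ ?_).symm
  · intro e he
    simpa [c.edge_inj.eq_iff] using he
  · intro a _ b _ h; exact c.edge_inj h
  · intro e he
    simp only [Finset.mem_filter, Finset.mem_univ, true_and] at he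
    obtain ⟨f, hf, rfl⟩ := he
    exact ⟨f, by simp [hf], rfl⟩
  · intro e he
    simp only [Finset.mem_filter, Finset.mem_univ, true_and] at he
    rw [c.half_eq]
    refine Finset.sum_eq_single u ?_ (by simp)
    intro v hv hvu
    rw [half_eq_zero]
    intro hv'
    exact hvu (hX _ ⟨e, he, rfl⟩ v hv' (by simpa using hv))

/-- A contraction induces a contraction of split graphs. -/
def Contr.splitMap (hX : ∀ e ∈ c.edge '' X, ∀ v ∈ G.ends e, c.vert v = c.vert u → v = u) :
    Contr (G.split u (c.edge '' X)) (H.split (c.vert u) X) where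
  vert := G.splitVElim u _ (H.newV _ X) (fun v => H.oldV _ X (c.vert v))
  edge := H.splitEElim _ X (G.newE u _) (fun e => G.oldE u _ (c.edge e))
  edge_inj := by
    intro a b hab
    rcases H.split_E_cases _ X a with rfl | ⟨a, rfl⟩ <;>
      rcases H.split_E_cases _ X b with rfl | ⟨b, rfl⟩
    · rfl
    · exact absurd hab.symm (G.oldE_ne_newE _ _ _)
    · exact absurd hab (G.oldE_ne_newE _ _ _)
    · rw [c.edge_inj (G.oldE_injective _ _ hab)]
  vert_surj := by
    intro x
    rcases H.split_V_cases _ X x with rfl | ⟨x, rfl⟩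
    · exact ⟨G.newV _ _, rfl⟩
    · obtain ⟨v, rfl⟩ := c.vert_surj x
      exact ⟨G.oldV _ _ v, rfl⟩
  ends_edge e := by
    rcases H.split_E_cases _ X e with rfl | ⟨e, rfl⟩
    · rfl
    · rw [splitEElim_oldE, split_ends_old, split_ends_old, c.ends_edge, Sym2.map_map, Sym2.map_map]
      refine Sym2.map_congr fun v hv => ?_
      simp only [Function.comp_apply, c.edge_inj.mem_set_image]
      by_cases he : e ∈ X
      · by_cases hvu : v = u
        · simp [he, hvu]
        · have : c.vert v ≠ c.vert u := fun h => hvu (hX _ ⟨e, he, rfl⟩ v hv h)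
          simp [he, hvu, this]
      · simp [he]
  vert_const e he := by
    rcases G.split_E_cases u _ e with rfl | ⟨e, rfl⟩
    · exact absurd ⟨H.newE _ X, rfl⟩ he
    · have her : e ∉ Set.range c.edge := by
        rintro ⟨f, rfl⟩; exact he ⟨H.oldE _ X f, rfl⟩
      have heX : e ∉ c.edge '' X := fun h => her (Set.image_subset_range _ _ h)
      refine src_tgt_of_ends _ (G.split_ends_of_not_mem u _ heX) ?_
      simp [c.vert_const e her]
  m_vert i := by
    change H.oldV _ X (H.m i) = H.oldV _ X (c.vert (G.m i))
    rw [c.m_vert]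
  fiber x y hxy := by
    rcases G.split_V_cases u _ x with rfl | ⟨x, rfl⟩ <;>
      rcases G.split_V_cases u _ y with rfl | ⟨y, rfl⟩
    · exact SimpleGraph.Reachable.refl _
    · exact absurd hxy.symm (H.oldV_ne_newV _ X _)
    · exact absurd hxy (H.oldV_ne_newV _ X _)
    · have h := c.fiber x y (H.oldV_injective _ X hxy)
      refine reach_map G (G.split u _) (G.oldV u _) ?_ h
      intro e he
      have heX : e ∉ c.edge '' X := fun h => he (Set.image_subset_range _ _ h)
      refine reach_ends _ (e := G.oldE u _ e) ?_ ?_ ?_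
      · rintro ⟨f, hf⟩
        rcases H.split_E_cases _ X f with rfl | ⟨f, rfl⟩
        · exact G.oldE_ne_newE _ _ _ hf.symm
        · exact he ⟨f, G.oldE_injective _ _ hf⟩
      · rw [split_ends_of_not_mem _ _ _ heX]; simp
      · rw [split_ends_of_not_mem _ _ _ heX]; simp
  deg_eq x := by
    have hval := c.valOn_image hX
    rw [Finset.sum_filter, sum_split_V]
    rcases H.split_V_cases _ X x with rfl | ⟨x, rfl⟩
    · simp only [splitVElim_newV, splitVElim_oldV, oldV_ne_newV, if_true, if_false,
        split_deg_new, hval]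
      simp
    · simp only [splitVElim_newV, splitVElim_oldV, (H.oldV_ne_newV _ X _).symm, if_false,
        split_deg_old, (H.oldV_injective _ X).eq_iff, hval]
      rw [← Finset.sum_filter, Finset.sum_sub_distrib, ← c.deg_eq, zero_add,
        Finset.sum_ite_eq' _ u]
      simp [eq_comm]

/-- If all half-edges at `u` outside `X` belong to one collapsed edge `b`, then the graph contracts
to the split graph of its contraction. -/
def Contr.toSplit (hX : ∀ e ∈ c.edge '' X, ∀ v ∈ G.ends e, c.vert v = c.vert u → v = u)
    (hu : G.valOn (c.edge '' X) u = G.deg u + 1) {b : G.E} {y : G.V} (hyu : y ≠ u)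
    (hb : G.ends b = s(u, y)) (hbr : b ∉ Set.range c.edge)
    (huniq : ∀ e ∉ c.edge '' X, u ∈ G.ends e → e = b) :
    Contr G (H.split (c.vert u) X) where
  -- Here `u` itself becomes the new vertex and the collapsed edge `b` the new edge; the rest of its
  -- fibre becomes the old vertex.
  vert v := if v = u then H.newV _ X else H.oldV _ X (c.vert v)
  edge := H.splitEElim _ X b c.edge
  edge_inj := by
    intro a b' hab
    rcases H.split_E_cases _ X a with rfl | ⟨a, rfl⟩ <;>
      rcases H.split_E_cases _ X b' with rfl | ⟨b', rfl⟩
    · rfl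
    · exact absurd ⟨_, hab.symm⟩ hbr
    · exact absurd ⟨_, hab⟩ hbr
    · rw [c.edge_inj hab]
  vert_surj := by
    intro x
    rcases H.split_V_cases _ X x with rfl | ⟨x, rfl⟩
    · exact ⟨u, by simp⟩
    · obtain ⟨v, rfl⟩ := c.vert_surj x
      by_cases hv : v = u
      · refine ⟨y, ?_⟩
        simp only [if_neg hyu]
        rw [hv, c.vert_eq_of_mem hbr (u := y) (v := u)] <;> simp [hb]
      · exact ⟨v, by simp [hv]⟩
  ends_edge e := by
    rcases H.split_E_cases _ X e with rfl | ⟨e, rfl⟩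
    · rw [splitEElim_newE, split_ends_new, hb, Sym2.map_mk, if_pos rfl, if_neg hyu,
        c.vert_eq_of_mem hbr (u := y) (v := u)] <;> simp [hb]
    · rw [splitEElim_oldE, split_ends_old, c.ends_edge, Sym2.map_map]
      refine Sym2.map_congr fun v hv => ?_
      simp only [Function.comp_apply]
      by_cases hvu : v = u
      · subst hvu
        have : e ∈ X := by
          by_contra he
          exact hbr ⟨e, huniq _ (by rwa [c.edge_inj.mem_set_image]) hv⟩
        simp [this]
      · by_cases he : e ∈ X
        · have : c.vert v ≠ c.vert u := fun h => hvu (hX _ ⟨e, he, rfl⟩ v hv h)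
          simp [hvu, this]
        · simp [he, hvu]
  vert_const e he := by
    have her : e ∉ Set.range c.edge := by
      rintro ⟨f, rfl⟩; exact he ⟨H.oldE _ X f, rfl⟩
    have heX : e ∉ c.edge '' X := fun h => her (Set.image_subset_range _ _ h)
    have hue : u ∉ G.ends e := fun h => he ⟨H.newE _ X, (huniq e heX h).symm⟩
    rw [mem_ends, not_or] at hue
    rw [if_neg hue.1, if_neg hue.2, c.vert_const e her]
  m_vert i := by
    have hm : G.m i ≠ u := by
      intro hi
      have h1 := G.valence_eq_valOn (c.edge '' X) u
      rw [hu, deg] at h1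
      have h2 : 1 ≤ G.marks u := by
        rw [MarkedGraph.marks_eq]
        calc (1 : ℤ) = if G.m i = u then 1 else 0 := by simp [hi]
          _ ≤ _ := Finset.single_le_sum (f := fun i => if G.m i = u then (1 : ℤ) else 0)
            (fun j _ => by split_ifs <;> simp) (Finset.mem_univ i)
      have h3 : 1 ≤ ∑ e with e ∉ c.edge '' X, G.half e u := by
        refine le_trans (G.half_pos (e := b) (v := u) (by simp [hb])) ?_
        refine Finset.single_le_sum (f := fun e => G.half e u) (fun e _ => G.half_nonneg e u) ?_
        simp only [Finset.mem_filter, Finset.mem_univ, true_and]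
        exact fun h => hbr (Set.image_subset_range _ _ h)
      have h4 : (0 : ℤ) ≤ G.w u := by positivity
      omega
    rw [if_neg hm, ← c.m_vert]
    rfl
  fiber x z hxz := by
    have key : ∀ x z, c.vert x = c.vert z → x ≠ u → z ≠ u →
        G.Reach (Set.range (H.splitEElim (c.vert u) X b c.edge))ᶜ x z := by
      intro x z h hx hz
      -- A walk can visit `u` only by a detour along `b`. Sending `u` to `y` turns `b` into a
      -- constant step and leaves a walk that avoids `b`.
      have := reach_map G G (T' := (Set.range (H.splitEElim (c.vert u) X b c.edge))ᶜ)
        (fun v => if v = u then y else v) ?_ (c.fiber x z h)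
      · simpa [hx, hz] using this
      · intro e he
        have heX : e ∉ c.edge '' X := fun h => he (Set.image_subset_range _ _ h)
        by_cases hue : u ∈ G.ends e
        · rw [huniq e heX hue]
          refine reach_of_ends G G (f := fun v => if v = u then y else v) hb ?_
          simp only [if_true, if_neg hyu]
          exact SimpleGraph.Reachable.refl _
        · have hue' := hue
          rw [mem_ends, not_or] at hue'
          simp only [if_neg hue'.1, if_neg hue'.2]
          refine reach_ends _ ?_ (G.src_mem e) (G.tgt_mem e)
          rintro ⟨f, hf⟩
          rcases H.split_E_cases _ X f with rfl | ⟨f, rfl⟩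
          · exact hue (by rw [← hf, splitEElim_newE, hb]; simp)
          · exact he ⟨f, hf⟩
    by_cases hx : x = u <;> by_cases hz : z = u
    · rw [hx, hz]
    · rw [if_pos hx, if_neg hz] at hxz
      exact absurd hxz.symm (H.oldV_ne_newV _ X _)
    · rw [if_neg hx, if_pos hz] at hxz
      exact absurd hxz (H.oldV_ne_newV _ X _)
    · rw [if_neg hx, if_neg hz] at hxz
      exact key x z (H.oldV_injective _ X hxz) hx hz
  deg_eq x := by
    have hval := c.valOn_image hX
    rcases H.split_V_cases _ X x with rfl | ⟨x, rfl⟩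
    · have : (Finset.univ.filter fun v =>
          (if v = u then H.newV (c.vert u) X else H.oldV (c.vert u) X (c.vert v)) =
            H.newV (c.vert u) X) = {u} := by
        ext v
        by_cases hv : v = u <;> simp [hv, oldV_ne_newV]
      rw [this, Finset.sum_singleton, split_deg_new, ← hval, hu]
      ring
    · have : (Finset.univ.filter fun v =>
          (if v = u then H.newV (c.vert u) X else H.oldV (c.vert u) X (c.vert v)) =
            H.oldV (c.vert u) X x) = (Finset.univ.filter fun v => c.vert v = x).erase u := by
        ext v
        by_cases hv : v = u <;>
          simp [hv, (H.oldV_ne_newV _ X _).symm, (H.oldV_injective _ X).eq_iff]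
      rw [this, split_deg_old, ← hval, hu, c.deg_eq]
      by_cases hx : x = c.vert u
      · rw [if_pos hx, ← Finset.add_sum_erase _ _ (a := u) (by simp [hx])]
        ring
      · rw [if_neg hx, Finset.erase_eq_of_notMem (by simp [Ne.symm hx]), sub_zero]

end pull

end MarkedGraph

/-- There are three cases. If splitting is stable upstairs, it is stable downstairs and the split
graphs are related by `splitMap`. If it is stable only downstairs, `b` is collapsed and `toSplit`
recovers it as the new edge. If it is stable on neither side, the fibre of `u` is a single vertex,
`b` survives, and both sides lengthen it. -/
theorem pullPoint_contr {G H : CombType g n} (c : CContr G H) {u : G.V} {X : Set H.E}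
    (hX : ∀ e ∈ c.edge '' X, ∀ v ∈ G.ends e, c.vert v = c.vert u → v = u)
    (hG : G.Pullable (c.edge '' X) u) (hH : H.Pullable X (c.vert u)) (l : Cone G)
    (hl : ∀ e ∉ Set.range c.edge, l e = 0) (s : ℝ≥0) :
    pullPoint G u (c.edge '' X) l s = pullPoint H (c.vert u) X (l ∘ c.edge) s := by
  have hval := c.valOn_image hX
  have hpos := (stable_iff _).1 G.stable
  have hXr : ∀ e ∈ c.edge '' X, e ∈ Set.range c.edge := fun e he => Set.image_subset_range _ _ he
  have hdeg : G.deg u ≤ H.deg (c.vert u) := by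
    rw [c.deg_eq]
    exact Finset.single_le_sum (f := fun v => G.deg v) (fun v _ => (hpos v).le) (by simp)
  by_cases h : 2 ≤ G.valOn (c.edge '' X) u ∧ G.valOn (c.edge '' X) u ≤ G.deg u
  · have h' : 2 ≤ H.valOn X (c.vert u) ∧ H.valOn X (c.vert u) ≤ H.deg (c.vert u) := by
      omega
    rw [pullPoint, pullPoint, dif_pos h, dif_pos h']
    have := mk_eq_of_contr (G := G.split u _ h) (H := H.split _ X h') (c.splitMap hX)
      (G.splitEElim u _ s l) ?_
    · rw [this]
      congr 1
      funext e
      rcases H.split_E_cases _ X e with rfl | ⟨e, rfl⟩ <;> rfl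
    · intro e he
      rcases G.split_E_cases u _ e with rfl | ⟨e, rfl⟩
      · exact absurd ⟨H.newE _ X, rfl⟩ he
      · refine hl e ?_
        rintro ⟨f, rfl⟩
        exact he ⟨H.oldE _ X f, rfl⟩
  · have hlt : ¬ G.valOn (c.edge '' X) u ≤ G.deg u := fun h' => h ⟨hG.two_le, h'⟩
    have hu : G.valOn (c.edge '' X) u = G.deg u + 1 := by have := hG.le_deg; omega
    obtain ⟨b, hbX, ⟨y, hyu, hb⟩, huniq⟩ := hG.exists_unique hlt
    rw [pullPoint, dif_neg h]
    by_cases h' : 2 ≤ H.valOn X (c.vert u) ∧ H.valOn X (c.vert u) ≤ H.deg (c.vert u)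
    · have hlt' : G.deg u < H.deg (c.vert u) := by omega
      -- The larger degree downstairs needs a second vertex in the fibre. It is reached from `u`
      -- through collapsed edges, and outside `X` only `b` leaves `u`.
      have hex : ∃ v, v ≠ u ∧ c.vert v = c.vert u := by
        by_contra hne
        push Not at hne
        rw [c.deg_eq, Finset.sum_eq_single u] at hlt'
        · exact lt_irrefl _ hlt'
        · intro v hv hvu
          exact absurd (by simpa using hv) (hne v hvu)
        · simp
      have hbr : b ∉ Set.range c.edge := by
        intro hbr
        obtain ⟨v, hvu, hv⟩ := hex
        have hr := c.fiber v u hv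
        have := G.mem_iff_of_reach (A := {u}) (T := (Set.range c.edge)ᶜ) ?_ hr
        · exact hvu (this.2 rfl)
        · intro e he he'
          obtain ⟨a, ha, _, _, hab⟩ := G.mem_bdry_iff.1 he'
          have hae : u ∈ G.ends e := by
            rw [hab]; rw [Set.mem_singleton_iff] at ha; simp [ha]
          exact he (huniq e (fun h => he (hXr e h)) hae ▸ hbr)
      rw [pullPoint, dif_pos h']
      have := mk_eq_of_contr (G := G) (H := H.split _ X h')
        (c.toSplit hX hu hyu hb hbr huniq)
        (fun e => l e + if e ∉ c.edge '' X ∧ u ∈ G.ends e then s else 0) ?_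
      · rw [this]
        congr 1
        funext e
        rcases H.split_E_cases _ X e with rfl | ⟨e, rfl⟩
        · change l b + (if b ∉ c.edge '' X ∧ u ∈ G.ends b then s else 0) = s
          rw [hl b hbr, if_pos ⟨hbX, by simp [hb]⟩, zero_add]
        · change l (c.edge e) + (if c.edge e ∉ c.edge '' X ∧ u ∈ G.ends (c.edge e) then s else 0)
            = l (c.edge e)
          rw [if_neg, add_zero]
          rintro ⟨h1, h2⟩
          exact hbr ⟨e, huniq _ h1 h2⟩
      · intro e he
        have her : e ∉ Set.range c.edge := by
          rintro ⟨f, rfl⟩; exact he ⟨H.oldE _ X f, rfl⟩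
        rw [hl e her, zero_add, if_neg]
        rintro ⟨h1, h2⟩
        exact he ⟨H.newE _ X, (huniq e h1 h2).symm⟩
    · have hlt' : H.deg (c.vert u) = G.deg u := by
        have := hH.two_le
        have : ¬ H.valOn X (c.vert u) ≤ H.deg (c.vert u) := fun h => h' ⟨this, h⟩
        omega
      -- Equal degrees leave no room for another vertex in the fibre, since each would add a
      -- positive degree.
      have hinj : ∀ v, c.vert v = c.vert u → v = u := by
        intro v hv
        by_contra hvu
        rw [c.deg_eq] at hlt'
        have h1 : ∑ w ∈ {v, u}, G.deg w ≤ ∑ w with c.vert w = c.vert u, G.deg w := by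
          refine Finset.sum_le_sum_of_subset_of_nonneg ?_ fun w _ _ => (hpos w).le
          intro w hw
          simp only [Finset.mem_insert, Finset.mem_singleton] at hw
          rcases hw with rfl | rfl <;> simp [hv]
        rw [Finset.sum_pair hvu] at h1
        have := hpos v
        omega
      have hbr : b ∈ Set.range c.edge := by
        by_contra hbr
        exact hyu (hinj y (c.vert_eq_of_mem hbr (by simp [hb]) (by simp [hb])))
      rw [pullPoint, dif_neg h']
      have := mk_eq_of_contr c
        (fun e => l e + if e ∉ c.edge '' X ∧ u ∈ G.ends e then s else 0) ?_
      · rw [this]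
        congr 1
        funext e
        simp only [Function.comp_apply, c.edge_inj.mem_set_image]
        congr 1
        have : u ∈ G.ends (c.edge e) ↔ c.vert u ∈ H.ends e := by
          rw [c.ends_edge, Sym2.mem_map]
          exact ⟨fun h => ⟨u, h, rfl⟩, fun ⟨v, hv, hvu⟩ => hinj v hvu ▸ hv⟩
        simp only [this]
      · intro e he
        rw [hl e he, zero_add, if_neg]
        rintro ⟨h1, h2⟩
        exact he (huniq e h1 h2 ▸ hbr)

/-! ### Bridgeless graphs of genus two -/

namespace MarkedGraph

/-- The contribution `2 w(v) - 2 + val(v)` of a vertex to twice the genus minus two. -/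
def exc (G : MarkedGraph n) (v : G.V) : ℤ := 2 * (G.w v : ℤ) - 2 + (G.valence v : ℤ)

theorem deg_eq_exc (G : MarkedGraph n) (v : G.V) : G.deg v = G.exc v + G.marks v := rfl

theorem sum_exc (G : MarkedGraph n) : ∑ v, G.exc v = 2 * (G.genus - 1) := by
  have h := G.sum_deg
  simp only [deg_eq_exc, Finset.sum_add_distrib, sum_marks] at h
  linarith

/-- There are no bridges. -/
def Bridgeless (G : MarkedGraph n) : Prop := ∀ e, ¬ G.IsBridge e

theorem bdry_compl (G : MarkedGraph n) (A : Set G.V) : G.bdry Aᶜ = G.bdry A := by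
  ext e; simp only [bdry, Set.mem_ofPred_eq, Set.mem_compl_iff]; tauto

theorem mem_bdry_symmDiff (G : MarkedGraph n) (A B : Set G.V) (e : G.E) :
    e ∈ G.bdry (symmDiff A B) ↔ ¬ (e ∈ G.bdry A ↔ e ∈ G.bdry B) := by
  simp only [bdry, Set.mem_ofPred_eq, Set.mem_symmDiff]; tauto

theorem two_le_ncard_bdry {G : MarkedGraph n} (hG : G.Connected) {B : Set G.V}
    (hne : (G.bdry B).Nonempty) (hN : ∀ e ∈ G.bdry B, ¬ G.IsBridge e) :
    2 ≤ (G.bdry B).ncard := by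
  have h0 : (G.bdry B).ncard ≠ 0 := ((Set.ncard_pos (Set.toFinite _)).2 hne).ne'
  have h1 : (G.bdry B).ncard ≠ 1 := by
    intro h
    obtain ⟨e, he⟩ := Set.ncard_eq_one.1 h
    exact hN e (by simp [he]) ((isBridge_iff hG e).2 ⟨B, he⟩)
  omega

theorem half_bdry (G : MarkedGraph n) {A : Set G.V} {u : G.V} (hu : u ∉ A) {e : G.E}
    (he : e ∈ G.bdry A) (hue : u ∈ G.ends e) : G.half e u = 1 := by
  obtain ⟨a, ha, b, hb, hab⟩ := G.mem_bdry_iff.1 he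
  have hau : a ≠ u := by rintro rfl; exact hu ha
  rw [hab, Sym2.mem_iff] at hue
  have hbu : b = u := by rcases hue with h | h <;> simp_all
  rw [half_eq_of_ends _ hab]
  simp [hau, hbu]

theorem valOn_bdry (G : MarkedGraph n) {A : Set G.V} {u : G.V} (hu : u ∉ A)
    (hA : ∀ e ∈ G.bdry A, u ∈ G.ends e) : G.valOn (G.bdry A) u = (G.bdry A).ncard := by
  rw [valOn, Finset.sum_congr rfl (g := fun _ => (1 : ℤ))]
  · rw [Finset.sum_const, nsmul_one, Set.ncard_eq_toFinset_card']
    congr 2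
    ext e; simp
  · intro e he
    simp only [Finset.mem_filter, Finset.mem_univ, true_and] at he
    exact G.half_bdry hu he (hA e he)

theorem mem_bdry_singleton (G : MarkedGraph n) {v : G.V} {e : G.E} (h : e ∈ G.bdry {v}ᶜ) :
    v ∈ G.ends e := by
  obtain ⟨a, ha, b, hb, hab⟩ := G.mem_bdry_iff.1 h
  simp only [Set.mem_compl_iff, Set.mem_singleton_iff, not_not] at hb
  rw [hab, hb]; simp

theorem valence_singleton (G : MarkedGraph n) (v : G.V) :
    ∃ k : ℤ, 0 ≤ k ∧ (G.valence v : ℤ) = (G.bdry {v}ᶜ).ncard + 2 * k := by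
  have h := G.valence_eq_valOn (G.bdry {v}ᶜ) v
  rw [G.valOn_bdry (by simp) (fun e he => G.mem_bdry_singleton he)] at h
  have hd : (2 : ℤ) ∣ ∑ e with e ∉ G.bdry {v}ᶜ, G.half e v := by
    refine Finset.dvd_sum fun e he => ?_
    simp only [Finset.mem_filter, Finset.mem_univ, true_and] at he
    have := G.not_mem_bdry he (G.src_mem e) (G.tgt_mem e)
    simp only [Set.mem_compl_iff, Set.mem_singleton_iff, not_iff_not] at this
    unfold half
    by_cases hs : G.src e = v <;> simp_all
  obtain ⟨k, hk⟩ := hd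
  have hn : 0 ≤ ∑ e with e ∉ G.bdry {v}ᶜ, G.half e v :=
    Finset.sum_nonneg fun e _ => G.half_nonneg e v
  exact ⟨k, by omega, by omega⟩

/-- Without bridges, a vertex that is not alone has at least two half-edges leading elsewhere; a
vertex that is alone carries the whole sum, which is two. -/
theorem exc_nonneg {G : MarkedGraph n} (hG : G.Connected) (hb : G.Bridgeless) (hg : G.genus = 2)
    (v : G.V) : 0 ≤ G.exc v := by
  by_cases h : ∃ w, w ≠ v
  · obtain ⟨w, hw⟩ := h
    have h2 := two_le_ncard_bdry hG (B := {v}ᶜ)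
      (bdry_nonempty hG (u := w) (v := v) (by simpa using hw) (by simp)) (fun e _ => hb e)
    obtain ⟨k, hk, hv⟩ := G.valence_singleton v
    have : (0 : ℤ) ≤ G.w v := by positivity
    rw [exc]; omega
  · push Not at h
    have h1 := G.sum_exc
    rw [Fintype.sum_eq_single v (fun w hw => absurd (h w) hw), hg] at h1
    omega

theorem exc_eq_zero {G : MarkedGraph n} (hG : G.Connected) (hb : G.Bridgeless) (hg : G.genus = 2)
    {v : G.V} (hv : 2 ≤ G.exc v) {w : G.V} (hw : w ≠ v) : G.exc w = 0 := by
  have h1 := G.sum_exc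
  have h2 : ∑ x ∈ {w, v}, G.exc x ≤ ∑ x, G.exc x :=
    Finset.sum_le_sum_of_subset_of_nonneg (Finset.subset_univ _)
      fun x _ _ => exc_nonneg hG hb hg x
  rw [Finset.sum_pair hw, h1, hg] at h2
  have := exc_nonneg hG hb hg w
  omega

/-- Sets of vertices whose boundary can be pulled away canonically in all graphs that give `G` after
collapsing bridges. -/
def Cand (G : MarkedGraph n) (A : Set G.V) : Prop :=
  ∃ v ∉ A, (∀ e ∈ G.bdry A, v ∈ G.ends e) ∧
    ((2 ≤ G.exc v ∧ (G.bdry A).ncard = 2) ∨ ((∀ x, G.exc x ≤ 1) ∧ A = {v}ᶜ ∧ 2 ≤ G.marks v))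

theorem exists_mark {G : MarkedGraph n} {v : G.V} (h : 1 ≤ G.marks v) : ∃ i, G.m i = v := by
  by_contra hne
  push Not at hne
  rw [marks_eq, Finset.sum_eq_zero fun i _ => if_neg (hne i)] at h
  omega

/-- With a vertex of `exc` two, both sides hang on that vertex by two edges. Every vertex in a side
has `exc` zero and hence a mark, so equal marks make the sides meet. The boundary of their
intersection lies in both boundaries and has at least two edges, so the boundaries agree. In the
theta case the mark set determines the omitted vertex. -/
theorem Cand.eq_of_marks {G : MarkedGraph n} (hG : G.Connected) (hs : G.Stable)
    (hb : G.Bridgeless) (hg : G.genus = 2) {A B : Set G.V} (hA : G.Cand A) (hB : G.Cand B)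
    (h : G.m ⁻¹' A = G.m ⁻¹' B) : A = B := by
  obtain ⟨v, hv, hve, hA⟩ := hA
  obtain ⟨w, hw, hwe, hB⟩ := hB
  rcases hA with ⟨hA1, hA2⟩ | ⟨hA1, hA2, hA3⟩
  · rcases hB with ⟨hB1, hB2⟩ | ⟨hB1, hB2, hB3⟩
    · obtain rfl : v = w := by
        by_contra hne
        have := exc_eq_zero hG hb hg hB1 hne
        omega
      have hAne : ∃ a, a ∈ A := by
        have : (G.bdry A).Nonempty := (Set.ncard_pos (Set.toFinite _)).1 (by omega)
        obtain ⟨e, he⟩ := this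
        obtain ⟨a, ha, _⟩ := G.mem_bdry_iff.1 he
        exact ⟨a, ha⟩
      obtain ⟨a, ha⟩ := hAne
      have hav : a ≠ v := by rintro rfl; exact hv ha
      have h1 := exc_eq_zero hG hb hg hA1 hav
      have h2 := (G.stable_iff).1 hs a
      rw [deg_eq_exc, h1] at h2
      obtain ⟨i, rfl⟩ := exists_mark (by omega : 1 ≤ G.marks a)
      have haB : G.m i ∈ B := by
        have : i ∈ G.m ⁻¹' A := ha
        rwa [h] at this
      have key : ∀ C D : Set G.V, v ∉ C → v ∉ D → (∀ e ∈ G.bdry C, v ∈ G.ends e) →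
          ∀ e a b, a ∈ C → a ∈ D → b ∉ C → G.ends e = s(a, b) → e ∈ G.bdry D := by
        intro C D hC hD hCe e a b haC haD hbC hab
        have hve := hCe e (G.mem_bdry_iff.2 ⟨a, haC, b, hbC, hab⟩)
        rw [hab, Sym2.mem_iff] at hve
        rcases hve with rfl | rfl
        · exact absurd haC hC
        · exact G.mem_bdry_iff.2 ⟨a, haD, v, hD, hab⟩
      have hsub : G.bdry (A ∩ B) ⊆ G.bdry A ∩ G.bdry B := by
        intro e he
        obtain ⟨a, ⟨haA, haB⟩, b, hbn, hab⟩ := G.mem_bdry_iff.1 he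
        by_cases hbA : b ∈ A
        · have hbB : b ∉ B := fun h => hbn ⟨hbA, h⟩
          exact ⟨key B A hw hv hwe e a b haB haA hbB hab, G.mem_bdry_iff.2 ⟨a, haB, b, hbB, hab⟩⟩
        · exact ⟨G.mem_bdry_iff.2 ⟨a, haA, b, hbA, hab⟩, key A B hv hw hve e a b haA haB hbA hab⟩
      have h3 := two_le_ncard_bdry hG (B := A ∩ B)
        (bdry_nonempty hG (u := G.m i) (v := v) ⟨ha, haB⟩ (fun h => hv h.1)) (fun e _ => hb e)
      have hfin : ∀ s : Set G.E, s.Finite := fun s => Set.toFinite s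
      have e1 : G.bdry (A ∩ B) = G.bdry A :=
        Set.eq_of_subset_of_ncard_le (fun e he => (hsub he).1) (by omega) (hfin _)
      have e2 : G.bdry (A ∩ B) = G.bdry B :=
        Set.eq_of_subset_of_ncard_le (fun e he => (hsub he).2) (by omega) (hfin _)
      by_contra hne
      -- Sets with equal boundary have a symmetric difference without boundary; it misses `v`, so by
      -- connectedness it is empty.
      have : (symmDiff A B).Nonempty := by
        rw [Set.nonempty_iff_ne_empty]
        intro h
        exact hne (symmDiff_eq_bot.1 h)
      obtain ⟨x, hx⟩ := this
      obtain ⟨e, he⟩ := bdry_nonempty hG (A := symmDiff A B) hx (v := v) (by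
        simp [Set.mem_symmDiff, hv, hw])
      rw [mem_bdry_symmDiff, ← e1, ← e2] at he
      exact he Iff.rfl
    · have := hB1 v; omega
  · rcases hB with ⟨hB1, hB2⟩ | ⟨hB1, hB2, hB3⟩
    · have := hA1 w; omega
    · obtain ⟨i, rfl⟩ := exists_mark (by omega : 1 ≤ G.marks v)
      have h1 : i ∉ G.m ⁻¹' B := by rw [← h]; exact hv
      subst hB2
      have h2 : G.m i = w := by simpa using h1
      rw [hA2, h2]

theorem card_le_of_connected (G : MarkedGraph n) (T : Set G.E) (h : (G.edgeGraph T).Connected) :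
    Fintype.card G.V ≤ T.ncard + 1 := by
  have h1 := h.card_vert_le_card_edgeSet_add_one
  rw [Nat.card_eq_fintype_card] at h1
  refine h1.trans (Nat.add_le_add_right ?_ 1)
  have hex : ∀ a : (G.edgeGraph T).edgeSet, ∃ e : T, G.ends e = a.1 := by
    rintro ⟨a, ha⟩
    induction a with
    | h u v =>
      obtain ⟨_, e, he, hends⟩ := ha
      exact ⟨⟨e, he⟩, hends⟩
  choose f hf using hex
  refine Nat.card_le_card_of_injective f ?_
  intro a b hab
  exact Subtype.ext ((hf a).symm.trans ((congrArg (fun e => G.ends e.1) hab).trans (hf b)))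

/-- The vertex has exactly `exc` two, so the number of its non-loop edges is two or four. With two,
the rest of the graph is the side. With four, deleting the vertex must disconnect the graph, and
each part takes at least two of the four edges. -/
theorem exists_cand_of_exc {G : MarkedGraph n} (hG : G.Connected) (hb : G.Bridgeless)
    (hg : G.genus = 2) {e₀ : G.E} (he₀ : G.src e₀ ≠ G.tgt e₀) {v : G.V} (hv : 2 ≤ G.exc v) :
    ∃ A, G.Cand A := by
  obtain ⟨w, hw⟩ : ∃ w, w ≠ v := by
    by_contra h
    push Not at h
    exact he₀ ((h _).trans (h _).symm)
  have hD := two_le_ncard_bdry hG (B := {v}ᶜ)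
      (bdry_nonempty hG (u := w) (v := v) (by simpa using hw) (by simp)) (fun e _ => hb e)
  by_cases hD2 : (G.bdry {v}ᶜ).ncard = 2
  · exact ⟨{v}ᶜ, v, by simp, fun e he => G.mem_bdry_singleton he, Or.inl ⟨hv, hD2⟩⟩
  have hv2 : G.exc v ≤ 2 := by
    have h1 := G.sum_exc
    have h2 := Finset.single_le_sum (f := G.exc) (fun x _ => exc_nonneg hG hb hg x)
      (Finset.mem_univ v)
    rw [h1, hg] at h2
    omega
  obtain ⟨k, hk, hval⟩ := G.valence_singleton v
  have hw0 : (0 : ℤ) ≤ G.w v := by positivity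
  have hD4 : (G.bdry {v}ᶜ).ncard = 4 := by
    rw [exc] at hv hv2
    omega
  set D := G.bdry {v}ᶜ with hDdef
  set A := {x | G.Reach Dᶜ w x} with hA
  have hvA : v ∉ A := by
    intro h
    have := G.mem_iff_of_reach (A := {v}ᶜ) (T := Dᶜ) (fun e he => he) h
    simp [hw] at this
  have hAD : G.bdry A ⊆ D := by
    intro e he
    by_contra heD
    exact G.not_mem_bdry_reach (T := Dᶜ) heD w he
  set B := {v}ᶜ \ A with hB
  have hBD : G.bdry B ⊆ D := by
    intro e he
    obtain ⟨a, ⟨hav, haA⟩, b, hb, hab⟩ := G.mem_bdry_iff.1 he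
    by_cases hbv : b = v
    · exact G.mem_bdry_iff.2 ⟨a, hav, b, by simp [hbv], hab⟩
    · have hbA : b ∈ A := by
        by_contra h
        exact hb ⟨hbv, h⟩
      exact hAD (G.mem_bdry_iff.2 ⟨b, hbA, a, haA, by rw [hab, Sym2.eq_swap]⟩)
  have hwA : w ∈ A := SimpleGraph.Reachable.refl _
  have hA2 := two_le_ncard_bdry hG (B := A)
    (bdry_nonempty hG (u := w) (v := v) hwA hvA) (fun e _ => hb e)
  by_cases hBne : B.Nonempty
  · obtain ⟨x, hx⟩ := hBne
    have hB2 := two_le_ncard_bdry hG (B := B)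
      (bdry_nonempty hG (u := x) (v := v) hx (by simp [hB])) (fun e _ => hb e)
    have hdisj : Disjoint (G.bdry A) (G.bdry B) := by
      rw [Set.disjoint_left]
      intro e heA heB
      obtain ⟨a, ha, b, hb, hab⟩ := G.mem_bdry_iff.1 heA
      have hve := G.mem_bdry_singleton (hAD heA)
      obtain ⟨a', ha', b', hb', hab'⟩ := G.mem_bdry_iff.1 heB
      have h1 : a' ∈ G.ends e := by simp [hab']
      rw [hab, Sym2.mem_iff] at hve h1
      have hav : a ≠ v := by rintro rfl; exact hvA ha
      have hbv : b = v := by rcases hve with h | h <;> simp_all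
      rcases h1 with rfl | rfl
      · exact ha'.2 ha
      · exact ha'.1 hbv
    have hsum := Set.ncard_union_eq hdisj (Set.toFinite _) (Set.toFinite _)
    have hle := Set.ncard_le_ncard (Set.union_subset hAD hBD) (Set.toFinite D)
    refine ⟨A, v, hvA, fun e he => G.mem_bdry_singleton (hAD he), Or.inl ⟨hv, ?_⟩⟩
    omega
  · exfalso
    have hall : ∀ x, x ≠ v → x ∈ A := by
      intro x hx
      by_contra h
      exact hBne ⟨x, hx, h⟩
    obtain ⟨e, he⟩ : D.Nonempty := (Set.ncard_pos (Set.toFinite _)).1 (by omega)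
    -- If deleting `v` left a connected graph, one edge of `D` would suffice to connect everything.
    -- The other three would then be independent cycles, too many for genus two.
    have hreach : ∀ x, G.Reach (insert e Dᶜ) w x := by
      intro x
      by_cases hx : x = v
      · obtain ⟨a, ha, b, hb, hab⟩ := G.mem_bdry_iff.1 he
        have hbv : b = v := by simpa using hb
        refine (G.reach_mono (Set.subset_insert _ _) (hall a ha)).trans ?_
        exact G.reach_ends (Set.mem_insert _ _) (by simp [hab]) (by simp [hab, hx, hbv])
      · exact G.reach_mono (Set.subset_insert _ _) (hall x hx)
    have hcard := G.card_le_of_connected (insert e Dᶜ)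
      ((G.connected_iff _).2 ⟨⟨v⟩, fun x y => (hreach x).symm.trans (hreach y)⟩)
    have h1 := Set.ncard_insert_le e Dᶜ
    have h2 := Set.ncard_add_ncard_compl D
    rw [Nat.card_eq_fintype_card] at h2
    have hwsum : (0 : ℤ) ≤ ∑ x, (G.w x : ℤ) := Finset.sum_nonneg fun x _ => by positivity
    rw [genus] at hg
    omega

theorem Contr.exc_eq {G H : MarkedGraph n} (c : Contr G H) (x : H.V) :
    H.exc x = ∑ v with c.vert v = x, G.exc v := by
  have h1 := c.deg_eq x
  have h2 := c.marks_eq x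
  simp only [deg_eq_exc, Finset.sum_add_distrib] at h1
  linarith

/-- All collapsed edges other than `b` are contracted, giving `K` with the bridge `b'`. If no vertex
carried two marks, an end of `b'` with `exc` below one would have, by stability, exactly one mark
and two non-loop edges; the second edge would be a bridge surviving in `H`. So both ends have `exc`
at least one, and they merge into a vertex with `exc` at least two. -/
theorem exists_two_marks {G H : MarkedGraph n} (c : Contr G H) (hG : G.Connected)
    (hs : G.Stable) (hb : H.Bridgeless) (hexc : ∀ x, H.exc x ≤ 1) {b : G.E} (hbb : G.IsBridge b) :
    ∃ x, 2 ≤ H.marks x := by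
  by_contra hne
  push Not at hne
  have hbr : b ∉ Set.range c.edge := by
    rintro ⟨e, rfl⟩
    exact hb e ((c.isBridge_edge hG e).1 hbb)
  obtain ⟨K, c₁, hr₁⟩ : ∃ (K : MarkedGraph n) (c₁ : Contr G K),
      Set.range c₁.edge = ((Set.range c.edge)ᶜ \ {b})ᶜ :=
    ⟨_, G.toContract _, range_contractEdge _ _⟩
  obtain ⟨d, -, hd⟩ := c₁.exists_factor c (by
    rw [hr₁]; intro e he h; exact h.1 he)
  have hK : K.Connected := c₁.connected hG
  have hKs : K.Stable := c₁.stable hs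
  obtain ⟨b', hb'⟩ : b ∈ Set.range c₁.edge := by
    rw [hr₁]; simp
  have hbK : K.IsBridge b' := (c₁.isBridge_edge hG b').1 (by rw [hb']; exact hbb)
  have honly : ∀ e, e ∉ Set.range d.edge → e = b' := by
    intro e he
    have h1 : c₁.edge e ∈ Set.range c₁.edge := ⟨e, rfl⟩
    rw [hr₁] at h1
    by_cases h2 : c₁.edge e ∈ Set.range c.edge
    · obtain ⟨f, hf⟩ := h2
      rw [← hd] at hf
      exact absurd ⟨f, c₁.edge_inj hf⟩ he
    · have : c₁.edge e = b := by
        by_contra h3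
        exact h1 ⟨h2, h3⟩
      exact c₁.edge_inj (this.trans hb'.symm)
  have hbd : b' ∉ Set.range d.edge := by
    rintro ⟨f, rfl⟩
    exact hbr ⟨f, by rw [← hd, hb']⟩
  obtain ⟨B, hB⟩ := (isBridge_iff hK b').1 hbK
  obtain ⟨x, hx, y, hy, hxy⟩ := K.mem_bdry_iff.1 (show b' ∈ K.bdry B by simp [hB])
  have hmarks : ∀ z, K.marks z ≤ 1 := by
    intro z
    have := hne (d.vert z)
    rw [d.marks_eq] at this
    have h2 := Finset.single_le_sum (f := K.marks) (s := {v | d.vert v = d.vert z})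
      (fun v _ => K.marks_nonneg v) (a := z) (by simp)
    omega
  have key : ∀ (z : K.V) (C : Set K.V), K.bdry C = {b'} → z ∈ C → z ∈ K.ends b' →
      1 ≤ K.exc z := by
    intro z C hC hz hzb
    by_contra hlt
    have h1 := (K.stable_iff).1 hKs z
    have h2 := hmarks z
    rw [deg_eq_exc] at h1
    obtain ⟨k, hk, hval⟩ := K.valence_singleton z
    have hbz : b' ∈ K.bdry {z}ᶜ := by
      obtain ⟨p, hp, q, hq, hpq⟩ := K.mem_bdry_iff.1 (show b' ∈ K.bdry C by simp [hC])
      rw [hpq, Sym2.mem_iff] at hzb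
      rw [K.mem_bdry_of_ends hpq]
      rcases hzb with rfl | rfl
      · have : q ≠ z := by rintro rfl; exact hq hz
        simp [this]
      · exact absurd hz hq
    have hpos : 0 < (K.bdry {z}ᶜ).ncard := (Set.ncard_pos (Set.toFinite _)).2 ⟨b', hbz⟩
    have hw0 : (0 : ℤ) ≤ K.w z := by positivity
    have hcard : (K.bdry {z}ᶜ).ncard = 2 := by
      rw [exc] at h1 hlt
      omega
    obtain ⟨f, hf⟩ : ∃ f, f ≠ b' ∧ K.bdry {z}ᶜ = {b', f} := by
      obtain ⟨p, q, hpq, heq⟩ := Set.ncard_eq_two.1 hcard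
      rw [heq] at hbz
      rcases hbz with h | h
      · exact ⟨q, by rw [h]; exact hpq.symm, by rw [heq, h]⟩
      · rw [Set.mem_singleton_iff] at h
        exact ⟨p, by rw [h]; exact hpq, by rw [heq, h, Set.pair_comm]⟩
    have hfb : K.IsBridge f := by
      rw [isBridge_iff hK]
      refine ⟨symmDiff C {z}ᶜ, ?_⟩
      ext e
      rw [mem_bdry_symmDiff, hC, hf.2]
      simp only [Set.mem_singleton_iff, Set.mem_insert_iff]
      constructor
      · intro h
        by_cases h1 : e = b' <;> tauto
      · rintro rfl
        simp [hf.1]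
    obtain ⟨f', rfl⟩ : f ∈ Set.range d.edge := by
      by_contra h
      exact hf.1 (honly f h)
    exact hb f' ((d.isBridge_edge hK f').1 hfb)
  have hex := key x B hB hx (by simp [hxy])
  have hey := key y Bᶜ (by rw [bdry_compl, hB]) hy (by simp [hxy])
  have hxne : x ≠ y := by rintro rfl; exact hy hx
  have hveq : d.vert x = d.vert y := d.vert_eq_of_mem hbd (by simp [hxy]) (by simp [hxy])
  have hfib : (Finset.univ.filter fun z => d.vert z = d.vert y) = {x, y} := by
    ext z
    simp only [Finset.mem_filter, Finset.mem_univ, true_and, Finset.mem_insert,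
      Finset.mem_singleton]
    constructor
    · intro h
      have hr := d.fiber z y h
      have : z = y ∨ (z ∈ K.ends b' ∧ y ∈ K.ends b') := by
        refine K.reach_induction (R := fun p q => p = q ∨ (p ∈ K.ends b' ∧ q ∈ K.ends b'))
          ⟨fun _ => Or.inl rfl, ?_, ?_⟩ ?_ hr
        · rintro p q (rfl | h)
          · exact Or.inl rfl
          · exact Or.inr ⟨h.2, h.1⟩
        · rintro p q r (rfl | h) (rfl | h')
          · exact Or.inl rfl
          · exact Or.inr h'
          · exact Or.inr h
          · exact Or.inr ⟨h.1, h'.2⟩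
        · intro e he
          rw [honly e he]
          exact Or.inr ⟨K.src_mem b', K.tgt_mem b'⟩
      rcases this with h | ⟨h, _⟩
      · exact Or.inr h
      · rwa [hxy, Sym2.mem_iff] at h
    · rintro (rfl | rfl)
      · exact hveq
      · rfl
  have := d.exc_eq (d.vert y)
  rw [hfib, Finset.sum_pair hxne] at this
  have := hexc (d.vert y)
  omega

/-! ### Collapsing bridges, and cuts with an apex -/

theorem reach_diff_bridge (G : MarkedGraph n) {B : Set G.V} {b : G.E} (hB : G.bdry B = {b})
    {S : Set G.E} {u v : G.V} (h : G.Reach S u v) (hu : u ∈ B) (hv : v ∈ B) :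
    G.Reach (S \ {b}) u v := by
  obtain ⟨p, hp, q, hq, hpq⟩ := G.mem_bdry_iff.1 (show b ∈ G.bdry B by simp [hB])
  -- The far side of the bridge is retracted to its end `p` in `B`, so that excursions across `b`
  -- become constant.
  have key := G.reach_map G (T' := S \ {b}) (fun x => if x ∈ B then x else p) ?_ h
  · simpa [hu, hv] using key
  · intro e he
    by_cases heb : e = b
    · subst heb
      exact G.reach_of_ends G (f := fun x => if x ∈ B then x else p) hpq (by simp [hp, hq])
    · have hn : e ∉ G.bdry B := by simpa [hB] using heb
      have hiff := G.not_mem_bdry hn (G.src_mem e) (G.tgt_mem e)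
      by_cases hs : G.src e ∈ B
      · simp only [hs, hiff.1 hs, if_true]
        exact G.reach_ends (T := S \ {b}) (e := e) ⟨he, heb⟩ (G.src_mem e) (G.tgt_mem e)
      · have ht : G.tgt e ∉ B := fun h => hs (hiff.2 h)
        simp [hs, ht]

/-- Bridges form a forest: vertices joined by bridges but separated by none of them coincide. The
induction discards one bridge at a time, staying on the common side of its cut. -/
theorem eq_of_reach_bridges {G : MarkedGraph n} (hG : G.Connected) {S : Set G.E}
    (hS : ∀ b ∈ S, G.IsBridge b) {u v : G.V} (h : G.Reach S u v)
    (hsep : ∀ b ∈ S, ∀ B, G.bdry B = {b} → (u ∈ B ↔ v ∈ B)) : u = v := by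
  induction S, Set.toFinite S using Set.Finite.induction_on generalizing u v with
  | empty => exact G.reach_induction (R := Eq) ⟨fun _ => rfl, Eq.symm, Eq.trans⟩ (by simp) h
  | @insert b S hb _ ih =>
    obtain ⟨B, hB⟩ := (isBridge_iff hG b).1 (hS b (Set.mem_insert _ _))
    have hiff := hsep b (Set.mem_insert _ _) B hB
    have hr : G.Reach S u v := by
      have hsub : insert b S \ {b} ⊆ S := by
        rintro x ⟨hx, hxb⟩
        exact hx.resolve_left hxb
      by_cases hu : u ∈ B
      · exact G.reach_mono hsub (G.reach_diff_bridge hB h hu (hiff.1 hu))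
      · exact G.reach_mono hsub (G.reach_diff_bridge (B := Bᶜ) (by rw [bdry_compl, hB]) h hu
          fun h => hu (hiff.2 h))
    exact ih (fun b hb => hS b (Set.mem_insert_of_mem _ hb)) hr
      fun b hb => hsep b (Set.mem_insert_of_mem _ hb)

/-- A contraction that collapses only bridges. -/
def Contr.Mild {G H : MarkedGraph n} (c : Contr G H) : Prop :=
  ∀ e, e ∉ Set.range c.edge → G.IsBridge e

theorem Contr.Mild.src_eq_tgt {G H : MarkedGraph n} {c : Contr G H} (hc : c.Mild)
    (hG : G.Connected) {e : G.E} (he : ¬ G.IsBridge e)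
    (h : c.vert (G.src e) = c.vert (G.tgt e)) : G.src e = G.tgt e := by
  refine eq_of_reach_bridges hG (S := (Set.range c.edge)ᶜ) (fun b hb => hc b hb)
    (c.fiber _ _ h) fun b hb B hB => ?_
  refine G.not_mem_bdry (e := e) ?_ (G.src_mem e) (G.tgt_mem e)
  rw [hB, Set.mem_singleton_iff]
  rintro rfl
  exact he (hc _ hb)

theorem Contr.Mild.comp {G H K : MarkedGraph n} {c : Contr G H} {d : Contr H K} (hc : c.Mild)
    (hd : d.Mild) (hG : G.Connected) : (c.comp d).Mild := by
  intro e he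
  by_cases h : e ∈ Set.range c.edge
  · obtain ⟨f, rfl⟩ := h
    refine (c.isBridge_edge hG f).2 (hd f ?_)
    rintro ⟨x, rfl⟩
    exact he ⟨x, rfl⟩
  · exact hc e h

theorem Contr.mem_range {G H : MarkedGraph n} {c : Contr G H} (hc : c.Mild) {e : G.E}
    (he : ¬ G.IsBridge e) : e ∈ Set.range c.edge := by
  by_contra h
  exact he (hc e h)

theorem Contr.range_subset {G H : MarkedGraph n} (c : Contr G H) (hG : G.Connected)
    (hH : H.Bridgeless) {e : G.E} (he : e ∈ Set.range c.edge) : ¬ G.IsBridge e := by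
  obtain ⟨f, rfl⟩ := he
  exact fun h => hH f ((c.isBridge_edge hG f).1 h)

/-- Edges of a small cut without bridges lie on the same side of every bridge. -/
theorem bdry_same_side {G : MarkedGraph n} (hG : G.Connected) {A B : Set G.V} {b : G.E}
    (hN : ∀ e ∈ G.bdry A, ¬ G.IsBridge e) (hcard : (G.bdry A).ncard ≤ 3) (hB : G.bdry B = {b})
    {e f : G.E} (he : e ∈ G.bdry A) (hf : f ∈ G.bdry A) {x y : G.V} (hx : x ∈ G.ends e)
    (hy : y ∈ G.ends f) (hxB : x ∈ B) : y ∈ B := by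
  by_contra hyB
  have hbb : G.IsBridge b := (isBridge_iff hG b).2 ⟨B, hB⟩
  have hbA : b ∉ G.bdry A := fun h => hN b h hbb
  obtain ⟨C, hC, hbC⟩ : ∃ C, G.bdry C = G.bdry A ∧ ∀ z ∈ G.ends b, z ∉ C := by
    by_cases h : G.src b ∈ A
    · refine ⟨Aᶜ, G.bdry_compl A, fun z hz hzA => hzA ?_⟩
      exact (G.not_mem_bdry hbA (G.src_mem b) hz).1 h
    · exact ⟨A, rfl, fun z hz hzA => h ((G.not_mem_bdry hbA hz (G.src_mem b)).1 hzA)⟩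
  -- `C` avoids the ends of `b`, so `C ∩ D` has boundary inside the given cut. Each side of `b`
  -- would then contain at least two edges of the cut, four in total.
  have main : ∀ (D : Set G.V), G.bdry D = {b} → ∀ e ∈ G.bdry A, ∀ x ∈ G.ends e, x ∈ D →
      2 ≤ (G.bdry (C ∩ D)).ncard ∧ G.bdry (C ∩ D) ⊆ G.bdry A ∧
        ∀ e ∈ G.bdry (C ∩ D), ∀ z ∈ G.ends e, z ∈ D := by
    intro D hD e he x hx hxD
    have hside : ∀ e, e ∈ G.bdry A → ∀ p ∈ G.ends e, ∀ q ∈ G.ends e, (p ∈ D ↔ q ∈ D) := by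
      intro e he p hp q hq
      refine G.not_mem_bdry ?_ hp hq
      rw [hD, Set.mem_singleton_iff]
      rintro rfl
      exact hbA he
    have hsub : G.bdry (C ∩ D) ⊆ G.bdry A := by
      intro f hf
      obtain ⟨p, ⟨hpC, hpD⟩, q, hq, hpq⟩ := G.mem_bdry_iff.1 hf
      have hfb : f ≠ b := by
        rintro rfl
        exact hbC p (by simp [hpq]) hpC
      have hfD : f ∉ G.bdry D := by simpa [hD] using hfb
      have hqD := (G.not_mem_bdry hfD (u := p) (v := q) (by simp [hpq]) (by simp [hpq])).1 hpD
      rw [← hC]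
      exact G.mem_bdry_iff.2 ⟨p, hpC, q, fun h => hq ⟨h, hqD⟩, hpq⟩
    refine ⟨two_le_ncard_bdry hG ?_ fun e he => hN e (hsub he), hsub, ?_⟩
    · rw [← hC] at he
      obtain ⟨p, hp, q, hq, hpq⟩ := G.mem_bdry_iff.1 he
      rw [hC] at he
      exact ⟨e, G.mem_bdry_iff.2 ⟨p, ⟨hp, (hside e he x hx p (by simp [hpq])).1 hxD⟩, q,
        fun h => hq h.1, hpq⟩⟩
    · intro f hf z hz
      obtain ⟨p, ⟨hpC, hpD⟩, q, hq, hpq⟩ := G.mem_bdry_iff.1 hf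
      exact (hside f (hsub hf) p (by simp [hpq]) z hz).1 hpD
  obtain ⟨h1, h2, h3⟩ := main B hB e he x hx hxB
  obtain ⟨h4, h5, h6⟩ := main Bᶜ (by rw [bdry_compl, hB]) f hf y hy hyB
  have hdisj : Disjoint (G.bdry (C ∩ B)) (G.bdry (C ∩ Bᶜ)) := by
    rw [Set.disjoint_left]
    intro e h h'
    exact h6 e h' _ (G.src_mem e) (h3 e h _ (G.src_mem e))
  have h7 := Set.ncard_union_eq hdisj (Set.toFinite _) (Set.toFinite _)
  have h8 := Set.ncard_le_ncard (Set.union_subset h2 h5) (Set.toFinite _)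
  omega

/-- The edges of `bdry A` meet outside `A` in the vertex `u`. -/
def Apex (G : MarkedGraph n) (A : Set G.V) (u : G.V) : Prop :=
  (G.bdry A).Nonempty ∧ u ∉ A ∧ ∀ e ∈ G.bdry A, u ∈ G.ends e

theorem Apex.eq {G : MarkedGraph n} {A : Set G.V} {u : G.V} (h : G.Apex A u) {e : G.E}
    (he : e ∈ G.bdry A) {v : G.V} (hv : v ∈ G.ends e) (hvA : v ∉ A) : v = u := by
  have hu := h.2.2 e he
  obtain ⟨a, ha, b, hb, hab⟩ := G.mem_bdry_iff.1 he
  rw [hab, Sym2.mem_iff] at hu hv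
  have hua : u ≠ a := by rintro rfl; exact h.2.1 ha
  have hva : v ≠ a := by rintro rfl; exact hvA ha
  rw [hv.resolve_left hva, hu.resolve_left hua]

theorem Apex.unique {G : MarkedGraph n} {A : Set G.V} {u v : G.V} (h : G.Apex A u)
    (h' : G.Apex A v) : u = v := by
  obtain ⟨e, he⟩ := h.1
  exact h'.eq he (h.2.2 e he) h.2.1

/-- The fibre of `v` is joined by bridges. By `bdry_same_side` no bridge separates the points where
the edges of the cut enter it, so these points coincide. -/
theorem exists_apex {G H : MarkedGraph n} {c : Contr G H} (hG : G.Connected) (hc : c.Mild)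
    (hH : H.Bridgeless) {A : Set H.V} {v : H.V} (h : H.Apex A v) (hcard : (H.bdry A).ncard ≤ 3) :
    ∃ u, c.vert u = v ∧ G.Apex (c.vert ⁻¹' A) u := by
  have hb := c.bdry_preimage A
  obtain ⟨f, hf⟩ := h.1
  have hex : ∀ f ∈ H.bdry A, ∃ u ∈ G.ends (c.edge f), c.vert u = v := by
    intro f hf
    have := h.2.2 f hf
    rw [c.ends_edge, Sym2.mem_map] at this
    exact this
  have hN : ∀ e ∈ G.bdry (c.vert ⁻¹' A), ¬ G.IsBridge e := by
    rw [hb]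
    rintro _ ⟨f, _, rfl⟩
    exact c.range_subset hG hH ⟨f, rfl⟩
  obtain ⟨u, hu, huv⟩ := hex f hf
  refine ⟨u, huv, ?_, by simpa [huv] using h.2.1, ?_⟩
  · rw [hb]; exact ⟨_, f, hf, rfl⟩
  · intro e he
    obtain ⟨f', hf', rfl⟩ : e ∈ c.edge '' H.bdry A := hb ▸ he
    obtain ⟨u', hu', huv'⟩ := hex f' hf'
    suffices u = u' by rw [this]; exact hu'
    have hcard' : (G.bdry (c.vert ⁻¹' A)).ncard ≤ 3 := by
      rw [hb, Set.ncard_image_of_injective _ c.edge_inj]; exact hcard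
    have hf2 : c.edge f ∈ G.bdry (c.vert ⁻¹' A) := by rw [hb]; exact ⟨f, hf, rfl⟩
    refine eq_of_reach_bridges hG (S := (Set.range c.edge)ᶜ) (fun b hb => hc b hb)
      (c.fiber _ _ (huv.trans huv'.symm)) fun b hb B hB => ?_
    exact ⟨bdry_same_side hG hN hcard' hB hf2 he hu hu',
      bdry_same_side hG hN hcard' hB he hf2 hu' hu⟩

theorem Cand.exists_apex {H : MarkedGraph n} (hH : H.Connected) (hg : H.genus = 2) {A : Set H.V}
    (hA : H.Cand A) : ∃ v, H.Apex A v ∧ (H.bdry A).ncard ≤ 3 ∧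
      ((2 ≤ H.exc v ∧ (H.bdry A).ncard = 2) ∨ 2 ≤ H.marks v) := by
  obtain ⟨v, hv, hve, h⟩ := hA
  rcases h with ⟨h1, h2⟩ | ⟨h1, h2, h3⟩
  · exact ⟨v, ⟨(Set.ncard_pos (Set.toFinite _)).1 (by omega), hv, hve⟩, by omega,
      Or.inl ⟨h1, h2⟩⟩
  · refine ⟨v, ⟨?_, hv, hve⟩, ?_, Or.inr h3⟩
    · obtain ⟨w, hw⟩ : ∃ w, w ≠ v := by
        by_contra h
        push Not at h
        have h4 := H.sum_exc
        rw [Fintype.sum_eq_single v (fun w hw => absurd (h w) hw), hg] at h4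
        have := h1 v
        omega
      exact bdry_nonempty hH (u := w) (v := v) (by rw [h2]; exact hw) hv
    -- Here `exc` at most one means valence at most three, which is the bound needed in
    -- `exists_apex`.
    · obtain ⟨k, hk, hval⟩ := H.valence_singleton v
      have h4 := h1 v
      have : (0 : ℤ) ≤ H.w v := by positivity
      rw [exc] at h4
      rw [h2]
      omega

/-! ### A canonical choice of the side to pull away -/

/-- Sets of vertices whose boundary can be pulled away, in graphs that may have bridges. -/
def Good (G : MarkedGraph n) (A : Set G.V) : Prop :=
  ∃ (H : MarkedGraph n) (c : Contr G H) (A' : Set H.V), c.Mild ∧ H.Bridgeless ∧ H.Cand A' ∧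
    A = c.vert ⁻¹' A'

/-- If another edge meets the apex, its half-edge gives the degree bound. Otherwise the fibre is the
apex alone, which inherits from `Cand` either `exc` two with a cut of two edges or two marks; then
the split itself is stable. -/
theorem Good.exists_pullable {G : MarkedGraph n} (hG : G.Connected)
    (hg : G.genus = 2) {A : Set G.V} (hA : G.Good A) :
    ∃ u, G.Apex A u ∧ G.Pullable (G.bdry A) u := by
  obtain ⟨H, c, A', hc, hb, hcand, rfl⟩ := hA
  obtain ⟨v, hv, hcard, hcases⟩ := hcand.exists_apex (c.connected hG) (c.genus_eq.trans hg)
  obtain ⟨u, huv, hu⟩ := MarkedGraph.exists_apex hG hc hb hv hcard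
  refine ⟨u, hu, ?_⟩
  have hval := G.valOn_bdry hu.2.1 hu.2.2
  have hncard : (G.bdry (c.vert ⁻¹' A')).ncard = (H.bdry A').ncard := by
    rw [c.bdry_preimage, Set.ncard_image_of_injective _ c.edge_inj]
  have htwo := two_le_ncard_bdry hG hu.1 (by
    rw [c.bdry_preimage]
    rintro _ ⟨f, _, rfl⟩
    exact c.range_subset hG hb ⟨f, rfl⟩)
  have hsplit := G.valence_eq_valOn (G.bdry (c.vert ⁻¹' A')) u
  have hw : (0 : ℤ) ≤ G.w u := by positivity
  have hm := G.marks_nonneg u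
  by_cases hrest : ∃ b ∉ G.bdry (c.vert ⁻¹' A'), u ∈ G.ends b
  · refine ⟨by omega, ?_, fun _ => hrest⟩
    obtain ⟨b, hb, hub⟩ := hrest
    have h1 := Finset.single_le_sum (f := fun e => G.half e u)
      (s := {e | e ∉ G.bdry (c.vert ⁻¹' A')}) (fun e _ => G.half_nonneg e u) (a := b)
      (by simpa using hb)
    have h2 := G.half_pos hub
    rw [deg]
    omega
  · push Not at hrest
    have hrest0 : ∑ e with e ∉ G.bdry (c.vert ⁻¹' A'), G.half e u = 0 := by
      refine Finset.sum_eq_zero fun e he => G.half_eq_zero.2 (hrest e ?_)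
      simpa using he
    have hfib : (Finset.univ.filter fun x => c.vert x = v) = {u} := by
      ext x
      simp only [Finset.mem_filter, Finset.mem_univ, true_and, Finset.mem_singleton]
      refine ⟨fun hx => ?_, fun hx => hx ▸ huv⟩
      have := G.mem_iff_of_reach (A := {u}) (T := (Set.range c.edge)ᶜ) ?_
        (c.fiber x u (hx.trans huv.symm))
      · simpa using this
      · intro e he heu
        obtain ⟨a, ha, b, hb, hab⟩ := G.mem_bdry_iff.1 heu
        rw [Set.mem_singleton_iff] at ha
        refine hrest e ?_ (by simp [hab, ha])
        rw [c.bdry_preimage]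
        rintro ⟨f, _, rfl⟩
        exact he ⟨f, rfl⟩
    have hexc := c.exc_eq v
    have hmarks := c.marks_eq v
    rw [hfib, Finset.sum_singleton] at hexc hmarks
    have key : G.valOn (G.bdry (c.vert ⁻¹' A')) u ≤ G.deg u := by
      rw [exc, exc] at hexc
      rw [exc] at hcases
      rw [deg]
      omega
    exact ⟨by omega, by omega, fun h => by omega⟩

theorem Cand.of_surjective {G H : MarkedGraph n} (d : Contr G H) (hd : Function.Surjective d.edge)
    {A : Set H.V} (hA : H.Cand A) : G.Cand (d.vert ⁻¹' A) := by
  have hinj := d.vert_injective hd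
  have hfib : ∀ v, (Finset.univ.filter fun x => d.vert x = d.vert v) = {v} := by
    intro v; ext x; simp [hinj.eq_iff]
  have hexc : ∀ v, H.exc (d.vert v) = G.exc v := fun v => by
    rw [d.exc_eq, hfib, Finset.sum_singleton]
  have hmarks : ∀ v, H.marks (d.vert v) = G.marks v := fun v => by
    rw [d.marks_eq, hfib, Finset.sum_singleton]
  obtain ⟨v, hv, hve, h⟩ := hA
  obtain ⟨v, rfl⟩ := d.vert_surj v
  refine ⟨v, hv, ?_, ?_⟩
  · rw [d.bdry_preimage]
    rintro _ ⟨e, he, rfl⟩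
    have := hve e he
    rw [d.ends_edge, Sym2.mem_map] at this
    obtain ⟨x, hx, hxv⟩ := this
    rwa [← hinj hxv]
  · rw [d.bdry_preimage, Set.ncard_image_of_injective _ d.edge_inj, ← hexc, ← hmarks]
    refine h.imp id fun h => ⟨fun x => by rw [← hexc]; exact h.1 _, ?_, h.2.2⟩
    rw [h.2.1]
    ext x
    simp [hinj.eq_iff]

/-- Any two models with all bridges collapsed are isomorphic over `G`, so both sides can be compared
as candidates in the same bridgeless graph. -/
theorem Good.eq_of_marks {G : MarkedGraph n} (hG : G.Connected) (hs : G.Stable)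
    (hg : G.genus = 2) {A B : Set G.V} (hA : G.Good A) (hB : G.Good B)
    (h : G.m ⁻¹' A = G.m ⁻¹' B) : A = B := by
  obtain ⟨H, c, A', hc, hb, hA', rfl⟩ := hA
  obtain ⟨K, d, B', hd, hb', hB', rfl⟩ := hB
  obtain ⟨f, hf, hfe⟩ := c.exists_factor d fun e he =>
    Contr.mem_range hc (d.range_subset hG hb' he)
  have hsurj : Function.Surjective f.edge := by
    intro e
    obtain ⟨e', he'⟩ := Contr.mem_range hd (c.range_subset hG hb ⟨e, rfl⟩)
    exact ⟨e', c.edge_inj (by rw [hfe, he'])⟩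
  have hpre : d.vert ⁻¹' B' = c.vert ⁻¹' (f.vert ⁻¹' B') := by
    ext x; simp [hf]
  rw [hpre] at h ⊢
  have hm : H.m = c.vert ∘ G.m := funext c.m_vert
  rw [Cand.eq_of_marks (c.connected hG) (c.stable hs) hb (c.genus_eq.trans hg) hA'
    (hB'.of_surjective f hsurj) (by rw [hm]; exact h)]

theorem Good.preimage {G H : MarkedGraph n} {d : Contr G H} (hG : G.Connected) (hd : d.Mild)
    {A : Set H.V} (hA : H.Good A) : G.Good (d.vert ⁻¹' A) := by
  obtain ⟨K, c, A', hc, hb, hA', rfl⟩ := hA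
  exact ⟨K, d.comp c, A', hd.comp hc hG, hb, hA', rfl⟩

theorem Good.exists_image {G H : MarkedGraph n} {d : Contr G H} (hG : G.Connected) (hd : d.Mild)
    {A : Set G.V} (hA : G.Good A) : ∃ A', H.Good A' ∧ A = d.vert ⁻¹' A' := by
  obtain ⟨K, c, A', hc, hb, hA', rfl⟩ := hA
  obtain ⟨f, hf, hfe⟩ := d.exists_factor c fun e he =>
    Contr.mem_range hd (c.range_subset hG hb he)
  refine ⟨f.vert ⁻¹' A', ⟨K, f, A', ?_, hb, hA', rfl⟩, by ext x; simp [hf]⟩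
  intro e he
  refine (d.isBridge_edge hG e).1 (hc _ ?_)
  rintro ⟨x, hx⟩
  exact he ⟨x, d.edge_inj (by rw [hfe, hx])⟩

/-- The marked points on the side that is pulled away: a choice that only depends on the
graph after collapsing bridges. -/
def label (G : MarkedGraph n) : Set (Fin n) :=
  Classical.epsilon fun L => ∃ A, G.Good A ∧ G.m ⁻¹' A = L

/-- Good sides correspond under the contraction and contain the same marks, so `epsilon` is applied
to the same predicate. A choice of vertex sets would not be comparable between graphs, a choice of
marks is. -/
theorem label_eq {G H : MarkedGraph n} {d : Contr G H} (hG : G.Connected) (hd : d.Mild) :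
    G.label = H.label := by
  rw [label, label]
  congr 1
  funext L
  have hm : H.m = d.vert ∘ G.m := funext d.m_vert
  refine propext ⟨?_, ?_⟩
  · rintro ⟨A, hA, rfl⟩
    obtain ⟨A', hA', rfl⟩ := hA.exists_image hG hd
    exact ⟨A', hA', by rw [hm]; rfl⟩
  · rintro ⟨A, hA, rfl⟩
    exact ⟨_, hA.preimage hG hd, by rw [hm]; rfl⟩

/-- The chosen side to be pulled away, and the vertex from which it is pulled. -/
structure Datum (G : MarkedGraph n) (A : Set G.V) (u : G.V) : Prop where
  good : G.Good A
  label_eq : G.m ⁻¹' A = G.label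
  apex : G.Apex A u
  pullable : G.Pullable (G.bdry A) u

theorem Good.exists_datum {G : MarkedGraph n} (hG : G.Connected)
    (hg : G.genus = 2) (h : ∃ A, G.Good A) : ∃ A u, G.Datum A u := by
  have : ∃ L, ∃ A, G.Good A ∧ G.m ⁻¹' A = L := by
    obtain ⟨A, hA⟩ := h
    exact ⟨_, A, hA, rfl⟩
  obtain ⟨A, hA, hL⟩ := Classical.epsilon_spec this
  obtain ⟨u, hu, hp⟩ := hA.exists_pullable hG hg
  exact ⟨A, u, hA, hL, hu, hp⟩

theorem Datum.transport {G H : MarkedGraph n} {d : Contr G H} (hG : G.Connected) (hs : G.Stable)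
    (hg : G.genus = 2) (hd : d.Mild) {A : Set G.V} {u : G.V} (h : G.Datum A u) {A' : Set H.V}
    {u' : H.V} (h' : H.Datum A' u') : A = d.vert ⁻¹' A' ∧ d.vert u = u' := by
  have hm : H.m = d.vert ∘ G.m := funext d.m_vert
  have hA : A = d.vert ⁻¹' A' := by
    refine h.good.eq_of_marks hG hs hg (h'.good.preimage hG hd) ?_
    rw [h.label_eq, MarkedGraph.label_eq hG hd, ← h'.label_eq, hm]; rfl
  refine ⟨hA, ?_⟩
  subst hA
  refine Apex.unique ⟨h'.apex.1, h.apex.2.1, fun e he => ?_⟩ h'.apex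
  rw [d.ends_edge, Sym2.mem_map]
  refine ⟨u, h.apex.2.2 _ ?_, rfl⟩
  rw [d.bdry_preimage]
  exact ⟨e, he, rfl⟩

/-! ### Existence of a side to pull away, and counting non-bridges -/

/-- All edges other than bridges are loops. -/
def LoopsAndBridges (G : MarkedGraph n) : Prop := ∀ e, ¬ G.IsBridge e → G.src e = G.tgt e

/-- After collapsing all bridges of `G`, a vertex of `exc` two gives a candidate through the
non-loop edge that survives; otherwise the graph is a theta and the bridge of `G₁` supplies a vertex
with two marks. -/
theorem exists_good {G₁ G : MarkedGraph n} (c : Contr G₁ G) (hG₁ : G₁.Connected) (hs : G₁.Stable)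
    (hg : G₁.genus = 2) {b : G₁.E} (hb : G₁.IsBridge b) (hZ : ¬ G.LoopsAndBridges) :
    ∃ A, G.Good A := by
  have hG := c.connected hG₁
  obtain ⟨H, d, hd⟩ : ∃ (H : MarkedGraph n) (d : Contr G H), Set.range d.edge = {e | G.IsBridge e}ᶜ :=
    ⟨_, G.toContract _, range_contractEdge _ _⟩
  have hmild : d.Mild := by
    intro e he
    rw [hd] at he
    simpa using he
  have hless : H.Bridgeless := by
    intro e he
    have : d.edge e ∈ Set.range d.edge := ⟨e, rfl⟩
    rw [hd] at this
    exact this ((d.isBridge_edge hG e).2 he)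
  suffices ∃ A, H.Cand A by
    obtain ⟨A, hA⟩ := this
    exact ⟨_, H, d, A, hmild, hless, hA, rfl⟩
  by_cases hexc : ∃ v, 2 ≤ H.exc v
  · obtain ⟨v, hv⟩ := hexc
    rw [LoopsAndBridges] at hZ
    push Not at hZ
    obtain ⟨e, he, hne⟩ := hZ
    obtain ⟨f, rfl⟩ := Contr.mem_range hmild he
    refine exists_cand_of_exc (d.connected hG) hless
      ((c.comp d).genus_eq.trans hg) (e₀ := f) ?_ hv
    intro h
    refine hne (hmild.src_eq_tgt hG he ?_)
    have h2 := d.ends_edge' f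
    rw [ends_eq, Sym2.eq_iff] at h2
    rcases h2 with ⟨h3, h4⟩ | ⟨h3, h4⟩
    · rw [← h3, ← h4, h]
    · rw [← h3, ← h4, h]
  · have hexc : ∀ x, H.exc x ≤ 1 := by
      intro x
      by_contra h
      exact hexc ⟨x, by omega⟩
    obtain ⟨x, hx⟩ := exists_two_marks (c.comp d) hG₁ hs hless hexc hb
    exact ⟨{x}ᶜ, x, by simp, fun e he => H.mem_bdry_singleton he, Or.inr ⟨hexc, rfl, hx⟩⟩

theorem Contr.loopsAndBridges {G H : MarkedGraph n} (c : Contr G H) (hG : G.Connected)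
    (h : G.LoopsAndBridges) : H.LoopsAndBridges := by
  intro e he
  have := h (c.edge e) fun hb => he ((c.isBridge_edge hG e).1 hb)
  exact H.src_tgt_of_ends (f := id) (c.ends_edge' e) (by rw [this])

theorem Contr.Mild.loopsAndBridges {G H : MarkedGraph n} {c : Contr G H} (hc : c.Mild)
    (hG : G.Connected) (h : H.LoopsAndBridges) : G.LoopsAndBridges := by
  intro e he
  refine hc.src_eq_tgt hG he ?_
  obtain ⟨f, rfl⟩ := Contr.mem_range hc he
  have h1 := h f fun hb => he ((c.isBridge_edge hG f).2 hb)
  have h2 := c.ends_edge' f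
  rw [ends_eq, Sym2.eq_iff] at h2
  rcases h2 with ⟨h3, h4⟩ | ⟨h3, h4⟩
  · rw [← h3, ← h4, h1]
  · rw [← h3, ← h4, h1]

/-- The edges that are not bridges. -/
def nonBridges (G : MarkedGraph n) : Set G.E := {e | ¬ G.IsBridge e}

theorem Contr.image_nonBridges_subset {G H : MarkedGraph n} (c : Contr G H) (hG : G.Connected) :
    c.edge '' H.nonBridges ⊆ G.nonBridges := by
  rintro _ ⟨e, he, rfl⟩ h
  exact he ((c.isBridge_edge hG e).1 h)

theorem Contr.ncard_nonBridges_le {G H : MarkedGraph n} (c : Contr G H) (hG : G.Connected) :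
    H.nonBridges.ncard ≤ G.nonBridges.ncard := by
  rw [← Set.ncard_image_of_injective _ c.edge_inj]
  exact Set.ncard_le_ncard (c.image_nonBridges_subset hG) (Set.toFinite _)

theorem Contr.Mild.image_nonBridges {G H : MarkedGraph n} {c : Contr G H} (hc : c.Mild)
    (hG : G.Connected) : c.edge '' H.nonBridges = G.nonBridges := by
  refine (c.image_nonBridges_subset hG).antisymm fun e he => ?_
  obtain ⟨f, rfl⟩ := Contr.mem_range hc he
  exact ⟨f, fun h => he ((c.isBridge_edge hG f).2 h), rfl⟩

/-- Non-bridges of `H` inject into those of `G`. With equally many, none is collapsed. -/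
theorem Contr.mild_of_ncard {G H : MarkedGraph n} (c : Contr G H) (hG : G.Connected)
    (h : G.nonBridges.ncard ≤ H.nonBridges.ncard) : c.Mild := by
  have := Set.eq_of_subset_of_ncard_le (c.image_nonBridges_subset hG)
    (by rwa [Set.ncard_image_of_injective _ c.edge_inj]) (Set.toFinite _)
  intro e he
  by_contra hb
  have h2 : e ∈ G.nonBridges := hb
  rw [← this] at h2
  obtain ⟨f, _, rfl⟩ := h2
  exact he ⟨f, rfl⟩

end MarkedGraph

/-! ### The filtration by the number of non-bridges -/

/-- The types that arise by contraction from a type with a bridge. -/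
def bridgeTypes (g n : ℕ) : Set (CombType g n) :=
  {G | ∃ G₁ : CombType g n, (∃ b, G₁.IsBridge b) ∧ Nonempty (CContr G₁ G)}

theorem contrClosed_bridgeTypes : ContrClosed (bridgeTypes g n) := by
  rintro G ⟨G₁, hb, ⟨c⟩⟩ H d
  exact ⟨G₁, hb, ⟨c.comp d⟩⟩

/-- The types in `bridgeTypes` with at most `k` edges that are not bridges, together with all
those whose edges are loops and bridges. -/
def stageTypes (n k : ℕ) : Set (CombType 2 n) :=
  {G | G ∈ bridgeTypes 2 n ∧ (G.LoopsAndBridges ∨ G.nonBridges.ncard ≤ k)}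

theorem contrClosed_stageTypes (n k : ℕ) : ContrClosed (stageTypes n k) := by
  rintro G ⟨hG, h⟩ H c
  refine ⟨contrClosed_bridgeTypes G hG H c, ?_⟩
  exact h.imp (c.loopsAndBridges G.connected) (c.ncard_nonBridges_le G.connected).trans

theorem stageTypes_mono (n k : ℕ) : stageTypes n k ⊆ stageTypes n (k + 1) :=
  fun _ h => ⟨h.1, h.2.imp id fun h => h.trans (Nat.le_succ k)⟩

theorem ncard_nonBridges {k : ℕ} {G : CombType 2 n} (hG : G ∈ stageTypes n (k + 1))
    (h : G ∉ stageTypes n k) : ¬ G.LoopsAndBridges ∧ G.nonBridges.ncard = k + 1 := by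
  have h1 : ¬ (G.LoopsAndBridges ∨ G.nonBridges.ncard ≤ k) := fun h' => h ⟨hG.1, h'⟩
  push Not at h1
  have := hG.2.resolve_left h1.1
  exact ⟨h1.1, by omega⟩

theorem exists_datum {k : ℕ} {G : CombType 2 n} (hG : G ∈ stageTypes n (k + 1))
    (h : G ∉ stageTypes n k) : ∃ p : Set G.V × G.V, G.Datum p.1 p.2 := by
  obtain ⟨G₁, ⟨b, hb⟩, ⟨c⟩⟩ := hG.1
  obtain ⟨A, u, hAu⟩ := Good.exists_datum G.connected G.genus_eq
    (exists_good c G₁.connected G₁.stable G₁.genus_eq hb (ncard_nonBridges hG h).1)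
  exact ⟨(A, u), hAu⟩

/-! ### Deforming a stage into the previous one -/

/-- The smallest length of an edge that is not a bridge (zero if there is no such edge). -/
def minLength (G : CombType g n) (l : Cone G) : ℝ≥0 :=
  if h : G.nonBridges.toFinset.Nonempty then G.nonBridges.toFinset.inf' h l else 0

theorem continuous_minLength (G : CombType g n) : Continuous (minLength G) := by
  unfold minLength
  split_ifs with h
  · exact Continuous.finset_inf'_apply h fun e _ => continuous_apply e
  · exact continuous_const

theorem minLength_le (G : CombType g n) (l : Cone G) {e : G.E} (he : e ∈ G.nonBridges) :
    minLength G l ≤ l e := by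
  have he' : e ∈ G.nonBridges.toFinset := by simpa using he
  rw [minLength, dif_pos ⟨e, he'⟩]
  exact Finset.inf'_le _ he'

theorem exists_eq_minLength (G : CombType g n) (l : Cone G) (h : G.nonBridges.Nonempty) :
    ∃ e ∈ G.nonBridges, l e = minLength G l := by
  have h' : G.nonBridges.toFinset.Nonempty := by simpa using h
  obtain ⟨e, he, heq⟩ := Finset.exists_mem_eq_inf' h' l
  refine ⟨e, by simpa using he, ?_⟩
  rw [minLength, dif_pos h', heq]

theorem minLength_contr {G H : CombType g n} {c : CContr G H} (hc : c.Mild)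
    (hne : G.nonBridges.Nonempty) (l : Cone G) : minLength G l = minLength H (l ∘ c.edge) := by
  have him := hc.image_nonBridges G.connected
  refine le_antisymm ?_ ?_
  · obtain ⟨e, he, heq⟩ := exists_eq_minLength H (l ∘ c.edge) (by
      rw [← Set.image_nonempty (f := c.edge), him]; exact hne)
    rw [← heq]
    exact minLength_le G l (him ▸ ⟨e, he, rfl⟩)
  · obtain ⟨e, he, heq⟩ := exists_eq_minLength G l hne
    rw [← heq]
    rw [← him] at he
    obtain ⟨f, hf, rfl⟩ := he
    exact minLength_le H (l ∘ c.edge) hf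

/-- Shortening all edges that are not bridges by `r`. -/
def shorten (G : CombType g n) (l : Cone G) (r : ℝ≥0) : Cone G :=
  fun e => if G.IsBridge e then l e else l e - r

theorem shorten_zero (G : CombType g n) (l : Cone G) : shorten G l 0 = l := by
  funext e; simp [shorten]

theorem sum_shorten (G : CombType g n) (l : Cone G) {r : ℝ≥0} (hr : r ≤ minLength G l) :
    ∑ e, shorten G l r e + G.nonBridges.ncard * r = ∑ e, l e := by
  have h1 : (G.nonBridges.ncard : ℝ≥0) * r = ∑ e, if G.IsBridge e then 0 else r := by
    have : ∀ e, (if G.IsBridge e then 0 else r) = if e ∈ G.nonBridges then r else 0 := fun e => by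
      by_cases h : G.IsBridge e <;> simp [nonBridges, h]
    simp only [this]
    rw [Set.ncard_eq_toFinset_card', ← Finset.sum_filter, Finset.sum_const, nsmul_eq_mul]
    congr 3
    ext e; simp
  rw [h1, ← Finset.sum_add_distrib]
  refine Finset.sum_congr rfl fun e _ => ?_
  unfold shorten
  split_ifs with h
  · simp
  · exact tsub_add_cancel_of_le (hr.trans (minLength_le G l h))

theorem continuous_shorten (G : CombType g n) :
    Continuous fun p : Cone G × ℝ≥0 => shorten G p.1 p.2 := by
  refine continuous_pi fun e => ?_
  unfold shorten
  split_ifs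
  · fun_prop
  · fun_prop

/-- The deformation that shortens edges other than bridges and pulls a part of the curve away
along a growing bridge. -/
def stageFlow (k : ℕ) (G : CombType 2 n) (l : Cone G) (t : unitInterval) : Mtrop 2 n :=
  if h : G ∉ stageTypes n k ∧ ∃ p : Set G.V × G.V, G.Datum p.1 p.2 then
    pullPoint G h.2.choose.2 (G.bdry h.2.choose.1)
      (shorten G l (Real.toNNReal t * minLength G l))
      ((k + 1 : ℕ) * (Real.toNNReal t * minLength G l))
  else Mtrop.mk G l

theorem stageFlow_of_mem {k : ℕ} {G : CombType 2 n} (hG : G ∈ stageTypes n k) (l : Cone G)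
    (t : unitInterval) : stageFlow k G l t = Mtrop.mk G l := by
  rw [stageFlow, dif_neg fun h => h.1 hG]

theorem stageFlow_of_not_mem {k : ℕ} {G : CombType 2 n} (hG : G ∈ stageTypes n (k + 1))
    (h : G ∉ stageTypes n k) : ∃ A u, G.Datum A u ∧ ∀ l t, stageFlow k G l t =
      pullPoint G u (G.bdry A) (shorten G l (Real.toNNReal t * minLength G l))
        ((k + 1 : ℕ) * (Real.toNNReal t * minLength G l)) := by
  have hp := exists_datum hG h
  refine ⟨hp.choose.1, hp.choose.2, hp.choose_spec, fun l t => ?_⟩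
  rw [stageFlow, dif_pos ⟨h, hp⟩]

theorem stageFlow_eq_of_minLength {k : ℕ} {G : CombType 2 n} (hG : G ∈ stageTypes n (k + 1))
    (l : Cone G) (t : unitInterval) (h : Real.toNNReal t * minLength G l = 0) :
    stageFlow k G l t = Mtrop.mk G l := by
  by_cases hk : G ∈ stageTypes n k
  · exact stageFlow_of_mem hk l t
  · obtain ⟨A, u, _, hf⟩ := stageFlow_of_not_mem hG hk
    rw [hf, h, shorten_zero, mul_zero, pullPoint_zero]

/-- If `G` is in stage `k`, so is `H`, and nothing moves. If only `H` is, a non-bridge of length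
zero was collapsed, so `minLength` vanishes and nothing moves either. If neither is, only bridges
are collapsed, the chosen data correspond, and pulling is compatible. -/
theorem stageFlow_contr {k : ℕ} {G H : CombType 2 n} (hG : G ∈ stageTypes n (k + 1))
    (hH : H ∈ stageTypes n (k + 1)) (c : CContr G H) (l : Cone G)
    (hl : ∀ e ∉ Set.range c.edge, l e = 0) (t : unitInterval) :
    stageFlow k G l t = stageFlow k H (l ∘ c.edge) t := by
  by_cases hGk : G ∈ stageTypes n k
  · rw [stageFlow_of_mem hGk, stageFlow_of_mem (contrClosed_stageTypes n k G hGk H c),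
      mk_eq_of_contr c l hl]
  obtain ⟨hGZ, hGN⟩ := ncard_nonBridges hG hGk
  have hne : G.nonBridges.Nonempty := (Set.ncard_pos (Set.toFinite _)).1 (by omega)
  by_cases hHk : H ∈ stageTypes n k
  · have hnm : ¬ c.Mild := by
      intro hc
      rcases hHk.2 with h | h
      · exact hGZ (hc.loopsAndBridges G.connected h)
      · rw [← hc.image_nonBridges G.connected, Set.ncard_image_of_injective _ c.edge_inj] at hGN
        omega
    unfold Contr.Mild at hnm
    push Not at hnm
    obtain ⟨e, he, heb⟩ := hnm
    have hm : minLength G l = 0 := by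
      have := minLength_le G l (e := e) heb
      rw [hl e he] at this
      exact le_antisymm this (zero_le)
    rw [stageFlow_of_mem hHk, stageFlow_eq_of_minLength hG l t (by rw [hm, mul_zero]),
      mk_eq_of_contr c l hl]
  · obtain ⟨_, hHN⟩ := ncard_nonBridges hH hHk
    have hc : c.Mild := c.mild_of_ncard G.connected (by omega)
    obtain ⟨A, u, hA, hf⟩ := stageFlow_of_not_mem hG hGk
    obtain ⟨A', u', hA', hf'⟩ := stageFlow_of_not_mem hH hHk
    obtain ⟨rfl, rfl⟩ := Datum.transport G.connected G.stable G.genus_eq hc hA hA'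
    rw [hf, hf', ← minLength_contr hc hne]
    set r := Real.toNNReal t * minLength G l
    have hb := c.bdry_preimage A'
    have hpG := hA.pullable
    rw [hb] at hpG ⊢
    rw [pullPoint_contr c ?_ hpG hA'.pullable]
    · congr 1
      funext e
      simp only [shorten, Function.comp_apply, c.isBridge_edge G.connected]
    · intro e he
      rw [shorten, hl e he]
      simp
    · intro e he v hv hvu
      rw [← hb] at he
      refine hA.apex.eq he hv fun h => ?_
      refine hA'.apex.2.1 ?_
      rw [← hvu]; exact h

theorem continuous_stageFlow (k : ℕ) (G : CombType 2 n) :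
    Continuous fun p : Cone G × unitInterval => stageFlow k G p.1 p.2 := by
  unfold stageFlow
  split_ifs with h
  · have hr : Continuous fun p : Cone G × unitInterval =>
        Real.toNNReal p.2 * minLength G p.1 := by
      have := continuous_minLength G
      fun_prop
    refine (continuous_pullPoint G h.2.choose.2 (G.bdry h.2.choose.1)).comp
      (Continuous.prodMk ((continuous_shorten G).comp (continuous_fst.prodMk hr)) ?_)
    exact continuous_const.mul hr
  · exact (continuous_mk G).comp continuous_fst

/-- Contracting the edges of length zero removes at least one non-bridge and thus lowers the count.
-/
theorem mk_mem_slice_of_zero {k : ℕ} {G : CombType 2 n} (hG : G ∈ stageTypes n (k + 1))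
    {l : Cone G} (hl : ∑ e, l e = 1) {e : G.E} (he : e ∈ G.nonBridges) (h0 : l e = 0) :
    Mtrop.mk G l ∈ slice (stageTypes n k) := by
  have hz : ∀ e ∉ Set.range (G.toContract (zeroSet l)).edge, l e = 0 := by
    intro e he
    rw [CombType.range_toContract, Set.notMem_compl_iff] at he
    exact he
  refine ⟨G.contract (zeroSet l), ?_, _, ?_, (mk_contract_zeroSet G l).symm⟩
  · have h := contrClosed_stageTypes n (k + 1) G hG _ (G.toContract (zeroSet l))
    refine ⟨h.1, ?_⟩
    rcases hG.2 with h2 | h2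
    · exact Or.inl ((G.toContract (zeroSet l)).loopsAndBridges G.connected h2)
    · refine Or.inr (Nat.lt_succ_iff.1 (lt_of_lt_of_le ?_ h2))
      by_contra hle
      have := (G.toContract (zeroSet l)).mild_of_ncard G.connected (not_lt.1 hle) e ?_
      · exact he this
      · rw [CombType.range_toContract, Set.notMem_compl_iff]
        exact h0
  · rw [sum_contr _ l hz, hl]

/-- Pulling changes only bridges: it creates one or lengthens one. So the stage is kept, the total
length grows by `s`, and a non-bridge of length zero remains one. -/
theorem exists_pullPoint_eq {k : ℕ} {G : CombType 2 n} (hG : G ∈ stageTypes n k)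
    {A : Set G.V} {u : G.V} (hA : G.Datum A u) (l : Cone G) (s : ℝ≥0) :
    ∃ H ∈ stageTypes n k, ∃ l' : Cone H, pullPoint G u (G.bdry A) l s = Mtrop.mk H l' ∧
      ∑ e, l' e = ∑ e, l e + s ∧
      ∀ e ∈ G.nonBridges, l e = 0 → ∃ e' ∈ H.nonBridges, l' e' = 0 := by
  rw [pullPoint]
  split_ifs with h
  · have hb : (G.split u (G.bdry A) h).IsBridge (G.newE u (G.bdry A)) :=
      G.split_isBridge u G.connected hA.apex.2.1 hA.apex.2.2
    let c : CContr (G.split u (G.bdry A) h) G := G.splitContr u (G.bdry A)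
    have hc : c.Mild := by
      intro e he
      rcases G.split_E_cases u _ e with rfl | ⟨e', rfl⟩
      · exact hb
      · exact absurd ⟨e', rfl⟩ he
    refine ⟨G.split u (G.bdry A) h, ⟨⟨_, ⟨_, hb⟩, ⟨Contr.refl _⟩⟩, ?_⟩, _, rfl, ?_, ?_⟩
    · refine hG.2.imp (hc.loopsAndBridges (CombType.connected _)) fun h2 => ?_
      rwa [← hc.image_nonBridges (CombType.connected _),
        Set.ncard_image_of_injective _ c.edge_inj]
    · refine (G.sum_split_E u (G.bdry A) _).trans ?_
      simp [add_comm]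
    · intro e he h0
      refine ⟨c.edge e, ?_, h0⟩
      exact c.image_nonBridges_subset (CombType.connected _) ⟨e, he, rfl⟩
  · refine ⟨G, hG, _, rfl, ?_, ?_⟩
    · obtain ⟨b, hb, ⟨y, hy, hby⟩, huniq⟩ := hA.pullable.exists_unique
        fun h' => h ⟨hA.pullable.two_le, h'⟩
      rw [Finset.sum_add_distrib]
      congr 1
      rw [Finset.sum_eq_single b]
      · rw [if_pos ⟨hb, by simp [hby]⟩]
      · intro e _ heb
        rw [if_neg fun h' => heb (huniq e h'.1 h'.2)]
      · simp
    · intro e he h0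
      refine ⟨e, he, ?_⟩
      rw [h0, zero_add, if_neg]
      rintro ⟨heA, hue⟩
      obtain ⟨b, hb, ⟨y, hy, hby⟩, huniq⟩ := hA.pullable.exists_unique
        fun h' => h ⟨hA.pullable.two_le, h'⟩
      obtain rfl := huniq e heA hue
      -- Besides the cut of `A`, only this edge meets `u`, so it is the whole boundary of `A`
      -- together with `u`.
      refine he ((isBridge_iff G.connected e).2 ⟨insert u A, ?_⟩)
      have hends : ∀ f a b, G.ends f = s(a, b) → f ∈ G.bdry A → a ∈ A → b = u := by
        intro f a b hab hf ha
        have := hA.apex.2.2 f hf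
        rw [hab, Sym2.mem_iff] at this
        rcases this with rfl | h
        · exact absurd ha hA.apex.2.1
        · exact h.symm
      have hyA : y ∉ A := fun hy' =>
        hA.apex.2.1 ((G.not_mem_bdry hb (by simp [hby]) (by simp [hby])).1 hy')
      ext f
      rw [Set.mem_singleton_iff]
      constructor
      · intro hf
        obtain ⟨a, ha, b, hb', hab⟩ := G.mem_bdry_iff.1 hf
        rw [Set.mem_insert_iff, not_or] at hb'
        have hfA : f ∉ G.bdry A := by
          intro hfA
          rcases ha with rfl | ha
          · obtain ⟨p, hp, q, hq, hpq⟩ := G.mem_bdry_iff.1 hfA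
            have h1 : p ∈ G.ends f := by simp [hpq]
            rw [hab, Sym2.mem_iff] at h1
            rcases h1 with rfl | rfl
            · exact hA.apex.2.1 hp
            · exact hb'.2 hp
          · exact hb'.1 (hends f a b hab hfA ha)
        refine huniq f hfA ?_
        rcases ha with rfl | ha
        · simp [hab]
        · exact absurd (G.mem_bdry_iff.2 ⟨a, ha, b, hb'.2, hab⟩) hfA
      · rintro rfl
        exact G.mem_bdry_iff.2 ⟨u, Set.mem_insert _ _, y, by simp [hy, hyA], hby⟩

theorem contractible_stage (k : ℕ) (hc : ContractibleSpace (slice (stageTypes n k))) :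
    ContractibleSpace (slice (stageTypes n (k + 1))) := by
  refine contractible_of_deformation (contrClosed_stageTypes n (k + 1)) (stageTypes_mono n k)
    (stageFlow k) (fun G hG H hH c l hl t => stageFlow_contr hG hH c l hl t)
    (fun G _ => continuous_stageFlow k G)
    (fun G hG l => stageFlow_eq_of_minLength hG l 0 (by simp)) ?_ ?_ hc
  · intro G hG l hl t
    by_cases hk : G ∈ stageTypes n k
    · rw [stageFlow_of_mem hk]
      exact ⟨G, hG, l, hl, rfl⟩
    · obtain ⟨A, u, hA, hf⟩ := stageFlow_of_not_mem hG hk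
      have hr : Real.toNNReal t * minLength G l ≤ minLength G l :=
        mul_le_of_le_one_left (zero_le) (Real.toNNReal_le_one.2 t.2.2)
      obtain ⟨H, hH, l', h1, h2, -⟩ := exists_pullPoint_eq hG hA
        (shorten G l (Real.toNNReal t * minLength G l))
        ((k + 1 : ℕ) * (Real.toNNReal t * minLength G l))
      rw [hf, h1]
      refine ⟨H, hH, l', ?_, rfl⟩
      rw [h2, ← (ncard_nonBridges hG hk).2, sum_shorten G l hr, hl]
  · intro G hG l hl
    by_cases hk : G ∈ stageTypes n k
    · rw [stageFlow_of_mem hk]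
      exact ⟨G, hk, l, hl, rfl⟩
    · obtain ⟨A, u, hA, hf⟩ := stageFlow_of_not_mem hG hk
      obtain ⟨H, hH, l', h1, h2, h3⟩ := exists_pullPoint_eq hG hA
        (shorten G l (minLength G l)) ((k + 1 : ℕ) * minLength G l)
      have hN := (ncard_nonBridges hG hk).2
      obtain ⟨e, he, heq⟩ := exists_eq_minLength G l
        ((Set.ncard_pos (Set.toFinite _)).1 (by omega))
      obtain ⟨e', he', h0⟩ := h3 e he (by
        rw [shorten, if_neg he, heq, tsub_self])
      have := hf l 1
      simp only [Set.Icc.coe_one, Real.toNNReal_one, one_mul] at this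
      rw [this, h1]
      refine mk_mem_slice_of_zero hH ?_ he' h0
      rw [h2, ← hN, sum_shorten G l le_rfl, hl]

/-! ### Trees of bridges with loops -/

namespace MarkedGraph

theorem bdry_union_subset (G : MarkedGraph n) (A B : Set G.V) :
    G.bdry (A ∪ B) ⊆ G.bdry A ∪ G.bdry B := by
  intro e he
  simp only [bdry, Set.mem_ofPred_eq, Set.mem_union] at he ⊢
  tauto

/-- With a root `r`, send each bridge to its end on the side away from `r`. If two bridges shared
this end, the union of their far sides would have no boundary, against connectedness. -/
theorem ncard_bridges_lt {G : MarkedGraph n} (hG : G.Connected) :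
    {e | G.IsBridge e}.ncard + 1 ≤ Fintype.card G.V := by
  obtain ⟨r⟩ := ((G.connected_iff _).1 hG).1
  have hex : ∀ e : {e // G.IsBridge e}, ∃ B : Set G.V, ∃ x p, G.bdry B = {e.1} ∧ r ∉ B ∧ x ∈ B ∧
      p ∉ B ∧ G.ends e.1 = s(x, p) := by
    rintro ⟨e, he⟩
    obtain ⟨B, hB, hr⟩ : ∃ B, G.bdry B = {e} ∧ r ∉ B := by
      obtain ⟨B, hB⟩ := (isBridge_iff hG e).1 he
      by_cases hr : r ∈ B
      · exact ⟨Bᶜ, by rw [bdry_compl, hB], fun h => h hr⟩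
      · exact ⟨B, hB, hr⟩
    obtain ⟨x, hx, p, hp, hxp⟩ := G.mem_bdry_iff.1 (show e ∈ G.bdry B by simp [hB])
    exact ⟨B, x, p, hB, hr, hx, hp, hxp⟩
  choose B x p hB hr hx hp hxp using hex
  have hxr : ∀ e, x e ≠ r := fun e h => hr e (h ▸ hx e)
  have hside : ∀ e f, e ≠ f → x e = x f → p f ∈ B e := by
    intro e f hne hef
    have hn : f.1 ∉ G.bdry (B e) := by
      rw [hB, Set.mem_singleton_iff]
      exact fun h => hne (Subtype.ext h).symm
    refine (G.not_mem_bdry hn (u := x f) (v := p f) ?_ ?_).1 (hef ▸ hx e) <;> simp [hxp]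
  have hinj : Function.Injective (fun e => (⟨x e, hxr e⟩ : {v // v ≠ r})) := by
    intro e f hef
    have hef : x e = x f := congrArg Subtype.val hef
    by_contra hne
    obtain ⟨b, hb⟩ := bdry_nonempty hG (A := B e ∪ B f) (u := x e) (v := r) (Or.inl (hx e))
      (by simp [hr])
    have hb' := G.bdry_union_subset _ _ hb
    rw [hB, hB] at hb'
    rcases hb' with hb' | hb' <;> rw [Set.mem_singleton_iff] at hb' <;> subst hb'
    · rw [G.mem_bdry_of_ends (hxp e)] at hb
      exact hb ⟨fun _ => Or.inr (hside f e (Ne.symm hne) hef.symm), fun _ => Or.inl (hx e)⟩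
    · rw [G.mem_bdry_of_ends (hxp f)] at hb
      exact hb ⟨fun _ => Or.inl (hside e f hne hef), fun _ => Or.inr (hx f)⟩
  have h1 := Fintype.card_le_of_injective _ hinj
  have h2 : Fintype.card {v // v ≠ r} = Fintype.card G.V - 1 := Set.card_ne_eq r
  have h3 : {e | G.IsBridge e}.ncard = Fintype.card {e // G.IsBridge e} := by
    rw [← Nat.card_eq_fintype_card]; rfl
  have h4 : 0 < Fintype.card G.V := Fintype.card_pos_iff.2 ⟨r⟩
  omega

theorem LoopsAndBridges.reach {G : MarkedGraph n} (hG : G.Connected) (h : G.LoopsAndBridges)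
    (u v : G.V) : G.Reach {e | G.IsBridge e} u v := by
  refine G.reach_induction (G.reach_equivalence _) ?_ (((G.connected_iff _).1 hG).2 u v)
  intro e _
  by_cases he : G.IsBridge e
  · exact G.reach_ends he (G.src_mem e) (G.tgt_mem e)
  · rw [h e he]

/-- The bridges form a spanning tree, so exactly the loops and the weights contribute to the genus.
-/
theorem LoopsAndBridges.ncard_add {G : MarkedGraph n} (hG : G.Connected) (h : G.LoopsAndBridges) :
    (G.nonBridges.ncard : ℤ) + ∑ v, (G.w v : ℤ) = G.genus := by
  have h1 := ncard_bridges_lt hG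
  have h2 := G.card_le_of_connected {e | G.IsBridge e}
    ((G.connected_iff _).2 ⟨((G.connected_iff _).1 hG).1, h.reach hG⟩)
  have h3 := Set.ncard_add_ncard_compl {e | G.IsBridge e}
  rw [Nat.card_eq_fintype_card] at h3
  have h4 : {e | G.IsBridge e}ᶜ = G.nonBridges := rfl
  rw [h4] at h3
  rw [genus]
  omega

/-! ### Replacing weights by loops -/

/-- The graph in which vertex weights are replaced by loops. -/
def looped (G : MarkedGraph n) : MarkedGraph n where
  V := G.V
  E := G.E ⊕ Σ v : G.V, Fin (G.w v)
  ends := Sum.elim G.ends fun p => s(p.1, p.1)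
  m := G.m
  w _ := 0

section looped
variable (G : MarkedGraph n)

/-- The inclusion of the old edges. -/
def loopedOld (e : G.E) : G.looped.E := (Sum.inl e : G.E ⊕ Σ v : G.V, Fin (G.w v))

/-- The inclusion of the new loops. -/
def loopedNew (p : Σ v : G.V, Fin (G.w v)) : G.looped.E :=
  (Sum.inr p : G.E ⊕ Σ v : G.V, Fin (G.w v))

/-- The identity map on vertices. -/
def loopedVert (v : G.looped.V) : G.V := v

theorem looped_E_cases (e : G.looped.E) :
    (∃ f, e = G.loopedOld f) ∨ ∃ p, e = G.loopedNew p := by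
  rcases e with f | p
  · exact Or.inl ⟨f, rfl⟩
  · exact Or.inr ⟨p, rfl⟩

theorem looped_deg (v : G.looped.V) : G.looped.deg v = G.deg (G.loopedVert v) := by
  have hm : G.looped.marks v = G.marks (G.loopedVert v) := rfl
  have hv : (G.looped.valence v : ℤ) = G.valence (G.loopedVert v) + 2 * G.w (G.loopedVert v) := by
    rw [valence_eq, valence_eq]
    refine (Fintype.sum_sum_type (α₁ := G.E) (α₂ := Σ v : G.V, Fin (G.w v)) _).trans ?_
    congr 1
    refine (Fintype.sum_sigma (ι := G.V) (α := fun v => Fin (G.w v)) _).trans ?_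
    have : ∀ (x : G.V) (i : Fin (G.w x)), G.looped.half (G.loopedNew ⟨x, i⟩) v =
        if x = G.loopedVert v then 2 else 0 := by
      intro x i
      refine (half_eq_of_ends G.looped (e := G.loopedNew ⟨x, i⟩) (a := x) (b := x) rfl v).trans ?_
      change ((if x = G.loopedVert v then (1 : ℤ) else 0) +
        if x = G.loopedVert v then 1 else 0) = _
      split_ifs <;> rfl
    refine (Finset.sum_congr rfl fun x _ => Finset.sum_congr rfl fun i _ => this x i).trans ?_
    simp [mul_comm]
  have hw : G.looped.w v = 0 := rfl
  rw [deg, deg, hm, hv, hw]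
  push_cast
  ring

/-- Collapsing the new loops. -/
def loopedContr : Contr G.looped G where
  vert := G.loopedVert
  edge := G.loopedOld
  edge_inj := Sum.inl_injective
  vert_surj v := ⟨v, rfl⟩
  ends_edge e := (Sym2.map_id' (α := G.V) ▸ rfl : _ = (G.ends e).map fun v => v)
  vert_const e he := by
    rcases G.looped_E_cases e with ⟨f, rfl⟩ | ⟨p, rfl⟩
    · exact absurd ⟨f, rfl⟩ he
    · exact src_tgt_of_ends G.looped (e := G.loopedNew p) (a := p.1) (b := p.1) rfl rfl
  m_vert _ := rfl
  fiber u v h := by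
    have : u = v := h
    rw [this]
  deg_eq x := by
    have : (Finset.univ.filter fun v : G.looped.V => G.loopedVert v = x) = {(x : G.V)} := by
      ext v
      simp only [Finset.mem_filter, Finset.mem_univ, true_and]
      exact (Finset.mem_singleton (α := G.V)).symm
    rw [this]
    refine ((Finset.sum_singleton (ι := G.V) G.looped.deg x).trans ?_).symm
    exact G.looped_deg x

end looped

/-- A contraction of loops, from a graph with vanishing weights. -/
structure Contr.IsExpansion {K G : MarkedGraph n} (c : Contr K G) : Prop where
  w_eq : ∀ v, K.w v = 0
  loop : ∀ e, e ∉ Set.range c.edge → K.src e = K.tgt e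

theorem isExpansion_loopedContr (G : MarkedGraph n) : G.loopedContr.IsExpansion where
  w_eq _ := rfl
  loop e he := by
    rcases G.looped_E_cases e with ⟨f, rfl⟩ | ⟨p, rfl⟩
    · exact absurd ⟨f, rfl⟩ he
    · exact src_tgt_of_ends G.looped (f := id) (e := G.loopedNew p) (a := p.1) (b := p.1) rfl rfl

namespace Contr.IsExpansion

variable {K K' G : MarkedGraph n} {c : Contr K G} {c' : Contr K' G}

theorem vert_injective (h : c.IsExpansion) : Function.Injective c.vert := fun u v huv =>
  K.reach_induction (R := Eq) ⟨fun _ => rfl, Eq.symm, Eq.trans⟩ (fun e he => h.loop e he)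
    (c.fiber u v huv)

theorem filter_eq (h : c.IsExpansion) (v : K.V) :
    (Finset.univ.filter fun x => c.vert x = c.vert v) = {v} := by
  ext x; simp [h.vert_injective.eq_iff]

theorem card_loops (h : c.IsExpansion) (x : G.V) :
    Fintype.card {e : {e // e ∉ Set.range c.edge} // c.vert (K.src e.1) = x} = G.w x := by
  have h1 := c.weight_eq x
  obtain ⟨v, rfl⟩ := c.vert_surj x
  rw [h.filter_eq, Finset.sum_singleton, Finset.sum_singleton, h.w_eq] at h1
  have h2 : (Fintype.card {e : {e // e ∉ Set.range c.edge} // c.vert (K.src e.1) = c.vert v} : ℤ) =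
      ∑ e with e ∉ Set.range c.edge, if c.vert (K.src e) = c.vert v then 1 else 0 := by
    rw [Fintype.card_subtype, Finset.sum_subtype (p := fun e => e ∉ Set.range c.edge) _ (by simp),
      Finset.sum_boole]
  rw [← h2] at h1
  push_cast at h1
  omega

theorem deg_vert (h : c.IsExpansion) (v : K.V) : G.deg (c.vert v) = K.deg v := by
  rw [c.deg_eq, h.filter_eq, Finset.sum_singleton]

theorem exists_equiv {α β γ : Type*} [Fintype α] [Fintype β] (p : α → γ) (q : β → γ)
    (h : ∀ x, Fintype.card {a // p a = x} = Fintype.card {b // q b = x}) :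
    ∃ φ : α ≃ β, ∀ a, q (φ a) = p a := by
  refine ⟨(Equiv.sigmaFiberEquiv p).symm.trans ((Equiv.sigmaCongrRight fun x =>
    Fintype.equivOfCardEq (h x)).trans (Equiv.sigmaFiberEquiv q)), fun a => ?_⟩
  exact (Fintype.equivOfCardEq (h (p a)) ⟨a, rfl⟩).2

/-- Both expansions have the vertices of `G` and the same number of additional loops at each vertex,
namely its weight. Matching the loops vertex by vertex gives an isomorphism over `G`. -/
theorem exists_contr (h : c.IsExpansion) (h' : c'.IsExpansion) :
    ∃ d : Contr K K', Function.Surjective d.edge ∧ ∀ f, d.edge (c'.edge f) = c.edge f := by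
  obtain ⟨φ, hφ⟩ := exists_equiv (fun e : {e // e ∉ Set.range c'.edge} => c'.vert (K'.src e.1))
    (fun e : {e // e ∉ Set.range c.edge} => c.vert (K.src e.1))
    (fun x => by rw [h.card_loops, h'.card_loops])
  choose s hs using c'.vert_surj
  have hs' : ∀ v, s (c'.vert v) = v := fun v => h'.vert_injective (hs _)
  let E : K'.E → K.E := fun e => if he : ∃ f, c'.edge f = e then c.edge he.choose else (φ ⟨e, he⟩).1
  have hE1 : ∀ f, E (c'.edge f) = c.edge f := by
    intro f
    have he : ∃ f', c'.edge f' = c'.edge f := ⟨f, rfl⟩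
    simp only [E, dif_pos he]
    rw [c'.edge_inj he.choose_spec]
  have hE2 : ∀ e (he : e ∉ Set.range c'.edge), E e = (φ ⟨e, he⟩).1 := by
    intro e he
    exact dif_neg he
  have hsurj : Function.Surjective E := by
    intro e
    by_cases he : e ∈ Set.range c.edge
    · obtain ⟨f, rfl⟩ := he
      exact ⟨_, hE1 f⟩
    · refine ⟨(φ.symm ⟨e, he⟩).1, ?_⟩
      rw [hE2 _ (φ.symm ⟨e, he⟩).2]
      simp
  have hrange : ∀ e, E e ∈ Set.range c.edge → e ∈ Set.range c'.edge := by
    intro e he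
    by_contra h'
    rw [hE2 e h'] at he
    exact (φ ⟨e, h'⟩).2 he
  have hinj : Function.Injective E := by
    intro a b hab
    by_cases ha : a ∈ Set.range c'.edge
    · obtain ⟨f, rfl⟩ := ha
      obtain ⟨f', rfl⟩ := hrange b ⟨f, by rw [← hab, hE1]⟩
      rw [hE1, hE1] at hab
      rw [c.edge_inj hab]
    · by_cases hb : b ∈ Set.range c'.edge
      · obtain ⟨f, rfl⟩ := hb
        exact absurd (hrange a ⟨f, by rw [hab, hE1]⟩) ha
      · rw [hE2 a ha, hE2 b hb] at hab
        exact congrArg Subtype.val (φ.injective (Subtype.ext hab))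
  have hvinj : Function.Injective fun v => s (c.vert v) := by
    intro u v huv
    refine h.vert_injective ?_
    rw [← hs (c.vert u), ← hs (c.vert v)]
    exact congrArg _ huv
  refine ⟨⟨fun v => s (c.vert v), E, hinj, ?_, ?_, ?_, ?_, ?_, ?_⟩, hsurj, hE1⟩
  · intro x
    obtain ⟨v, hv⟩ := c.vert_surj (c'.vert x)
    exact ⟨v, by simp [hv, hs']⟩
  · intro e
    by_cases he : e ∈ Set.range c'.edge
    · obtain ⟨f, rfl⟩ := he
      rw [hE1]
      have h1 := c.ends_edge f
      rw [c'.ends_edge f] at h1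
      have h2 := congrArg (Sym2.map s) h1
      rw [Sym2.map_map, Sym2.map_map] at h2
      have h3 : s ∘ c'.vert = id := funext hs'
      rw [h3, Sym2.map_id] at h2
      exact h2
    · rw [hE2 e he, K'.ends_eq, K.ends_eq, ← h'.loop e he, ← h.loop _ (φ ⟨e, he⟩).2, Sym2.map_mk,
        hφ ⟨e, he⟩, hs']
  · intro e he
    exact absurd (hsurj e) he
  · intro i
    rw [← c.m_vert, c'.m_vert, hs']
  · intro u v huv
    rw [hvinj huv]
  · intro x
    obtain ⟨v, hv⟩ := c.vert_surj (c'.vert x)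
    have hx : s (c.vert v) = x := by rw [hv, hs']
    have : (Finset.univ.filter fun y => s (c.vert y) = x) = {v} := by
      ext y
      simp only [Finset.mem_filter, Finset.mem_univ, true_and, Finset.mem_singleton]
      rw [← hx]
      exact hvinj.eq_iff
    rw [this, Finset.sum_singleton, ← h.deg_vert, hv, h'.deg_vert]

theorem loopsAndBridges (h : c.IsExpansion) (hK : K.Connected) (hG : G.LoopsAndBridges) :
    K.LoopsAndBridges := by
  intro e he
  by_cases her : e ∈ Set.range c.edge
  · obtain ⟨f, rfl⟩ := her
    have h1 := hG f fun hb => he ((c.isBridge_edge hK f).2 hb)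
    refine h.vert_injective ?_
    have h2 := c.ends_edge' f
    rw [ends_eq, Sym2.eq_iff] at h2
    rcases h2 with ⟨h3, h4⟩ | ⟨h3, h4⟩
    · rw [← h3, ← h4, h1]
    · rw [← h3, ← h4, h1]
  · exact h.loop e her

/-- Expansions are compatible with contractions, up to collapsing bridges. -/
theorem exists_mild {H : MarkedGraph n} (h : c.IsExpansion) (hK : K.Connected)
    (hG : G.LoopsAndBridges) (d : Contr G H) {b : Contr K' H} (hb : b.IsExpansion) :
    ∃ j : Contr K K', j.Mild ∧ (∀ x, x ∉ Set.range j.edge → x ∉ Set.range (c.comp d).edge) ∧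
      ∀ f, j.edge (b.edge f) = c.edge (d.edge f) := by
  have hKZ := h.loopsAndBridges hK hG
  -- Only the collapsed bridges are contracted. The collapsed loops are kept, because they become
  -- the loops that replace the weights of `H`.
  obtain ⟨K₁, p, hp⟩ : ∃ (K₁ : MarkedGraph n) (p : Contr K K₁),
      Set.range p.edge = {e | K.IsBridge e ∧ e ∉ Set.range (c.comp d).edge}ᶜ :=
    ⟨_, K.toContract _, range_contractEdge _ _⟩
  have hp' : ∀ e, e ∉ Set.range p.edge → K.IsBridge e ∧ e ∉ Set.range (c.comp d).edge := by
    intro e he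
    rw [hp] at he
    simpa using he
  have hmild : p.Mild := fun e he => (hp' e he).1
  obtain ⟨q, -, hq⟩ := p.exists_factor (c.comp d) fun e he => by
    by_contra h'
    exact (hp' e h').2 he
  have hK₁ := p.connected hK
  have hK₁Z := p.loopsAndBridges hK hKZ
  have hexp : q.IsExpansion := by
    constructor
    · have h1 := hK₁Z.ncard_add hK₁
      have h2 := hKZ.ncard_add hK
      rw [p.genus_eq, ← h2, ← hmild.image_nonBridges hK,
        Set.ncard_image_of_injective _ p.edge_inj] at h1
      have h3 : ∑ v, (K.w v : ℤ) = 0 := Finset.sum_eq_zero fun v _ => by rw [h.w_eq]; rfl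
      have h4 : ∑ v, (K₁.w v : ℤ) = 0 := by omega
      intro v
      have := (Finset.sum_eq_zero_iff_of_nonneg (fun v _ => by positivity)).1 h4 v
        (Finset.mem_univ v)
      exact_mod_cast this
    · intro x hx
      refine hK₁Z x fun hxb => ?_
      have h1 : p.edge x ∉ Set.range (c.comp d).edge := by
        rintro ⟨f, hf⟩
        exact hx ⟨f, p.edge_inj (by rw [hq, hf])⟩
      have h2 : p.edge x ∈ Set.range p.edge := ⟨x, rfl⟩
      rw [hp] at h2
      exact h2 ⟨(p.isBridge_edge hK x).2 hxb, h1⟩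
  obtain ⟨i, hi, hie⟩ := hexp.exists_contr hb
  have hrange : ∀ x, x ∉ Set.range (p.comp i).edge → x ∉ Set.range p.edge := by
    rintro x hx ⟨y, rfl⟩
    obtain ⟨z, rfl⟩ := hi y
    exact hx ⟨z, rfl⟩
  refine ⟨p.comp i, fun x hx => (hp' x (hrange x hx)).1, fun x hx => (hp' x (hrange x hx)).2,
    fun f => ?_⟩
  change p.edge (i.edge (b.edge f)) = _
  rw [hie, hq]
  rfl

end Contr.IsExpansion

end MarkedGraph

/-- The combinatorial type in which vertex weights are replaced by loops. -/
def CombType.looped (G : CombType g n) : CombType g n where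
  toMarkedGraph := G.toMarkedGraph.looped
  connected := G.loopedContr.connected_of G.connected
  stable := by
    rw [stable_iff]
    intro v
    rw [looped_deg]
    exact G.stable _
  genus_eq := G.loopedContr.genus_eq.symm.trans G.genus_eq

/-- Collapsing the new loops. -/
def CombType.toLooped (G : CombType g n) : CContr G.looped G := G.loopedContr

/-- The length function that vanishes on the new loops. -/
def loopedLen {G : CombType g n} (l : Cone G) : Cone G.looped :=
  (Sum.elim l fun _ => 0 : (G.E ⊕ Σ v : G.V, Fin (G.w v)) → ℝ≥0)

theorem loopedLen_edge {G : CombType g n} (l : Cone G) (e : G.E) :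
    loopedLen l (G.toLooped.edge e) = l e := rfl

theorem loopedLen_eq_zero {G : CombType g n} (l : Cone G) {e : G.looped.E}
    (he : e ∉ Set.range G.toLooped.edge) : loopedLen l e = 0 := by
  rcases G.looped_E_cases e with ⟨f, rfl⟩ | ⟨p, rfl⟩
  · exact absurd ⟨f, rfl⟩ he
  · rfl

theorem mk_looped (G : CombType g n) (l : Cone G) :
    Mtrop.mk G.looped (loopedLen l) = Mtrop.mk G l :=
  mk_eq_of_contr G.toLooped _ fun _ he => loopedLen_eq_zero l he

theorem sum_loopedLen (G : CombType g n) (l : Cone G) : ∑ e, loopedLen l e = ∑ e, l e :=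
  (sum_contr G.toLooped (loopedLen l) fun _ he => loopedLen_eq_zero l he).symm

/-! ### Contracting the bottom stage to a figure eight -/

/-- Shrinking bridges and moving the lengths of all other edges towards one half. -/
def spread (K : CombType g n) (l : Cone K) (t : unitInterval) : Cone K := fun e =>
  Real.toNNReal (1 - t) * l e + if K.IsBridge e then 0 else Real.toNNReal t * 2⁻¹

/-- The deformation of curves whose edges are loops and bridges to the curve with one vertex and
two loops of the same length. -/
def loopFlow (G : CombType g n) (l : Cone G) (t : unitInterval) : Mtrop g n :=
  Mtrop.mk G.looped (spread G.looped (loopedLen l) t)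

theorem loopFlow_zero (G : CombType g n) (l : Cone G) : loopFlow G l 0 = Mtrop.mk G l := by
  rw [← mk_looped, loopFlow]
  congr 1
  funext e
  simp [spread]

theorem continuous_loopFlow (G : CombType g n) :
    Continuous fun p : Cone G × unitInterval => loopFlow G p.1 p.2 := by
  refine (continuous_mk _).comp (continuous_pi fun e => ?_)
  have h : Continuous fun p : Cone G × unitInterval => loopedLen p.1 e := by
    rcases G.looped_E_cases e with ⟨f, rfl⟩ | ⟨p, rfl⟩
    · exact (continuous_apply f).comp continuous_fst
    · exact continuous_const
  unfold spread
  refine Continuous.add (Continuous.mul (by fun_prop) h) ?_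
  split_ifs
  · exact continuous_const
  · fun_prop

/-- Even if the contraction turns loops into weight, the looped graphs differ only by collapsed
bridges of length zero. These keep length zero throughout the flow, and all other edges flow alike.
-/
theorem loopFlow_contr {G H : CombType g n} (hG : G.LoopsAndBridges) (c : CContr G H) (l : Cone G)
    (hl : ∀ e ∉ Set.range c.edge, l e = 0) (t : unitInterval) :
    loopFlow G l t = loopFlow H (l ∘ c.edge) t := by
  obtain ⟨j, hj, hjr, hje⟩ := Contr.IsExpansion.exists_mild (isExpansion_loopedContr _)
    G.looped.connected hG c (isExpansion_loopedContr H.toMarkedGraph)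
  have hzero : ∀ x, x ∉ Set.range (G.toLooped.comp c).edge → loopedLen l x = 0 := by
    intro x hx
    by_cases h : x ∈ Set.range G.toLooped.edge
    · obtain ⟨f, rfl⟩ := h
      rw [loopedLen_edge]
      refine hl f ?_
      rintro ⟨y, rfl⟩
      exact hx ⟨y, rfl⟩
    · exact loopedLen_eq_zero l h
  have hmk := mk_eq_of_contr (G := G.looped) (H := H.looped) j (spread G.looped (loopedLen l) t) (by
    intro e he
    have h1 := hzero e (hjr e he)
    have h2 : G.looped.IsBridge e := hj e he
    simp [spread, h1, h2])
  rw [loopFlow, loopFlow, hmk]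
  congr 1
  funext y
  have hb : G.looped.IsBridge (j.edge y) ↔ H.looped.IsBridge y :=
    j.isBridge_edge G.looped.connected y
  have hlen : loopedLen l (j.edge y) = loopedLen (G := H) (l ∘ c.edge) y := by
    by_cases hy : y ∈ Set.range H.toLooped.edge
    · obtain ⟨f, rfl⟩ := hy
      have : j.edge (H.toLooped.edge f) = G.toLooped.edge (c.edge f) := hje f
      rw [this, loopedLen_edge, loopedLen_edge]
      rfl
    · rw [loopedLen_eq_zero _ hy]
      refine hzero _ ?_
      rintro ⟨f, hf⟩
      exact hy ⟨f, j.edge_inj ((hje f).trans hf)⟩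
  simp only [spread, Function.comp_apply, hlen, hb]

theorem ncard_nonBridges_eq_two {K : CombType 2 n} (hK : K.LoopsAndBridges)
    (hw : ∀ v, K.w v = 0) : K.nonBridges.ncard = 2 := by
  have h := hK.ncard_add K.connected
  rw [Finset.sum_eq_zero fun v _ => by rw [hw]; rfl, K.genus_eq] at h
  omega

/-- In genus two with zero weights there are exactly two non-bridges, and their shares of one half
add up to the target length one. -/
theorem sum_spread {K : CombType 2 n} (hK : K.LoopsAndBridges) (hw : ∀ v, K.w v = 0) (l : Cone K)
    (hl : ∑ e, l e = 1) (t : unitInterval) : ∑ e, spread K l t e = 1 := by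
  have h2 := ncard_nonBridges_eq_two hK hw
  simp only [spread, Finset.sum_add_distrib, ← Finset.mul_sum, hl, mul_one]
  have h3 : (∑ e, if K.IsBridge e then 0 else Real.toNNReal t * 2⁻¹) = Real.toNNReal t := by
    have : ∀ e, (if K.IsBridge e then 0 else Real.toNNReal t * 2⁻¹) =
        if e ∈ K.nonBridges then Real.toNNReal t * 2⁻¹ else 0 := fun e => by
      by_cases h : K.IsBridge e <;> simp [nonBridges, h]
    simp only [this]
    rw [← Finset.sum_filter, Finset.sum_const, nsmul_eq_mul]
    have hcard : (Finset.univ.filter fun e => e ∈ K.nonBridges).card = 2 := by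
      refine Eq.trans ?_ h2
      rw [Set.ncard_eq_toFinset_card']
      congr 1
      ext e; simp
    rw [hcard, mul_comm, mul_assoc]
    norm_num
  rw [h3, ← Real.toNNReal_add (by linarith [t.2.2]) t.2.1]
  simp

theorem split_singleton_isBridge (G : CombType g n) {u : G.V} {e : G.E}
    (he : G.ends e = s(u, u)) :
    (G.toMarkedGraph.split u {e}).IsBridge (G.newE u {e}) := by
  rw [isBridge_iff ((G.splitContr u _).connected_of G.connected)]
  refine ⟨{G.newV u {e}}, ?_⟩
  ext x
  rcases G.split_E_cases u {e} x with rfl | ⟨f, rfl⟩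
  · rw [mem_bdry_of_ends _ (G.split_ends_new u _)]
    simp [oldV_ne_newV]
  · simp only [Set.mem_singleton_iff, G.oldE_ne_newE, iff_false]
    by_cases hf : f = e
    · subst hf
      have h := G.split_ends_old u {f} f
      rw [he, Sym2.map_mk] at h
      rw [mem_bdry_of_ends _ h]
      simp
    · rw [mem_bdry_of_ends _ (G.split_ends_of_not_mem u {e} (by simpa using hf))]
      simp [oldV_ne_newV]

/-- If there is no bridge, the graph is one vertex with two loops. Pulling off both half-edges of
one loop is stable and creates a bridge, so the figure eight is a contraction of a graph with a
bridge. -/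
theorem mem_bridgeTypes {K : CombType 2 n} (hK : K.LoopsAndBridges) (hw : ∀ v, K.w v = 0) :
    K ∈ bridgeTypes 2 n := by
  by_cases hb : ∃ b, K.IsBridge b
  · exact ⟨K, hb, ⟨Contr.refl _⟩⟩
  push Not at hb
  obtain ⟨e, -⟩ : K.nonBridges.Nonempty := (Set.ncard_pos (Set.toFinite _)).1 (by
    rw [ncard_nonBridges_eq_two hK hw]; omega)
  have hsub : ∀ u v : K.V, u = v := fun u v =>
    eq_of_reach_bridges K.connected (fun _ h => h) (hK.reach K.connected u v)
      fun b hb' => absurd hb' (hb b)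
  have hends : K.ends e = s(K.src e, K.src e) := by
    rw [K.ends_eq, hsub (K.tgt e) (K.src e)]
  have hval : K.valOn {e} (K.src e) = 2 := by
    rw [valOn, Finset.sum_eq_single e]
    · rw [half_eq_of_ends _ hends]; simp
    · intro f hf hfe
      exact absurd (by simpa using hf) hfe
    · intro h
      simp at h
  have hdeg : K.deg (K.src e) = 2 + n := by
    have h := K.sum_deg
    rw [Fintype.sum_eq_single (K.src e) (fun v hv => absurd (hsub v _) hv), K.genus_eq] at h
    omega
  exact ⟨K.split (K.src e) {e} (by omega), ⟨_, split_singleton_isBridge K hends⟩,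
    ⟨K.splitContr _ _⟩⟩

/-- The graph with one vertex and two loops. -/
def figureEightGraph (n : ℕ) : MarkedGraph n where
  V := Unit
  E := Bool
  ends _ := s((), ())
  m _ := ()
  w _ := 0

theorem figureEight_sub (u v : (figureEightGraph n).V) : u = v := Subsingleton.elim (α := Unit) u v

theorem genus_figureEight : (figureEightGraph n).genus = 2 := by
  change ((Fintype.card Bool : ℤ) - (Fintype.card Unit : ℤ) + 1 + ∑ _ : Unit, ((0 : ℕ) : ℤ)) = 2
  simp

/-- The combinatorial type with one vertex and two loops. -/
def figureEight (n : ℕ) : CombType 2 n where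
  toMarkedGraph := figureEightGraph n
  connected := (connected_iff _ _).2 ⟨⟨()⟩, fun u v => by rw [figureEight_sub u v]⟩
  stable := by
    rw [stable_iff]
    intro v
    have h := (figureEightGraph n).sum_deg
    rw [Fintype.sum_eq_single v (fun w hw => absurd (figureEight_sub w v) hw),
      genus_figureEight] at h
    omega
  genus_eq := genus_figureEight

theorem exists_contr_figureEight {K : CombType 2 n} (hK : K.LoopsAndBridges)
    (hw : ∀ v, K.w v = 0) :
    ∃ c : CContr K (figureEight n), Set.range c.edge = K.nonBridges := by
  have h2 := ncard_nonBridges_eq_two hK hw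
  obtain ⟨x, y, hxy, hN⟩ := Set.ncard_eq_two.1 h2
  let E : Bool → K.E := fun b => if b then x else y
  have hE : Set.range E = K.nonBridges := by
    rw [hN]
    ext e
    simp [E, eq_comm, or_comm]
  have hinj : Function.Injective E := by
    intro a b hab
    cases a <;> cases b <;> simp_all [E]
  obtain ⟨v₀⟩ := ((K.connected_iff _).1 K.connected).1
  refine ⟨⟨fun _ => (), E, hinj, fun v => ⟨v₀, figureEight_sub _ _⟩, ?_, fun _ _ => rfl,
    fun _ => rfl, ?_, ?_⟩, hE⟩
  · intro e
    rw [K.ends_eq]; rfl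
  · intro u v _
    refine K.reach_mono ?_ (hK.reach K.connected u v)
    intro e he h
    have h' : e ∈ K.nonBridges := hE ▸ h
    exact h' he
  · intro v
    have h1 := (figureEight n).sum_deg
    rw [Fintype.sum_eq_single v (fun w hw => absurd (figureEight_sub w v) hw),
      (figureEight n).genus_eq, ← K.genus_eq, ← K.sum_deg] at h1
    rw [h1]
    refine Finset.sum_congr ?_ fun _ _ => rfl
    exact (Finset.filter_true_of_mem fun _ _ => figureEight_sub _ _).symm

theorem mk_spread_one {K : CombType 2 n} (hK : K.LoopsAndBridges) (hw : ∀ v, K.w v = 0)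
    (l : Cone K) : Mtrop.mk K (spread K l 1) = Mtrop.mk (figureEight n) fun _ => 2⁻¹ := by
  obtain ⟨c, hc⟩ := exists_contr_figureEight hK hw
  rw [mk_eq_of_contr c]
  · congr 1
    funext e
    have : ¬ K.IsBridge (c.edge e) := by
      have h : c.edge e ∈ Set.range c.edge := ⟨e, rfl⟩
      rw [hc] at h
      exact h
    simp [spread, this]
  · intro e he
    rw [hc] at he
    have : K.IsBridge e := not_not.1 he
    simp [spread, this]

theorem loopsAndBridges_of_mem {G : CombType 2 n} (hG : G ∈ stageTypes n 0) :
    G.LoopsAndBridges := by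
  refine hG.2.elim id fun h e he => ?_
  have h0 : G.nonBridges = ∅ := (Set.ncard_eq_zero (Set.toFinite _)).1 (by omega)
  exact absurd (show e ∈ G.nonBridges from he) (by simp [h0])

theorem mem_stageTypes_zero {K : CombType 2 n} (hK : K.LoopsAndBridges) (hw : ∀ v, K.w v = 0) :
    K ∈ stageTypes n 0 := ⟨mem_bridgeTypes hK hw, Or.inl hK⟩

theorem contractible_stage_zero : ContractibleSpace (slice (stageTypes n 0)) := by
  have hZ : ∀ G ∈ stageTypes n 0, G.looped.LoopsAndBridges := fun G hG =>
    (isExpansion_loopedContr _).loopsAndBridges G.looped.connected (loopsAndBridges_of_mem hG)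
  obtain ⟨F, hF⟩ := exists_slice_lift (contrClosed_stageTypes n 0) loopFlow
    (fun G hG H _ c l hl t => loopFlow_contr (loopsAndBridges_of_mem hG) c l hl t)
    (fun G _ => continuous_loopFlow G)
  have hmem : ∀ p, F p ∈ slice (stageTypes n 0) := by
    rintro ⟨⟨_, G, hG, l, hl, rfl⟩, t⟩
    rw [hF G hG l hl t]
    refine ⟨G.looped, mem_stageTypes_zero (hZ G hG) fun _ => rfl, _, ?_, rfl⟩
    exact sum_spread (hZ G hG) (fun _ => rfl) _ (by rw [sum_loopedLen, hl]) t
  have hfig : (figureEight n).LoopsAndBridges := fun e _ => figureEight_sub _ _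
  let y : slice (stageTypes n 0) := ⟨Mtrop.mk (figureEight n) fun _ => 2⁻¹, figureEight n,
    mem_stageTypes_zero hfig fun _ => rfl, _, by
      change ∑ _ : Bool, (2⁻¹ : ℝ≥0) = 1
      simp, rfl⟩
  rw [contractible_iff_id_nullhomotopic]
  refine ⟨y, ⟨⟨⟨fun p => ⟨F (p.2, p.1), hmem _⟩, by fun_prop⟩, ?_, ?_⟩⟩⟩
  · rintro ⟨_, G, hG, l, hl, rfl⟩
    refine Subtype.ext ?_
    change F (_, 0) = _
    rw [hF G hG l hl 0, loopFlow_zero]; rfl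
  · rintro ⟨_, G, hG, l, hl, rfl⟩
    refine Subtype.ext ?_
    change F (_, 1) = _
    rw [hF G hG l hl 1]
    exact mk_spread_one (hZ G hG) (fun _ => rfl) _

/-! ### The bridge locus as the top stage -/

theorem contractible_slice_stageTypes (k : ℕ) : ContractibleSpace (slice (stageTypes n k)) := by
  induction k with
  | zero => exact contractible_stage_zero
  | succ k ih => exact contractible_stage k ih

/-- Stability gives each vertex degree at least one, so there are at most `n + 2` vertices. In genus
two the number of edges exceeds that of vertices by at most one. -/
theorem ncard_nonBridges_le (G : CombType 2 n) : G.nonBridges.ncard ≤ n + 3 := by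
  have h1 := G.sum_deg
  have h2 := G.genus_eq
  have h3 : (Fintype.card G.V : ℤ) ≤ ∑ v, G.deg v := by
    have : ∑ _v : G.V, (1 : ℤ) ≤ ∑ v, G.deg v := Finset.sum_le_sum fun v _ => G.stable v
    simpa using this
  have h4 : (0 : ℤ) ≤ ∑ v, (G.w v : ℤ) := Finset.sum_nonneg fun v _ => by positivity
  have h5 := Set.ncard_le_card G.nonBridges
  rw [Nat.card_eq_fintype_card] at h5
  rw [h2] at h1
  rw [genus] at h2
  push_cast at h1 h2
  omega

theorem stageTypes_eq : stageTypes n (n + 3) = bridgeTypes 2 n :=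
  Set.ext fun G => ⟨fun h => h.1, fun h => ⟨h, Or.inr (ncard_nonBridges_le G)⟩⟩

/-- The right-hand side meets every cone in a finite union of faces and is therefore closed.
Conversely, such a point extends by zero to a type with a bridge, where adding a small constant to
all lengths approximates it by curves with a bridge. -/
theorem bridgeClosure_eq :
    bridgeClosure g n = {x | ∃ G ∈ bridgeTypes g n, ∃ l : Cone G, Mtrop.mk G l = x} := by
  refine Set.Subset.antisymm (closure_minimal ?_ ?_) ?_
  · rintro _ ⟨G, l, -, hb, rfl⟩
    exact ⟨G, ⟨G, hb, ⟨Contr.refl _⟩⟩, l, rfl⟩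
  · rw [← isQuotientMap_mk.isClosed_preimage, isClosed_sigma_iff]
    intro G
    have heq : Sigma.mk G ⁻¹' ((fun x : Σ G : CombType g n, Cone G => Mtrop.mk x.1 x.2) ⁻¹'
        {x | ∃ G ∈ bridgeTypes g n, ∃ l : Cone G, Mtrop.mk G l = x}) =
        ⋃ S : {S : Set G.E // G.contract S ∈ bridgeTypes g n}, ⋂ e : S.1, {l : Cone G | l e = 0} := by
      ext l
      simp only [Set.mem_iUnion, Set.mem_iInter, Set.mem_preimage, Set.mem_ofPred_eq]
      constructor
      · rintro ⟨H, hH, l', h⟩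
        exact ⟨⟨zeroSet l, contract_mem_of_mk_eq contrClosed_bridgeTypes hH h⟩, fun e => e.2⟩
      · rintro ⟨⟨S, hS⟩, h⟩
        refine ⟨G.contract S, hS, l ∘ (G.toContract S).edge,
          (mk_eq_of_contr (G.toContract S) l ?_).symm⟩
        intro e he
        rw [CombType.range_toContract, Set.notMem_compl_iff] at he
        exact h ⟨e, he⟩
    rw [heq]
    exact isClosed_iUnion_of_finite fun S => isClosed_iInter fun e =>
      isClosed_eq (continuous_apply e.1) continuous_const
  · rintro _ ⟨G, ⟨G₁, hb, ⟨c⟩⟩, l, rfl⟩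
    let l₁ : Cone G₁ := fun e => if h : ∃ f, c.edge f = e then l h.choose else 0
    have h1 : l₁ ∘ c.edge = l := by
      funext e
      have he : ∃ f, c.edge f = c.edge e := ⟨e, rfl⟩
      simp only [l₁, Function.comp_apply, dif_pos he]
      rw [c.edge_inj he.choose_spec]
    have h2 : Mtrop.mk G l = Mtrop.mk G₁ l₁ := by
      rw [mk_eq_of_contr c l₁ fun e he => dif_neg he, h1]
    rw [h2]
    have hlim : Filter.Tendsto (fun r : ℝ≥0 => Mtrop.mk G₁ fun e => l₁ e + r)
        (nhdsWithin 0 (Set.Ioi 0)) (nhds (Mtrop.mk G₁ l₁)) := by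
      have hc : Continuous fun r : ℝ≥0 => Mtrop.mk G₁ fun e => l₁ e + r :=
        (continuous_mk G₁).comp (by fun_prop)
      have := hc.tendsto 0
      simp only [add_zero] at this
      exact this.mono_left nhdsWithin_le_nhds
    refine mem_closure_of_tendsto hlim ?_
    filter_upwards [self_mem_nhdsWithin] with r hr
    exact ⟨G₁, _, fun e => add_pos_of_nonneg_of_pos zero_le hr, hb, rfl⟩

theorem bridgeLocus_eq : bridgeLocus g n = slice (bridgeTypes g n) := by
  ext x
  rw [bridgeLocus, bridgeClosure_eq]
  constructor
  · rintro ⟨⟨G, hG, l, rfl⟩, h⟩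
    exact ⟨G, hG, l, h, rfl⟩
  · rintro ⟨G, hG, l, hl, rfl⟩
    exact ⟨⟨G, hG, l, rfl⟩, hl⟩

end TropicalCurve

end

theorem theorem3p2 (n : ℕ) : ContractibleSpace (TropicalCurve.bridgeLocus 2 n) := by
  rw [TropicalCurve.bridgeLocus_eq, ← TropicalCurve.stageTypes_eq]
  exact TropicalCurve.contractible_slice_stageTypes _
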